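/- Let $G=(V,E)$ be a finite connected simple graph with $n=|V|\ge 2$, $m=|E|$, maximum degree $\Delta$ and degrees $d(v)$; let $\beta>0$ and $x=\tanh\beta\in(0,1)$. Let $\langle\cdot\rangle$ be the expectation under the zero-field ferromagnetic Ising measure on $\{\pm1\}^V$, with weights $\exp(\beta\sum_{uv\in E}\sigma_u\sigma_v)$, and let $\chi=\frac{\beta}{n}\sum_{u,v\in V}\langle\sigma_u\sigma_v\rangle$ be the susceptibility. For $A\subseteq E$ let $\partial A$ be the set of vertices of odd degree in $(V,A)$, let $\mathcal C_k=\{A\subseteq E:|\partial A|=k\}$, $\mathcal W=\mathcal C_0\cup\mathcal C_2$, and let $\pi$ be the probability measure on $\mathcal W$ with $\pi(A)\propto n\,x^{|A|}$ on $\mathcal C_0$ and $\pi(A)\propto 2\,x^{|A|}$ on $\mathcal C_2$. The lazy Prokofiev–Svistunov (PS) chain on $\mathcal W$ makes the following step from $A$. Choose $u$ uniformly from $V$ if $A\in\mathcal C_0$, and uniformly from $\partial A$ if $A\in\mathcal C_2$; choose a uniformly random neighbour $v$ of $u$; move to $A\triangle\{uv\}$ with probability $a$, and stay at $A$ otherwise.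 Here, with $r=1/x$ if $uv\in A$ and $r=x$ if $uv\notin A$, one has $a=\frac12\min\bigl(1,\frac{d(u)}{d(v)}r\bigr)$ if $A$ and $A\triangle\{uv\}$ both lie in $\mathcal C_2$, and $a=\frac12\min(1,r)$ otherwise. Put $$R(\delta)=\frac1{2x}\Bigl(\log\frac8x-\frac{\log\delta}{m}\Bigr)\Bigl(3+\frac1{mx}\Bigr)\Delta\,n^6m^2 .$$ For $A_0\in\mathcal W$, consider the following randomized algorithm with inputs $G$, $\beta$, $\epsilon$, $\eta$. For each $1\le j\le 7\lceil\log\eta^{-1}\rceil+1$ and each $1\le i\le 20\lceil(2n+1)\epsilon^{-2}+1\rceil$, independently run the PS chain from $A_0$ for $\lceil R(\epsilon/(16(2n+1)))\rceil$ steps and let $Y_{i,j}$ be the indicator that the final state lies in $\mathcal C_0$. Let $\overline Y_j$ be the mean over $i$ of the $Y_{i,j}$, and output the median $\mathcal Y_{\epsilon,\eta}$ of the $\overline Y_j$ (the mean of the two middle values if their number is even). Running time means the number of steps of a fixed program, which takes $n$, the adjacency matrix of $G$ (with $V=\{0,\dots,n-1\}$) and the reals $\beta,\epsilon,\eta$ as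 its input, on a unit-cost real RAM: integer variables with addition and subtraction, real variables and arrays with $+,-,\times,/,\exp,\log$ and comparison, loops whose every iteration is charged, uniformly random integers, and coins of given bias. A program is a fully polynomial randomized approximation scheme (fpras) for a quantity $f(G,\beta)$ if there is a polynomial $Q$ such that for all $G$ and $\beta$ as above and all $\epsilon,\eta\in(0,1/4)$ it always halts within $Q(n,\epsilon^{-1},\eta^{-1})$ steps, and its output $\mathcal Y$ satisfies $\mathbb P[(1-\epsilon)f\le\mathcal Y\le(1+\epsilon)f]\ge1-\eta$. Then the following hold. 1. $\pi(\mathcal C_0)\ge 1/(2n+1)$ and $\chi=\beta/\pi(\mathcal C_0)$. 2. For all $G,\beta$ as above, all $\epsilon,\eta\in(0,1/4)$ and all $A_0\in\mathcal W$, $$\mathbb P\bigl[(1-\epsilon)\pi(\mathcal C_0)\le\mathcal Y_{\epsilon,\eta}\le(1+\epsilon)\pi(\mathcal C_0)\bigr]\ge1-\eta,$$ $$\mathbb P\bigl[(1-\epsilon)\chi\le\beta/\mathcal Y_{\epsilon/2,\eta}\le(1+\epsilon)\chi\bigr]\ge1-\eta .$$ 3. There are a program and a polynomial $Q$ such that for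 all $G,\beta$ as above and all $\epsilon,\eta\in(0,1/4)$ the output of the program has the law of $\mathcal Y_{\epsilon,\eta}$ with $A_0=\emptyset$, and the program always halts within $Q(n,\epsilon^{-1},\eta^{-1},x^{-1})$ steps. In particular, for each fixed $\beta$ its running time is polynomial in $n,\epsilon^{-1},\eta^{-1}$. 4. There is an fpras for $\pi(\mathcal C_0)$, and there is an fpras for the Ising susceptibility $\chi$. -/

import Mathlib

open scoped ENNReal

namespace Worm

noncomputable section

/-! ### Finite probability helpers -/

/-- A coin showing `true` with probability `p` (clamped to `[0, 1]`). -/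
def coin (p : ℝ) : PMF Bool :=
  PMF.ofFintype (fun b => cond b (min 1 (ENNReal.ofReal p)) (1 - min 1 (ENNReal.ofReal p))) (by
    simp)

/-- Draw a uniformly random element `a` of `s` and continue with `f a`.
If there is nothing to draw from, do `d` instead. -/
def drawFrom {α γ : Type*} (s : Finset α) (d : PMF γ) (f : α → PMF γ) : PMF γ :=
  if h : s.Nonempty then (PMF.uniformOfFinset s h).bind f else d

/-- A list of `k` independent samples from `μ`. -/
def iid {α : Type*} (μ : PMF α) : ℕ → PMF (List α)
  | 0 => PMF.pure []
  | k + 1 => μ.bind fun a => (iid μ k).map fun l => a :: l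

/-- The arithmetic mean of a list of reals. -/
def mean (l : List ℝ) : ℝ := l.sum / l.length

/-- The median of a list of reals (the mean of the two middle entries if the length is even). -/
def median (l : List ℝ) : ℝ :=
  ((l.insertionSort (· ≤ ·)).getD ((l.length - 1) / 2) 0 +
    (l.insertionSort (· ≤ ·)).getD (l.length / 2) 0) / 2

section Model

variable {V : Type*} [Fintype V] [DecidableEq V]

/-! ### The zero-field ferromagnetic Ising model -/

/-- The spin of `v`, as a real number `±1`. -/
def spin (σ : V → ℤˣ) (v : V) : ℝ := ((σ v : ℤ) : ℝ)

/-- The product of the two spins at the ends of an edge. -/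
def edgeSpin (σ : V → ℤˣ) (e : Sym2 V) : ℝ :=
  Sym2.lift ⟨fun u v => spin σ u * spin σ v, fun _ _ => mul_comm _ _⟩ e

variable (G : SimpleGraph V) [DecidableRel G.Adj]

/-- The Boltzmann weight `exp (β ∑_{uv ∈ E} σ_u σ_v)`. -/
def boltzmann (β : ℝ) (σ : V → ℤˣ) : ℝ :=
  Real.exp (β * ∑ e ∈ G.edgeFinset, edgeSpin σ e)

/-- The Gibbs expectation of an observable `f`. -/
def gibbs (β : ℝ) (f : (V → ℤˣ) → ℝ) : ℝ :=
  (∑ σ, f σ * boltzmann G β σ) / ∑ σ, boltzmann G β σ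

/-- The susceptibility `χ = (β / n) ∑_{u, v} ⟨σ_u σ_v⟩`. -/
def susceptibility (β : ℝ) : ℝ :=
  β / Fintype.card V * ∑ u, ∑ v, gibbs G β fun σ => spin σ u * spin σ v

/-! ### High-temperature graphs and the PS measure -/

/-- The odd vertices of the spanning subgraph with edge set `A`. -/
def oddSet (A : Finset (Sym2 V)) : Finset V :=
  Finset.univ.filter fun v => Odd (A.filter fun e => v ∈ e).card

/-- The edge sets `A ⊆ E` with exactly `k` odd vertices. -/
def oddClass (k : ℕ) : Finset (Finset (Sym2 V)) :=
  G.edgeFinset.powerset.filter fun A => (oddSet A).card = k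

/-- The configuration space of the PS chain. -/
def psSpace : Finset (Finset (Sym2 V)) := oddClass G 0 ∪ oddClass G 2

/-- The unnormalised PS weight (only used on `psSpace G`). -/
def psWeight (x : ℝ) (A : Finset (Sym2 V)) : ℝ :=
  x ^ A.card * if oddSet A = ∅ then (Fintype.card V : ℝ) else 2

/-- The probability of an event `S` contained in `psSpace G` under the PS stationary measure. -/
def psProb (x : ℝ) (S : Finset (Finset (Sym2 V))) : ℝ :=
  (∑ A ∈ S, psWeight x A) / ∑ A ∈ psSpace G, psWeight x A

/-! ### The lazy PS (worm) chain -/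

/-- The acceptance probability of the move `A → A ∆ uv` started at the vertex `u`. -/
def acceptance (x : ℝ) (A : Finset (Sym2 V)) (u v : V) : ℝ :=
  let r : ℝ := if s(u, v) ∈ A then 1 / x else x
  if A ∈ oddClass G 2 ∧ symmDiff A {s(u, v)} ∈ oddClass G 2 ∧ u ∈ oddSet A then
    1 / 2 * min 1 ((G.degree u : ℝ) / (G.degree v : ℝ) * r)
  else
    1 / 2 * min 1 r

/-- One step of the PS chain. -/
def psStep (x : ℝ) (A : Finset (Sym2 V)) : PMF (Finset (Sym2 V)) :=
  drawFrom (if oddSet A = ∅ then Finset.univ else oddSet A) (PMF.pure A) fun u =>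
    drawFrom (G.neighborFinset u) (PMF.pure A) fun v =>
      (coin (acceptance G x A u v)).map fun b => if b then symmDiff A {s(u, v)} else A

/-- The law of the PS chain after `t` steps, started at `A`. -/
def psRun (x : ℝ) (A : Finset (Sym2 V)) : ℕ → PMF (Finset (Sym2 V))
  | 0 => PMF.pure A
  | t + 1 => (psRun x A t).bind (psStep G x)

/-! ### The median-of-means estimator -/

/-- The bound for the mixing time of the PS chain, as a function of the accuracy `δ`. -/
def mixBound (x δ : ℝ) : ℝ :=
  1 / (2 * x) * (Real.log (8 / x) - Real.log δ / G.edgeFinset.card) *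
    (3 + 1 / (G.edgeFinset.card * x)) * G.maxDegree * (Fintype.card V : ℝ) ^ 6 *
    (G.edgeFinset.card : ℝ) ^ 2

/-- The indicator of the event `S` at the end of one run of length
`⌈mixBound⌉` with `δ = ε / (16 s)`, started at `A₀`. -/
def oneSample (x : ℝ) (S : Finset (Finset (Sym2 V))) (s ε : ℝ) (A₀ : Finset (Sym2 V)) : PMF ℝ :=
  (psRun G x A₀ ⌈mixBound G x (ε / (16 * s))⌉₊).map fun A => if A ∈ S then 1 else 0

/-- The law of the output of the estimator of the probability of `S`: the median of
`7 ⌈log η⁻¹⌉ + 1` independent means, each over `20 ⌈s ε⁻² + 1⌉` independent runs from `A₀`. -/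
def estimator (x : ℝ) (S : Finset (Finset (Sym2 V))) (s ε η : ℝ) (A₀ : Finset (Sym2 V)) :
    PMF ℝ :=
  (iid ((iid (oneSample G x S s ε A₀) (20 * ⌈s * (ε ^ 2)⁻¹ + 1⌉₊)).map mean)
    (7 * ⌈Real.log η⁻¹⌉₊ + 1)).map median

/-- The estimator of the probability of the class of even subgraphs, with `s = 2 n + 1`
and `x = tanh β`. -/
def evenEstimator (β ε η : ℝ) (A₀ : Finset (Sym2 V)) : PMF ℝ :=
  estimator G (Real.tanh β) (oddClass G 0) (2 * Fintype.card V + 1) ε η A₀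

/-- The PS probability of the class of even subgraphs, with `x = tanh β`. -/
def evenProb (β : ℝ) : ℝ := psProb G (Real.tanh β) (oddClass G 0)

/-- The admissible inputs: a connected graph with at least two vertices, a positive inverse
temperature, and an accuracy `ε` and a failure probability `η` in `(0, 1/4)`. -/
structure Admissible {V : Type*} [Fintype V] (G : SimpleGraph V) (β ε η : ℝ) : Prop where
  two_le_card : 2 ≤ Fintype.card V
  connected : G.Connected
  beta_pos : 0 < β
  eps_pos : 0 < ε
  eps_lt : ε < 1 / 4
  eta_pos : 0 < η
  eta_lt : η < 1 / 4

end Model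

/-! ### Randomised programs on a unit-cost real RAM

Programs are finite pieces of syntax. The memory consists of integer variables, of real variables
and of two-dimensional real arrays that are indexed by integers. Integers are only added,
subtracted and drawn at random; they can be read as reals, but reals cannot be rounded. Each
arithmetic operation, memory access, comparison, random draw and loop iteration is charged one
time step. -/

/-- The memory. -/
structure Store where
  idx : ℕ → ℕ
  var : ℕ → ℝ
  arr : ℕ → ℕ → ℕ → ℝ

/-- Integer expressions, with values in `ℕ` and truncated subtraction. -/
inductive IExpr : Type
  | lit (k : ℕ)
  | idx (i : ℕ)
  | add (e f : IExpr)
  | sub (e f : IExpr)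

/-- The value of an integer expression. -/
def IExpr.eval (s : Store) : IExpr → ℕ
  | .lit k => k
  | .idx i => s.idx i
  | .add e f => e.eval s + f.eval s
  | .sub e f => e.eval s - f.eval s

/-- The time for the evaluation of an integer expression: one step per node. -/
def IExpr.cost : IExpr → ℕ
  | .lit _ => 1
  | .idx _ => 1
  | .add e f => 1 + e.cost + f.cost
  | .sub e f => 1 + e.cost + f.cost

/-- Real expressions. -/
inductive Expr : Type
  | int (i : IExpr)
  | var (x : ℕ)
  | get (a : ℕ) (i j : IExpr)
  | add (e f : Expr)
  | sub (e f : Expr)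
  | mul (e f : Expr)
  | div (e f : Expr)
  | exp (e : Expr)
  | log (e : Expr)

/-- The value of a real expression. -/
def Expr.eval (s : Store) : Expr → ℝ
  | .int i => (i.eval s : ℝ)
  | .var x => s.var x
  | .get a i j => s.arr a (i.eval s) (j.eval s)
  | .add e f => e.eval s + f.eval s
  | .sub e f => e.eval s - f.eval s
  | .mul e f => e.eval s * f.eval s
  | .div e f => e.eval s / f.eval s
  | .exp e => Real.exp (e.eval s)
  | .log e => Real.log (e.eval s)

/-- The time for the evaluation of a real expression: one step per node. -/
def Expr.cost : Expr → ℕ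
  | .int i => 1 + i.cost
  | .var _ => 1
  | .get _ i j => 1 + i.cost + j.cost
  | .add e f => 1 + e.cost + f.cost
  | .sub e f => 1 + e.cost + f.cost
  | .mul e f => 1 + e.cost + f.cost
  | .div e f => 1 + e.cost + f.cost
  | .exp e => 1 + e.cost
  | .log e => 1 + e.cost

/-- Programs. `ifLt e f c d` runs `c` if `e < f` and `d` otherwise; `loop e c` runs `c`
exactly `max 0 ⌈e⌉` times, with `e` evaluated once at the start; `uniform i e` draws the integer
variable `i` uniformly from `{0, …, e - 1}` (and does nothing if this set is empty); `flip i e`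
sets the integer variable `i` to `1` with probability `e` (clamped to `[0, 1]`) and to `0`
otherwise. -/
inductive Program : Type
  | skip
  | assignIdx (i : ℕ) (e : IExpr)
  | assign (x : ℕ) (e : Expr)
  | store (a : ℕ) (i j : IExpr) (e : Expr)
  | seq (c d : Program)
  | ifLt (e f : Expr) (c d : Program)
  | loop (e : Expr) (c : Program)
  | uniform (i : ℕ) (e : IExpr)
  | flip (i : ℕ) (e : Expr)

/-- Overwrite an integer variable. -/
def Store.setIdx (s : Store) (i k : ℕ) : Store :=
  { s with idx := fun j => if j = i then k else s.idx j }

/-- Overwrite a real variable. -/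
def Store.setVar (s : Store) (x : ℕ) (r : ℝ) : Store :=
  { s with var := fun y => if y = x then r else s.var y }

/-- Overwrite an array entry. -/
def Store.setArr (s : Store) (a i j : ℕ) (r : ℝ) : Store :=
  { s with arr := fun b k l => if b = a ∧ k = i ∧ l = j then r else s.arr b k l }

/-- Add `k` to the running time. -/
def charge (k : ℕ) (p : PMF (Store × ℕ)) : PMF (Store × ℕ) := p.map fun r => (r.1, k + r.2)

/-- `k`-fold iteration, with one extra time step per iteration. -/
def iterRun (f : Store → PMF (Store × ℕ)) : ℕ → Store → PMF (Store × ℕ)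
  | 0, s => PMF.pure (s, 0)
  | k + 1, s => (f s).bind fun r => charge (1 + r.2) (iterRun f k r.1)

/-- The joint law of the final memory and the running time of a program. -/
def Program.run : Program → Store → PMF (Store × ℕ)
  | .skip => fun s => PMF.pure (s, 1)
  | .assignIdx i e => fun s => PMF.pure (s.setIdx i (e.eval s), 1 + e.cost)
  | .assign x e => fun s => PMF.pure (s.setVar x (e.eval s), 1 + e.cost)
  | .store a i j e => fun s =>
      PMF.pure (s.setArr a (i.eval s) (j.eval s) (e.eval s), 1 + i.cost + j.cost + e.cost)
  | .seq c d => fun s => (c.run s).bind fun r => charge r.2 (d.run r.1)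
  | .ifLt e f c d => fun s =>
      charge (1 + e.cost + f.cost) (if e.eval s < f.eval s then c.run s else d.run s)
  | .loop e c => fun s => charge (1 + e.cost) (iterRun c.run ⌈e.eval s⌉₊ s)
  | .uniform i e => fun s =>
      drawFrom (Finset.range (e.eval s)) (PMF.pure (s, 1 + e.cost)) fun k =>
        PMF.pure (s.setIdx i k, 1 + e.cost)
  | .flip i e => fun s =>
      (coin (e.eval s)).map fun b => (s.setIdx i (if b then 1 else 0), 1 + e.cost)

/-- The initial memory: `n` in the integer variable `0`, `β, ε, η` in the real variables `0, 1, 2`,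
the adjacency matrix of `G` in the array `0`, and zeros everywhere else. -/
def input {n : ℕ} (G : SimpleGraph (Fin n)) [DecidableRel G.Adj] (β ε η : ℝ) : Store where
  idx := fun i => if i = 0 then n else 0
  var := fun x => if x = 0 then β else if x = 1 then ε else if x = 2 then η else 0
  arr := fun a i j =>
    if h : a = 0 ∧ i < n ∧ j < n then
      if G.Adj ⟨i, h.2.1⟩ ⟨j, h.2.2⟩ then 1 else 0
    else 0

/-- The law of the output of a program, which is read off the real variable `0`. -/
def Program.output (p : Program) (s : Store) : PMF ℝ := (p.run s).map fun r => r.1.var 0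

/-- Every execution of `p` from `s` takes at most `T` time steps. -/
def Program.RunsWithin (p : Program) (s : Store) (T : ℝ) : Prop :=
  ∀ r ∈ (p.run s).support, (r.2 : ℝ) ≤ T

/-- `p` is a fully polynomial randomised approximation scheme for the quantity `f G β`: its
running time is bounded by a polynomial in `n`, `ε⁻¹` and `η⁻¹` (which depends neither on `G` nor
on `β`), and with probability at least `1 - η` its output has relative error at most `ε`. -/
def IsFPRAS (p : Program)
    (f : ∀ {n : ℕ} (G : SimpleGraph (Fin n)) [DecidableRel G.Adj], ℝ → ℝ) : Prop :=
  ∃ Q : MvPolynomial (Fin 3) ℝ,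
    ∀ (n : ℕ) (G : SimpleGraph (Fin n)) [DecidableRel G.Adj] (β ε η : ℝ), Admissible G β ε η →
      p.RunsWithin (input G β ε η) (MvPolynomial.eval ![(n : ℝ), ε⁻¹, η⁻¹] Q) ∧
      ENNReal.ofReal (1 - η) ≤ (p.output (input G β ε η)).toOuterMeasure
        {y | (1 - ε) * f G β ≤ y ∧ y ≤ (1 + ε) * f G β}

end

end Worm

open Worm

/-! Write Z_S for the sum of x^|A| over the edge sets A with boundary S (`oddWeight`). For s = ±1
one has exp(βs) = cosh β · (1 + x s), so expanding the Boltzmann weight and using the orthogonality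
of spin products gives ⟨σ_u σ_v⟩ = Z_{u△v} / Z_∅. The number of ordered pairs (u,v) with {u} △ {v} =
S is n if S is empty and 2 if |S| = 2. These are the factors in π, so the normaliser of π is the sum
of Z_{u△v} over all u, v, and χ = β / π(C₀) (`susceptibility_eq`). The spin representation also
shows Z_S ≤ Z_∅ (`oddWeight_le`), whence π(C₀) ≥ 1/n.

The chain mixes because of canonical paths. From I in the PS space to an even F, remove the edges of
I △ F one at a time without leaving the PS space; adding the even set F mod 2 to what is left gives
the path. A move on this path, together with the complementary set N = I △ D_j, determines I, F and
j. The sizes satisfy |T| + |N| = |I| + |F|, where T is the current state, and N has at most four odd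
vertices, so all codes together weigh at most n⁴/4 · Z_∅. This yields a Poincaré inequality with
constant mΔn⁵/x (`poincare_psChain`). For a lazy reversible chain such an inequality contracts the
variance at every step (`IsLazyReversible.sum_iterate_sq_le`), and R(δ) steps bring the probability
of any event within δ of its stationary value, from every initial state
(`abs_hitProb_sub_psProb_le`).

For the estimator, the bias is at most ε π(C₀) / 16, Chebyshev's inequality makes each mean bad with
probability at most 1/16, and an exponential moment bound makes the median bad with probability at
most η (`evenEstimator_accurate`).

The programs are analysed with two judgements. `Safe` gives a postcondition and a time bound that
hold for every outcome. `Impl` couples the outcome of a program with a prescribed law; composing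
such couplings along the syntax identifies the output law of `mainProg` exactly (`output_mainProg`).

The time of `mainProg` is polynomial in n, 1/ε, 1/η and 1/x. An fpras must not depend on 1/x. If n²x
< ε, then π(C₀) ≥ 1/(1 + n²x) shows that the constant answers 1 and β are accurate enough; otherwise
1/x ≤ n²/ε, and the dependence on 1/x disappears. -/

namespace Worm

noncomputable section

/-! ### Expectations of nonnegative functions under a `PMF` -/

/-- The expectation of a nonnegative function. -/
def expect {α : Type*} (μ : PMF α) (f : α → ℝ≥0∞) : ℝ≥0∞ := ∑' a, μ a * f a

section Expect

variable {α γ : Type*}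

theorem expect_pure (a : α) (f : α → ℝ≥0∞) : expect (PMF.pure a) f = f a := by
  classical
  unfold expect
  rw [tsum_eq_single a]
  · simp
  · intro b hb
    simp [PMF.pure_apply, hb]

theorem expect_bind (μ : PMF α) (k : α → PMF γ) (f : γ → ℝ≥0∞) :
    expect (μ.bind k) f = expect μ fun a => expect (k a) f := by
  unfold expect
  simp only [PMF.bind_apply, ← ENNReal.tsum_mul_right, ← ENNReal.tsum_mul_left]
  rw [ENNReal.tsum_comm]
  simp only [mul_assoc]

theorem expect_map (μ : PMF α) (g : α → γ) (f : γ → ℝ≥0∞) :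
    expect (μ.map g) f = expect μ (f ∘ g) := by
  rw [PMF.map, expect_bind]
  simp only [Function.comp_apply, expect_pure]
  rfl

theorem expect_mono {μ : PMF α} {f g : α → ℝ≥0∞} (h : ∀ a ∈ μ.support, f a ≤ g a) :
    expect μ f ≤ expect μ g := by
  refine ENNReal.tsum_le_tsum fun a => ?_
  by_cases ha : μ a = 0
  · simp [ha]
  · gcongr
    exact h a ((PMF.mem_support_iff _ _).2 ha)

theorem expect_congr {μ : PMF α} {f g : α → ℝ≥0∞} (h : ∀ a ∈ μ.support, f a = g a) :
    expect μ f = expect μ g :=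
  le_antisymm (expect_mono fun a ha => (h a ha).le) (expect_mono fun a ha => (h a ha).ge)

theorem expect_const (μ : PMF α) (c : ℝ≥0∞) : expect μ (fun _ => c) = c := by
  rw [expect, ENNReal.tsum_mul_right, μ.tsum_coe, one_mul]

theorem expect_mul_left (μ : PMF α) (c : ℝ≥0∞) (f : α → ℝ≥0∞) :
    expect μ (fun a => c * f a) = c * expect μ f := by
  simp only [expect, ← ENNReal.tsum_mul_left, mul_left_comm]

theorem expect_add (μ : PMF α) (f g : α → ℝ≥0∞) :
    expect μ (fun a => f a + g a) = expect μ f + expect μ g := by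
  simp only [expect, mul_add, ENNReal.tsum_add]

theorem toOuterMeasure_eq_expect (μ : PMF α) (S : Set α) :
    μ.toOuterMeasure S = expect μ (S.indicator 1) := by
  rw [PMF.toOuterMeasure_apply, expect]
  refine tsum_congr fun a => ?_
  by_cases h : a ∈ S <;> simp [h]

theorem toOuterMeasure_mul_le_expect {μ : PMF α} {S : Set α} {f : α → ℝ≥0∞} {c : ℝ≥0∞}
    (h : ∀ a ∈ μ.support, a ∈ S → c ≤ f a) : c * μ.toOuterMeasure S ≤ expect μ f := by
  rw [toOuterMeasure_eq_expect, ← expect_mul_left]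
  refine expect_mono fun a ha => ?_
  by_cases hS : a ∈ S
  · simpa [hS] using h a ha hS
  · simp [hS]

theorem toOuterMeasure_add_compl (μ : PMF α) (S : Set α) :
    μ.toOuterMeasure S + μ.toOuterMeasure Sᶜ = 1 := by
  rw [toOuterMeasure_eq_expect, toOuterMeasure_eq_expect, ← expect_add]
  refine (expect_congr fun a _ => ?_).trans (expect_const μ 1)
  by_cases h : a ∈ S <;> simp [h]

theorem toOuterMeasure_le_one (μ : PMF α) (S : Set α) : μ.toOuterMeasure S ≤ 1 := by
  rw [← toOuterMeasure_add_compl μ S]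
  exact le_self_add

theorem ofReal_one_sub_le_toOuterMeasure {μ : PMF α} {S : Set α} {η : ℝ} (hη : 0 ≤ η)
    (h : μ.toOuterMeasure Sᶜ ≤ ENNReal.ofReal η) :
    ENNReal.ofReal (1 - η) ≤ μ.toOuterMeasure S := by
  rw [ENNReal.ofReal_sub _ hη, ENNReal.ofReal_one, tsub_le_iff_right,
    ← toOuterMeasure_add_compl μ S]
  gcongr

theorem toOuterMeasure_mono_support {μ : PMF α} {S T : Set α}
    (h : ∀ a ∈ μ.support, a ∈ S → a ∈ T) : μ.toOuterMeasure S ≤ μ.toOuterMeasure T := by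
  have := toOuterMeasure_mul_le_expect (μ := μ) (S := S) (c := 1) (f := T.indicator 1)
    fun a ha hS => by simp [h a ha hS]
  rwa [one_mul, ← toOuterMeasure_eq_expect] at this

end Expect

/-! ### Independent samples -/

section Iid

variable {α : Type*}

theorem length_of_mem_support_iid {μ : PMF α} {k : ℕ} {l : List α}
    (h : l ∈ (iid μ k).support) : l.length = k := by
  induction k generalizing l with
  | zero => simp_all [iid]
  | succ k ih =>
    simp only [iid, PMF.support_bind, PMF.support_map, Set.mem_iUnion, Set.mem_image] at h
    obtain ⟨a, -, l', hl', rfl⟩ := h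
    simp [ih hl']

theorem expect_iid_succ (μ : PMF α) (k : ℕ) (f : List α → ℝ≥0∞) :
    expect (iid μ (k + 1)) f = expect μ fun a => expect (iid μ k) fun l => f (a :: l) := by
  rw [iid, expect_bind]
  simp only [expect_map]
  rfl

/-- The law `μ` gives mass `p` to `1` and mass `1 - p` to `0`. -/
def IsBernoulli (μ : PMF ℝ) (p : ℝ) : Prop :=
  ∀ f : ℝ → ℝ≥0∞, expect μ f = ENNReal.ofReal p * f 1 + ENNReal.ofReal (1 - p) * f 0

theorem isBernoulli_map_indicator [DecidableEq α] (μ : PMF α) (S : Finset α) :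
    IsBernoulli (μ.map fun a => if a ∈ S then (1 : ℝ) else 0)
      (μ.toOuterMeasure (S : Set α)).toReal := by
  intro f
  have h1 := toOuterMeasure_le_one μ (S : Set α)
  have hne : μ.toOuterMeasure (S : Set α) ≠ ⊤ := ne_top_of_le_ne_top ENNReal.one_ne_top h1
  have hc : ENNReal.ofReal (1 - (μ.toOuterMeasure (S : Set α)).toReal) =
      μ.toOuterMeasure (S : Set α)ᶜ := by
    rw [ENNReal.ofReal_sub _ ENNReal.toReal_nonneg, ENNReal.ofReal_one,
      ENNReal.ofReal_toReal hne, ← toOuterMeasure_add_compl μ (S : Set α),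
      ENNReal.add_sub_cancel_left hne]
  rw [hc, ENNReal.ofReal_toReal hne, expect_map, toOuterMeasure_eq_expect,
    toOuterMeasure_eq_expect, mul_comm _ (f 1), mul_comm _ (f 0), ← expect_mul_left,
    ← expect_mul_left, ← expect_add]
  refine expect_congr fun a _ => ?_
  by_cases h : a ∈ S <;> simp [h]

/-- Variance plus squared bias of a sum. The centre `c` is kept free for the induction: splitting
off a first sample `a` replaces `c` by `c - a`. -/
theorem expect_iid_sq {μ : PMF ℝ} {p : ℝ} (h : IsBernoulli μ p) (h0 : 0 ≤ p) (h1 : p ≤ 1)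
    (k : ℕ) (c : ℝ) : expect (iid μ k) (fun l => ENNReal.ofReal ((l.sum - c) ^ 2)) =
      ENNReal.ofReal (k * (p * (1 - p)) + (k * p - c) ^ 2) := by
  have h1' : 0 ≤ 1 - p := by linarith
  induction k generalizing c with
  | zero => simp [iid, expect_pure]
  | succ k ih =>
    have hs (a : ℝ) : expect (iid μ k) (fun l => ENNReal.ofReal (((a :: l).sum - c) ^ 2)) =
        ENNReal.ofReal (k * (p * (1 - p)) + (k * p - (c - a)) ^ 2) := by
      rw [← ih (c - a)]
      congr 1
      funext l
      rw [List.sum_cons]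
      ring_nf
    rw [expect_iid_succ]
    simp only [hs]
    rw [h, ← ENNReal.ofReal_mul h0, ← ENNReal.ofReal_mul h1', ← ENNReal.ofReal_add]
    · congr 1
      push_cast
      ring
    · positivity
    · positivity

/-- Chebyshev's inequality for the mean of independent indicators. -/
theorem toOuterMeasure_mean_le {μ : PMF ℝ} {p t : ℝ} (h : IsBernoulli μ p) (h0 : 0 ≤ p)
    (h1 : p ≤ 1) {k : ℕ} (hk : 0 < k) (ht : 0 < t) :
    ((iid μ k).map mean).toOuterMeasure {y | t < |y - p|} ≤
      ENNReal.ofReal (p * (1 - p) / (k * t ^ 2)) := by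
  have hk' : (0 : ℝ) < k := by exact_mod_cast hk
  -- Markov's inequality for the squared deviation of the sum. Centring at `k * p` leaves only the
  -- variance.
  have key : ENNReal.ofReal ((k * t) ^ 2) *
      (iid μ k).toOuterMeasure (mean ⁻¹' {y | t < |y - p|}) ≤
      ENNReal.ofReal (k * (p * (1 - p)) + (k * p - k * p) ^ 2) := by
    rw [← expect_iid_sq h h0 h1]
    refine toOuterMeasure_mul_le_expect fun l hl hS => ENNReal.ofReal_le_ofReal ?_
    simp only [Set.mem_preimage, Set.mem_ofPred_eq, mean, length_of_mem_support_iid hl] at hS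
    rw [← sq_abs (l.sum - _)]
    have : |l.sum - k * p| = k * |l.sum / k - p| := by
      rw [← abs_of_pos hk', ← abs_mul, abs_of_pos hk']
      congr 1
      field_simp
    rw [this]
    gcongr
  rw [PMF.toOuterMeasure_map_apply]
  have hpos : (0 : ℝ) < (k * t) ^ 2 := by positivity
  rw [mul_comm, ← ENNReal.le_div_iff_mul_le (Or.inl (by simpa using hpos.ne'))
    (Or.inl ENNReal.ofReal_ne_top), ← ENNReal.ofReal_div_of_pos hpos] at key
  refine key.trans (ENNReal.ofReal_le_ofReal (le_of_eq ?_))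
  rw [sub_self]
  field_simp
  ring

open Classical in
-- Exponential moments of a count factorise over independent samples; this is what makes the failure
-- probability of the median decay geometrically in `k`.
theorem expect_iid_pow_countP (μ : PMF α) (B : Set α) (z : ℝ≥0∞) (k : ℕ) :
    expect (iid μ k) (fun l => z ^ l.countP (· ∈ B)) =
      (expect μ fun a => if a ∈ B then z else 1) ^ k := by
  induction k with
  | zero => simp [iid, expect_pure]
  | succ k ih =>
    rw [expect_iid_succ, pow_succ, mul_comm, ← ih]
    rw [mul_comm, ← expect_mul_left]
    congr 1
    funext a
    rw [mul_comm, ← expect_mul_left]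
    congr 1
    funext l
    by_cases h : a ∈ B
    · simp [h, pow_succ, mul_comm]
    · simp [h]

open Classical in
/-- If bad samples have probability at most `1/16`, then half of `k` independent samples are bad
with probability at most `2⁻ᵏ`. -/
theorem toOuterMeasure_half_bad_le {μ : PMF α} {B : Set α}
    (hB : μ.toOuterMeasure B ≤ 16⁻¹) (k : ℕ) :
    (iid μ k).toOuterMeasure {l | k ≤ 2 * l.countP (· ∈ B)} ≤ 2⁻¹ ^ k := by
  -- The base 16 balances the two sides: the moment of one sample is at most 16/16 + 1 = 2, while
  -- half of the samples being bad makes the product at least 16^(k/2) = 4^k.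
  have h2 : (expect μ fun a => if a ∈ B then (16 : ℝ≥0∞) else 1) ≤ 2 := by
    calc (expect μ fun a => if a ∈ B then (16 : ℝ≥0∞) else 1)
        ≤ expect μ (fun a => 16 * B.indicator 1 a + 1) :=
          expect_mono fun a _ => by by_cases h : a ∈ B <;> simp [h]
      _ = 16 * μ.toOuterMeasure B + 1 := by
          rw [expect_add, expect_mul_left, expect_const, toOuterMeasure_eq_expect]
      _ ≤ 16 * 16⁻¹ + 1 := by gcongr
      _ = 2 := by
          rw [ENNReal.mul_inv_cancel (by norm_num) (by norm_num)]
          norm_num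
  have key : (4 : ℝ≥0∞) ^ k * (iid μ k).toOuterMeasure {l | k ≤ 2 * l.countP (· ∈ B)} ≤
      2 ^ k := by
    refine (toOuterMeasure_mul_le_expect (f := fun l => 16 ^ l.countP (· ∈ B))
      fun l _ hl => ?_).trans ?_
    · calc (4 : ℝ≥0∞) ^ k ≤ 4 ^ (2 * l.countP (· ∈ B)) :=
            pow_le_pow_right₀ (by norm_num) hl
        _ = 16 ^ l.countP (· ∈ B) := by rw [pow_mul]; norm_num
    · rw [expect_iid_pow_countP]
      gcongr
  have h4 : (4 : ℝ≥0∞) ^ k = 2 ^ k * 2 ^ k := by rw [← mul_pow]; norm_num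
  have hne : (2 : ℝ≥0∞) ^ k ≠ 0 := by simp
  have hnt : (2 : ℝ≥0∞) ^ k ≠ ⊤ := by simp
  rw [h4, mul_assoc] at key
  have key2 : 2 ^ k * (iid μ k).toOuterMeasure {l | k ≤ 2 * l.countP (· ∈ B)} ≤ 1 := by
    rw [← ENNReal.mul_le_mul_iff_right hne hnt, mul_one]
    exact key
  rw [← ENNReal.inv_pow, ← one_div]
  rw [ENNReal.le_div_iff_mul_le (Or.inl hne) (Or.inl hnt), mul_comm]
  exact key2

end Iid

/-! ### The median -/

/-- The window of positions from `i` to `j - 1` is a sublist. In a sorted list this converts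
statements about positions into statements about counts, both for the accuracy of the median and for
its computation. -/
theorem le_countP_of_forall_getElem {l : List ℝ} {q : ℝ → Prop} [DecidablePred q] {i j : ℕ}
    (hj : j ≤ l.length) (h : ∀ m (hm : m < l.length), i ≤ m → m < j → q l[m]) :
    j - i ≤ l.countP (q ·) := by
  have hsub : ((l.take j).drop i).Sublist l :=
    ((l.take j).drop_sublist i).trans (l.take_sublist j)
  calc j - i = ((l.take j).drop i).length := by simp [hj]
    _ = ((l.take j).drop i).countP (q ·) := by
        symm
        rw [List.countP_eq_length]
        intro a ha
        obtain ⟨m, hm, rfl⟩ := List.getElem_of_mem ha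
        simp only [List.length_drop, List.length_take] at hm
        simp only [List.getElem_drop, List.getElem_take, decide_eq_true_eq]
        exact h _ (by omega) (by omega) (by omega)
    _ ≤ l.countP (q ·) := hsub.countP_le

theorem pairwise_insertionSort_le (l : List ℝ) :
    (l.insertionSort (· ≤ ·)).Pairwise (· ≤ ·) := List.pairwise_insertionSort _ l

open Classical in
/-- If fewer than half of the entries lie outside `[a, b]`, then so does the median. -/
theorem median_mem_Icc {l : List ℝ} {a b : ℝ}
    (h : 2 * l.countP (· ∈ (Set.Icc a b)ᶜ) < l.length) : median l ∈ Set.Icc a b := by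
  set L := l.insertionSort (· ≤ ·) with hL
  have hperm : L.Perm l := List.perm_insertionSort _ l
  have hlen : L.length = l.length := hperm.length_eq
  have hcount : L.countP (· ∈ (Set.Icc a b)ᶜ) = l.countP (· ∈ (Set.Icc a b)ᶜ) :=
    hperm.countP_eq _
  have hsort : L.Pairwise (· ≤ ·) := pairwise_insertionSort_le l
  have hmono : ∀ i j (hi : i < L.length) (hj : j < L.length), i ≤ j → L[i] ≤ L[j] := by
    intro i j hi hj hij
    rcases hij.eq_or_lt with rfl | hlt
    · exact le_rfl
    · exact List.pairwise_iff_getElem.1 hsort i j hi hj hlt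
  -- If a sorted entry lies below `a`, so do all entries before it; if it lies above `b`, so do all
  -- entries after it. At a middle position either case produces at least half of the list outside
  -- the interval.
  have mid : ∀ i (hi : i < L.length), L.length ≤ 2 * (i + 1) → 2 * i ≤ L.length →
      L[i] ∈ Set.Icc a b := by
    intro i hi hlo hhi
    by_contra hmem
    rw [Set.mem_Icc, not_and_or, not_le, not_le] at hmem
    rcases hmem with hlt | hgt
    · have := le_countP_of_forall_getElem (l := L) (q := (· ∈ (Set.Icc a b)ᶜ)) (i := 0)
        (j := i + 1) (by omega) fun m hm _ hmi => by
          simp only [Set.mem_compl_iff, Set.mem_Icc, not_and_or, not_le]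
          exact Or.inl ((hmono m i hm hi (by omega)).trans_lt hlt)
      omega
    · have := le_countP_of_forall_getElem (l := L) (q := (· ∈ (Set.Icc a b)ᶜ)) (i := i)
        (j := L.length) le_rfl fun m hm hmi _ => by
          simp only [Set.mem_compl_iff, Set.mem_Icc, not_and_or, not_le]
          exact Or.inr (hgt.trans_le (hmono i m hi hm hmi))
      omega
  have hpos : 0 < l.length := by omega
  have h1 : (l.length - 1) / 2 < L.length := by omega
  have h2 : l.length / 2 < L.length := by omega
  have m1 := mid _ h1 (by omega) (by omega)
  have m2 := mid _ h2 (by omega) (by omega)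
  rw [median, ← hL, List.getD_eq_getElem _ _ h1, List.getD_eq_getElem _ _ h2]
  constructor <;> linarith [m1.1, m1.2, m2.1, m2.2]

/-- The median of `7 ⌈log η⁻¹⌉ + 1` independent samples, each of which lies in `[a, b]` with
probability at least `15/16`, lies in `[a, b]` with probability at least `1 - η`. -/
theorem le_toOuterMeasure_median {μ : PMF ℝ} {a b η : ℝ}
    (hμ : μ.toOuterMeasure (Set.Icc a b)ᶜ ≤ 16⁻¹) (hη : 0 < η) :
    ENNReal.ofReal (1 - η) ≤
      ((iid μ (7 * ⌈Real.log η⁻¹⌉₊ + 1)).map median).toOuterMeasure (Set.Icc a b) := by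
  classical
  refine ofReal_one_sub_le_toOuterMeasure hη.le ?_
  set k := 7 * ⌈Real.log η⁻¹⌉₊ + 1 with hk
  rw [PMF.toOuterMeasure_map_apply]
  calc (iid μ k).toOuterMeasure (median ⁻¹' (Set.Icc a b)ᶜ)
      ≤ (iid μ k).toOuterMeasure {l | k ≤ 2 * l.countP (· ∈ (Set.Icc a b)ᶜ)} := by
        refine toOuterMeasure_mono_support fun l hl hm => ?_
        by_contra hcon
        rw [Set.mem_ofPred_eq, not_le, ← length_of_mem_support_iid hl] at hcon
        exact hm (median_mem_Icc hcon)
    _ ≤ 2⁻¹ ^ k := by convert toOuterMeasure_half_bad_le hμ k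
    _ = ENNReal.ofReal ((2 : ℝ)⁻¹ ^ k) := by
        rw [ENNReal.ofReal_pow (by norm_num), ENNReal.ofReal_inv_of_pos (by norm_num)]
        norm_num
    _ ≤ ENNReal.ofReal η := by
        refine ENNReal.ofReal_le_ofReal ?_
        rw [← Real.log_le_log_iff (by positivity) hη, Real.log_pow, Real.log_inv]
        have h1 : Real.log η⁻¹ ≤ ⌈Real.log η⁻¹⌉₊ := Nat.le_ceil _
        rw [Real.log_inv] at h1
        have h2 : (0 : ℝ) ≤ (⌈-Real.log η⌉₊ : ℝ) := by positivity
        -- All that matters is 7 log 2 ≥ 1, so that 2^(-7L) ≤ exp(-L).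
        have h3 := Real.log_two_gt_d9
        rw [hk, Real.log_inv]
        push_cast
        nlinarith

/-! ### Odd vertices -/

section Odd

variable {V : Type*} [Fintype V] [DecidableEq V]

theorem odd_card_symmDiff {α : Type*} [DecidableEq α] (S T : Finset α) :
    Odd (symmDiff S T).card ↔ ¬(Odd S.card ↔ Odd T.card) := by
  have h1 : (symmDiff S T).card = (S \ T).card + (T \ S).card := by
    rw [symmDiff_def, Finset.sup_eq_union, Finset.card_union_of_disjoint]
    exact disjoint_sdiff_sdiff
  have h2 := Finset.card_sdiff_add_card_inter S T
  have h3 := Finset.card_sdiff_add_card_inter T S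
  rw [Finset.inter_comm] at h3
  simp only [Nat.odd_iff]
  omega

theorem filter_symmDiff' {α : Type*} [DecidableEq α] (S T : Finset α) (p : α → Prop)
    [DecidablePred p] :
    (symmDiff S T).filter p = symmDiff (S.filter p) (T.filter p) := by
  ext a
  simp only [Finset.mem_filter, Finset.mem_symmDiff]
  tauto

theorem mem_oddSet {A : Finset (Sym2 V)} {v : V} :
    v ∈ oddSet A ↔ Odd (A.filter fun e => v ∈ e).card := by
  simp [oddSet]

/-- The boundary map is linear over the field with two elements. All later computations of odd
vertices rest on this. -/
theorem oddSet_symmDiff (A B : Finset (Sym2 V)) :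
    oddSet (symmDiff A B) = symmDiff (oddSet A) (oddSet B) := by
  ext v
  rw [mem_oddSet, filter_symmDiff', odd_card_symmDiff, Finset.mem_symmDiff, mem_oddSet, mem_oddSet]
  tauto

theorem oddSet_empty : oddSet (∅ : Finset (Sym2 V)) = ∅ := by
  ext v
  simp [mem_oddSet]

theorem oddSet_singleton {u v : V} (h : u ≠ v) :
    oddSet {s(u, v)} = symmDiff {u} {v} := by
  ext w
  rw [mem_oddSet, Finset.filter_singleton, Finset.mem_symmDiff]
  simp only [Sym2.mem_iff, Finset.mem_singleton]
  by_cases hu : w = u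
  · subst hu
    simp [h]
  · by_cases hv : w = v
    · subst hv
      simp [hu]
    · simp [hu, hv]

theorem symmDiff_singleton_pair {u v : V} (h : u ≠ v) :
    symmDiff ({u} : Finset V) {v} = {u, v} := by
  ext w
  simp only [Finset.mem_symmDiff, Finset.mem_singleton, Finset.mem_insert]
  constructor
  · tauto
  · rintro (rfl | rfl)
    · exact Or.inl ⟨rfl, h⟩
    · exact Or.inr ⟨rfl, h.symm⟩

theorem card_symmDiff_singleton {u v : V} (h : u ≠ v) :
    (symmDiff ({u} : Finset V) {v}).card = 2 := by
  rw [symmDiff_singleton_pair h, Finset.card_pair h]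

theorem symmDiff_pair_eq_empty {u v : V} : symmDiff ({u} : Finset V) {v} = ∅ ↔ u = v := by
  rw [← Finset.bot_eq_empty, symmDiff_eq_bot, Finset.singleton_inj]

/-- Handshake lemma mod 2: inserting an edge adds a pair of vertices to the boundary mod 2 and so
preserves the parity of its size. It makes `≤ 2` and `= 0 or = 2` interchangeable in the PS space.
-/
theorem even_card_oddSet {A : Finset (Sym2 V)} (hA : ∀ e ∈ A, ¬e.IsDiag) :
    Even (oddSet A).card := by
  induction A using Finset.induction with
  | empty => simp [oddSet_empty]
  | insert e A he ih =>
    have hins : insert e A = symmDiff A {e} := by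
      ext f
      simp only [Finset.mem_insert, Finset.mem_symmDiff, Finset.mem_singleton]
      constructor
      · rintro (rfl | h)
        · exact Or.inr ⟨rfl, he⟩
        · exact Or.inl ⟨h, fun hf => he (hf ▸ h)⟩
      · tauto
    have ih' := ih fun f hf => hA f (Finset.mem_insert_of_mem hf)
    have hd := hA e (Finset.mem_insert_self _ _)
    induction e using Sym2.ind with
    | _ u v =>
    have huv : u ≠ v := by simpa using hd
    rw [hins, ← Nat.not_odd_iff_even, oddSet_symmDiff, odd_card_symmDiff,
      oddSet_singleton huv, card_symmDiff_singleton huv, not_not]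
    exact iff_of_false (Nat.not_odd_iff_even.2 ih') (by decide)

end Odd

/-! ### The high-temperature expansion -/

section Ising

variable {V : Type*} [Fintype V] [DecidableEq V]

theorem spin_sq (σ : V → ℤˣ) (v : V) : spin σ v * spin σ v = 1 := by
  rcases Int.units_eq_one_or (σ v) with h | h <;> simp [spin, h]

theorem spin_pow (σ : V → ℤˣ) (v : V) (k : ℕ) :
    spin σ v ^ k = if Odd k then spin σ v else 1 := by
  rcases Nat.even_or_odd k with ⟨j, rfl⟩ | ⟨j, rfl⟩
  · rw [if_neg (by simp), ← two_mul, pow_mul, pow_two, spin_sq, one_pow]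
  · rw [if_pos (odd_two_mul_add_one j), pow_succ, pow_mul, pow_two, spin_sq, one_pow, one_mul]

theorem abs_spin (σ : V → ℤˣ) (v : V) : |spin σ v| = 1 := by
  rcases Int.units_eq_one_or (σ v) with h | h <;> simp [spin, h]

/-- The product of the spins in `S`. -/
def spinProd (S : Finset V) (σ : V → ℤˣ) : ℝ := ∏ v, if v ∈ S then spin σ v else 1

theorem abs_spinProd (S : Finset V) (σ : V → ℤˣ) : |spinProd S σ| = 1 := by
  rw [spinProd, Finset.abs_prod]
  refine Finset.prod_eq_one fun v _ => ?_
  split_ifs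
  · exact abs_spin σ v
  · simp

theorem edgeSpin_eq_prod (σ : V → ℤˣ) {e : Sym2 V} (he : ¬e.IsDiag) :
    edgeSpin σ e = ∏ v, if v ∈ e then spin σ v else 1 := by
  induction e using Sym2.ind with
  | _ a b =>
  have hab : a ≠ b := by simpa using he
  rw [← Finset.prod_filter]
  have : (Finset.univ.filter fun v => v ∈ s(a, b)) = {a, b} := by
    ext v
    simp
  rw [this, Finset.prod_pair hab]
  rfl

theorem edgeSpin_eq_one_or (σ : V → ℤˣ) (e : Sym2 V) : edgeSpin σ e = 1 ∨ edgeSpin σ e = -1 := by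
  induction e using Sym2.ind with
  | _ a b =>
  change spin σ a * spin σ b = 1 ∨ spin σ a * spin σ b = -1
  rcases Int.units_eq_one_or (σ a) with h | h <;>
    rcases Int.units_eq_one_or (σ b) with h' | h' <;> simp [spin, h, h']

/-- Collect the factors by vertex: each spin occurs to the power of its degree in `A`, and only the
parity of that power matters. -/
theorem prod_edgeSpin (σ : V → ℤˣ) {A : Finset (Sym2 V)} (hA : ∀ e ∈ A, ¬e.IsDiag) :
    ∏ e ∈ A, edgeSpin σ e = spinProd (oddSet A) σ := by
  rw [Finset.prod_congr rfl fun e he => edgeSpin_eq_prod σ (hA e he), Finset.prod_comm, spinProd]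
  refine Finset.prod_congr rfl fun v _ => ?_
  rw [← Finset.prod_filter, Finset.prod_const, spin_pow]
  simp only [mem_oddSet]

/-- Orthogonality of the characters of the group {±1}^V. The sum factorises over the vertices, and a
vertex that lies in exactly one of the two sets contributes the factor 0. -/
theorem sum_spinProd_mul (S T : Finset V) :
    ∑ σ : V → ℤˣ, spinProd S σ * spinProd T σ =
      if S = T then 2 ^ Fintype.card V else 0 := by
  have h1 : ∀ σ : V → ℤˣ, spinProd S σ * spinProd T σ =
      ∏ v, ((if v ∈ S then ((σ v : ℤ) : ℝ) else 1) * if v ∈ T then ((σ v : ℤ) : ℝ) else 1) := by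
    intro σ
    rw [spinProd, spinProd, ← Finset.prod_mul_distrib]
    rfl
  have hu : (Finset.univ : Finset ℤˣ) = {1, -1} := by decide
  have h2 := Finset.prod_univ_sum (fun _ : V => (Finset.univ : Finset ℤˣ))
    fun v (s : ℤˣ) => (if v ∈ S then ((s : ℤ) : ℝ) else 1) * if v ∈ T then ((s : ℤ) : ℝ) else 1
  rw [Fintype.piFinset_univ] at h2
  rw [Finset.sum_congr rfl fun σ _ => h1 σ, ← h2]
  have h3 : ∀ v : V, (∑ s : ℤˣ, (if v ∈ S then ((s : ℤ) : ℝ) else 1) *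
      if v ∈ T then ((s : ℤ) : ℝ) else 1) = if (v ∈ S ↔ v ∈ T) then 2 else 0 := by
    intro v
    rw [hu, Finset.sum_pair (by decide)]
    by_cases hS : v ∈ S <;> by_cases hT : v ∈ T <;> simp [hS, hT] <;> norm_num
  simp only [h3]
  split_ifs with h
  · subst h
    simp
  · obtain ⟨v, hv⟩ : ∃ v, ¬(v ∈ S ↔ v ∈ T) := by
      by_contra hcon
      push Not at hcon
      exact h (Finset.ext hcon)
    exact Finset.prod_eq_zero (Finset.mem_univ v) (if_neg hv)

variable (G : SimpleGraph V) [DecidableRel G.Adj]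

theorem not_isDiag_of_subset {A : Finset (Sym2 V)} (hA : A ⊆ G.edgeFinset) :
    ∀ e ∈ A, ¬e.IsDiag := fun _ he =>
  G.not_isDiag_of_mem_edgeSet (SimpleGraph.mem_edgeFinset.1 (hA he))

/-- The generating function of the edge sets `A ⊆ E` with odd vertices `S`. -/
def oddWeight (x : ℝ) (S : Finset V) : ℝ :=
  ∑ A ∈ G.edgeFinset.powerset with oddSet A = S, x ^ A.card

/-- High-temperature expansion: multiplying out the product gives a sum over edge sets, and
orthogonality retains those with boundary `S`. -/
theorem sum_spinProd_mul_prod (x : ℝ) (S : Finset V) :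
    ∑ σ : V → ℤˣ, spinProd S σ * ∏ e ∈ G.edgeFinset, (1 + x * edgeSpin σ e) =
      2 ^ Fintype.card V * oddWeight G x S := by
  have h1 : ∀ σ : V → ℤˣ, spinProd S σ * ∏ e ∈ G.edgeFinset, (1 + x * edgeSpin σ e) =
      ∑ A ∈ G.edgeFinset.powerset, x ^ A.card * (spinProd S σ * spinProd (oddSet A) σ) := by
    intro σ
    rw [Finset.prod_one_add, Finset.mul_sum]
    refine Finset.sum_congr rfl fun A hA => ?_
    rw [Finset.prod_mul_distrib, Finset.prod_const,
      prod_edgeSpin σ (not_isDiag_of_subset G (Finset.mem_powerset.1 hA))]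
    ring
  rw [Finset.sum_congr rfl fun σ _ => h1 σ, Finset.sum_comm, oddWeight, Finset.sum_filter,
    Finset.mul_sum]
  refine Finset.sum_congr rfl fun A _ => ?_
  rw [← Finset.mul_sum, sum_spinProd_mul]
  simp only [eq_comm (a := S)]
  split_ifs <;> ring

theorem boltzmann_eq (β : ℝ) (σ : V → ℤˣ) :
    boltzmann G β σ = Real.cosh β ^ G.edgeFinset.card *
      ∏ e ∈ G.edgeFinset, (1 + Real.tanh β * edgeSpin σ e) := by
  rw [boltzmann, Finset.mul_sum, Real.exp_sum, ← Finset.prod_const, ← Finset.prod_mul_distrib]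
  refine Finset.prod_congr rfl fun e _ => ?_
  have hc : Real.cosh β ≠ 0 := (Real.cosh_pos β).ne'
  rw [Real.tanh_eq_sinh_div_cosh]
  rcases edgeSpin_eq_one_or σ e with h | h
  · rw [h, mul_one, mul_one, ← Real.cosh_add_sinh]
    field_simp
  · rw [h, mul_neg_one, mul_neg_one, ← Real.cosh_sub_sinh]
    field_simp
    ring

variable {G}

/-- Visible only on the spin side of the expansion: the product of the factors 1 ± x is nonnegative,
and replacing a spin product by 1 can only increase the sum. -/
theorem oddWeight_le {x : ℝ} (h0 : 0 ≤ x) (h1 : x ≤ 1) (S : Finset V) :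
    oddWeight G x S ≤ oddWeight G x ∅ := by
  have h2 : (0 : ℝ) < 2 ^ Fintype.card V := by positivity
  rw [← mul_le_mul_iff_right₀ h2, ← sum_spinProd_mul_prod, ← sum_spinProd_mul_prod]
  refine Finset.sum_le_sum fun σ _ => mul_le_mul_of_nonneg_right ?_ ?_
  · refine (le_abs_self _).trans ?_
    rw [abs_spinProd]
    simp [spinProd]
  · refine Finset.prod_nonneg fun e _ => ?_
    rcases edgeSpin_eq_one_or σ e with h | h <;> rw [h] <;> linarith

theorem oddWeight_nonneg {x : ℝ} (h0 : 0 ≤ x) (S : Finset V) : 0 ≤ oddWeight G x S :=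
  Finset.sum_nonneg fun _ _ => by positivity

theorem oddWeight_empty_pos {x : ℝ} (h0 : 0 ≤ x) : 0 < oddWeight G x ∅ := by
  have : (1 : ℝ) ≤ oddWeight G x ∅ := by
    have := Finset.single_le_sum
      (f := fun A : Finset (Sym2 V) => x ^ A.card)
      (s := G.edgeFinset.powerset.filter fun A => oddSet A = ∅) (fun A _ => by positivity)
      (a := ∅) (by simp [oddSet_empty])
    simpa only [oddWeight, Finset.card_empty, pow_zero] using this
  linarith

theorem gibbs_spin_mul_spin (β : ℝ) (u v : V) :
    gibbs G β (fun σ => spin σ u * spin σ v) =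
      oddWeight G (Real.tanh β) (symmDiff {u} {v}) / oddWeight G (Real.tanh β) ∅ := by
  have hS : ∀ σ : V → ℤˣ, spin σ u * spin σ v = spinProd (symmDiff {u} {v}) σ := by
    intro σ
    by_cases h : u = v
    · subst h
      simp [spinProd, spin_sq]
    · rw [symmDiff_singleton_pair h, spinProd, ← Finset.prod_filter, Finset.filter_mem_eq_inter,
        Finset.univ_inter, Finset.prod_pair h]
  have h1 : ∀ S : Finset V, ∑ σ, spinProd S σ * boltzmann G β σ =
      Real.cosh β ^ G.edgeFinset.card * (2 ^ Fintype.card V * oddWeight G (Real.tanh β) S) := by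
    intro S
    rw [← sum_spinProd_mul_prod, Finset.mul_sum]
    refine Finset.sum_congr rfl fun σ _ => ?_
    rw [boltzmann_eq]
    ring
  have h2 := h1 ∅
  simp only [spinProd, Finset.notMem_empty, if_false, Finset.prod_const_one, one_mul] at h2
  have hc : Real.cosh β ≠ 0 := (Real.cosh_pos β).ne'
  rw [gibbs, h2, Finset.sum_congr rfl fun σ _ => by rw [hS σ], h1]
  rw [← mul_assoc, ← mul_assoc, mul_div_mul_left]
  positivity

theorem tanh_pos_of_pos {β : ℝ} (h : 0 < β) : 0 < Real.tanh β := by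
  rw [Real.tanh_eq_sinh_div_cosh]
  exact div_pos (Real.sinh_pos_iff.2 h) (Real.cosh_pos β)

theorem tanh_lt_one' (β : ℝ) : Real.tanh β < 1 := by
  rw [Real.tanh_eq_sinh_div_cosh, div_lt_one (Real.cosh_pos β)]
  exact Real.sinh_lt_cosh β

/-! ### The PS space, its total weight, and bounds for the even class -/

theorem mem_psSpace {A : Finset (Sym2 V)} :
    A ∈ psSpace G ↔ A ⊆ G.edgeFinset ∧ ((oddSet A).card = 0 ∨ (oddSet A).card = 2) := by
  simp only [psSpace, oddClass, Finset.mem_union, Finset.mem_filter, Finset.mem_powerset]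
  tauto

theorem mem_oddClass {A : Finset (Sym2 V)} {k : ℕ} :
    A ∈ oddClass G k ↔ A ⊆ G.edgeFinset ∧ (oddSet A).card = k := by
  simp only [oddClass, Finset.mem_filter, Finset.mem_powerset]

theorem mem_psSpace_iff_le {A : Finset (Sym2 V)} :
    A ∈ psSpace G ↔ A ⊆ G.edgeFinset ∧ (oddSet A).card ≤ 2 := by
  rw [mem_psSpace]
  refine and_congr_right fun h => ?_
  have := even_card_oddSet (not_isDiag_of_subset G h)
  rw [Nat.even_iff] at this
  omega

/-- The origin of the weights n and 2 of the PS measure: an empty boundary comes from the n diagonal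
pairs, a boundary {a, b} from (a, b) and (b, a), and no other boundary arises. -/
theorem card_filter_symmDiff_singleton (S : Finset V) :
    ((Finset.univ : Finset (V × V)).filter fun p => S = symmDiff {p.1} {p.2}).card =
      if S.card = 0 then Fintype.card V else if S.card = 2 then 2 else 0 := by
  split_ifs with h0 h2
  · rw [Finset.card_eq_zero] at h0
    subst h0
    simp only [eq_comm (a := (∅ : Finset V)), symmDiff_pair_eq_empty]
    rw [← Finset.card_univ, ← Finset.diag_card (Finset.univ : Finset V)]
    refine congrArg Finset.card (Finset.ext fun p => ?_)
    simp [Finset.mem_diag]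
  · obtain ⟨a, b, hab, rfl⟩ := Finset.card_eq_two.1 h2
    have : ((Finset.univ : Finset (V × V)).filter fun p =>
        ({a, b} : Finset V) = symmDiff {p.1} {p.2}) =
        {(a, b), (b, a)} := by
      ext ⟨u, v⟩
      simp only [Finset.mem_filter, Finset.mem_univ, true_and, Finset.mem_insert,
        Finset.mem_singleton, Prod.mk.injEq]
      constructor
      · intro h
        have huv : u ≠ v := by
          rintro rfl
          simp at h
        rw [symmDiff_singleton_pair huv, ← Finset.coe_inj] at h
        push_cast at h
        rcases Set.pair_eq_pair_iff.1 h with ⟨h1, h2⟩ | ⟨h1, h2⟩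
        · exact Or.inl ⟨h1.symm, h2.symm⟩
        · exact Or.inr ⟨h2.symm, h1.symm⟩
      · rintro (⟨rfl, rfl⟩ | ⟨rfl, rfl⟩)
        · rw [symmDiff_singleton_pair hab]
        · rw [symmDiff_singleton_pair hab.symm, Finset.pair_comm]
    rw [this, Finset.card_pair (by simp [hab])]
  · rw [Finset.card_eq_zero, Finset.filter_eq_empty_iff]
    rintro ⟨u, v⟩ - rfl
    by_cases h : u = v
    · subst h
      simp at h0
    · exact h2 (card_symmDiff_singleton h)

theorem sum_oddWeight_eq (x : ℝ) :
    ∑ u, ∑ v, oddWeight G x (symmDiff {u} {v}) = ∑ A ∈ psSpace G, psWeight x A := by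
  have h1 : ∀ A : Finset (Sym2 V), (∑ p : V × V,
      if oddSet A = symmDiff {p.1} {p.2} then x ^ A.card else 0) =
      if (oddSet A).card = 0 ∨ (oddSet A).card = 2 then psWeight x A else 0 := by
    intro A
    rw [← Finset.sum_filter, Finset.sum_const, card_filter_symmDiff_singleton, nsmul_eq_mul,
      psWeight]
    simp only [Finset.card_eq_zero]
    by_cases h0 : oddSet A = ∅
    · simp [h0, mul_comm]
    · by_cases h2 : (oddSet A).card = 2
      · simp [h0, h2, mul_comm]
      · simp [h0, h2]
  have h2 : psSpace G = G.edgeFinset.powerset.filter fun A =>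
      (oddSet A).card = 0 ∨ (oddSet A).card = 2 := by
    ext A
    rw [mem_psSpace, Finset.mem_filter, Finset.mem_powerset]
  rw [← Fintype.sum_prod_type', h2, Finset.sum_filter, ← Finset.sum_congr rfl fun A _ => h1 A,
    Finset.sum_comm]
  simp only [oddWeight, Finset.sum_filter]

theorem sum_oddClass_zero (x : ℝ) :
    ∑ A ∈ oddClass G 0, psWeight x A = Fintype.card V * oddWeight G x ∅ := by
  rw [oddWeight, Finset.mul_sum, oddClass]
  simp only [Finset.card_eq_zero]
  refine Finset.sum_congr rfl fun A hA => ?_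
  rw [psWeight, if_pos (Finset.mem_filter.1 hA).2, mul_comm]

theorem sum_psSpace_eq (x : ℝ) :
    ∑ A ∈ psSpace G, psWeight x A = Fintype.card V * oddWeight G x ∅ +
      ∑ u, ∑ v, if u = v then 0 else oddWeight G x (symmDiff {u} {v}) := by
  rw [← sum_oddWeight_eq]
  have h1 : ∀ u : V, ∑ v, oddWeight G x (symmDiff {u} {v}) = oddWeight G x ∅ +
      ∑ v, if u = v then 0 else oddWeight G x (symmDiff {u} {v}) := by
    intro u
    have : ∀ v, oddWeight G x (symmDiff {u} {v}) = (if u = v then oddWeight G x ∅ else 0) +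
        if u = v then 0 else oddWeight G x (symmDiff {u} {v}) := by
      intro v
      split_ifs with h
      · subst h
        simp
      · simp
    rw [Finset.sum_congr rfl fun v _ => this v, Finset.sum_add_distrib]
    simp
  rw [Finset.sum_congr rfl fun u _ => h1 u, Finset.sum_add_distrib]
  simp

theorem psWeight_pos {x : ℝ} (hx : 0 < x) (hV : 0 < Fintype.card V) (A : Finset (Sym2 V)) :
    0 < psWeight x A := by
  have : (0 : ℝ) < Fintype.card V := by exact_mod_cast hV
  rw [psWeight]
  split_ifs <;> positivity

theorem evenProb_eq (β : ℝ) : evenProb G β =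
    Fintype.card V * oddWeight G (Real.tanh β) ∅ / ∑ A ∈ psSpace G, psWeight (Real.tanh β) A := by
  rw [evenProb, psProb, sum_oddClass_zero]

theorem sum_psSpace_pos {x : ℝ} (hx : 0 < x) (hV : 0 < Fintype.card V) :
    0 < ∑ A ∈ psSpace G, psWeight x A :=
  Finset.sum_pos (fun A _ => psWeight_pos hx hV A)
    ⟨∅, mem_psSpace.2 ⟨Finset.empty_subset _, Or.inl (by simp [oddSet_empty])⟩⟩

theorem evenProb_pos {β : ℝ} (hV : 0 < Fintype.card V) (hβ : 0 < β) : 0 < evenProb G β := by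
  have hx := tanh_pos_of_pos hβ
  have : (0 : ℝ) < Fintype.card V := by exact_mod_cast hV
  rw [evenProb_eq]
  exact div_pos (mul_pos this (oddWeight_empty_pos hx.le)) (sum_psSpace_pos hx hV)

/-- Summing the two-point functions over all pairs gives the total PS weight divided by Z_∅, and n
Z_∅ is the weight of the even class. -/
theorem susceptibility_eq {β : ℝ} (hβ : 0 < β) :
    susceptibility G β = β / evenProb G β := by
  have hx := tanh_pos_of_pos hβ
  rw [susceptibility, evenProb_eq]
  simp only [gibbs_spin_mul_spin, ← Finset.sum_div]
  rw [sum_oddWeight_eq, div_div_eq_mul_div, div_mul_div_comm]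

theorem evenProb_le_one {β : ℝ} (hV : 0 < Fintype.card V) (hβ : 0 < β) : evenProb G β ≤ 1 := by
  have hx := tanh_pos_of_pos hβ
  rw [evenProb_eq, div_le_one (sum_psSpace_pos hx hV), sum_psSpace_eq]
  refine le_add_of_nonneg_right (Finset.sum_nonneg fun u _ => Finset.sum_nonneg fun v _ => ?_)
  split_ifs
  · exact le_rfl
  · exact oddWeight_nonneg hx.le _

/-- Each of the n² summands of the normaliser is at most Z_∅. This is stronger than the bound
1/(2n+1) that the estimator works with. -/
theorem one_div_card_le_evenProb {β : ℝ} (hV : 0 < Fintype.card V) (hβ : 0 < β) :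
    1 / (Fintype.card V : ℝ) ≤ evenProb G β := by
  have hx := tanh_pos_of_pos hβ
  have hn : (0 : ℝ) < Fintype.card V := by exact_mod_cast hV
  rw [evenProb_eq, div_le_div_iff₀ hn (sum_psSpace_pos hx hV), ← sum_oddWeight_eq]
  have h1 : ∑ u, ∑ v, oddWeight G (Real.tanh β) (symmDiff {u} {v}) ≤
      ∑ _u : V, ∑ _v : V, oddWeight G (Real.tanh β) ∅ :=
    Finset.sum_le_sum fun u _ => Finset.sum_le_sum fun v _ =>
      oddWeight_le hx.le (tanh_lt_one' β).le _
  simp only [Finset.sum_const, Finset.card_univ, nsmul_eq_mul] at h1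
  linarith

theorem exists_mem_of_mem_oddSet {A : Finset (Sym2 V)} {u : V} (h : u ∈ oddSet A) :
    ∃ w, s(u, w) ∈ A := by
  rw [mem_oddSet] at h
  obtain ⟨e, he⟩ := Finset.card_pos.1 h.pos
  obtain ⟨heA, hue⟩ := Finset.mem_filter.1 he
  obtain ⟨w, rfl⟩ := Sym2.mem_iff_exists.1 hue
  exact ⟨w, heA⟩

theorem symmDiff_singleton_of_mem {α : Type*} [DecidableEq α] {A : Finset α} {e : α}
    (h : e ∈ A) : symmDiff A {e} = A.erase e := by
  ext f
  simp only [Finset.mem_symmDiff, Finset.mem_singleton, Finset.mem_erase]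
  constructor
  · rintro (h' | ⟨rfl, h'⟩)
    · exact ⟨h'.2, h'.1⟩
    · exact absurd h h'
  · tauto

theorem symmDiff_singleton_of_notMem {α : Type*} [DecidableEq α] {A : Finset α} {e : α}
    (h : e ∉ A) : symmDiff A {e} = insert e A := by
  ext f
  simp only [Finset.mem_symmDiff, Finset.mem_singleton, Finset.mem_insert]
  constructor
  · tauto
  · rintro (rfl | h')
    · exact Or.inr ⟨rfl, h⟩
    · exact Or.inl ⟨h', fun hf => h (hf ▸ h')⟩

/-- An odd vertex `u` is incident to some edge of `A`. For each possible edge, erasing it is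
injective on the sets that contain it, gains a factor `x`, and leaves a generating function bounded
by Z_∅. Unlike `oddWeight_le`, this bound tends to 0 with `x`. -/
theorem oddWeight_le_of_mem {x : ℝ} (h0 : 0 ≤ x) (h1 : x ≤ 1) {S : Finset V} {u : V}
    (hu : u ∈ S) : oddWeight G x S ≤ Fintype.card V * x * oddWeight G x ∅ := by
  have key : ∀ A ∈ G.edgeFinset.powerset.filter (fun A => oddSet A = S),
      x ^ A.card ≤ ∑ w : V, if s(u, w) ∈ A then x * x ^ (A.erase s(u, w)).card else 0 := by
    intro A hA
    obtain ⟨w, hw⟩ := exists_mem_of_mem_oddSet ((Finset.mem_filter.1 hA).2 ▸ hu)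
    refine le_trans (le_of_eq ?_) (Finset.single_le_sum (a := w) (fun w _ => ?_)
      (Finset.mem_univ w))
    · rw [if_pos hw, ← pow_succ', Finset.card_erase_add_one hw]
    · split_ifs
      · positivity
      · exact le_rfl
  calc oddWeight G x S ≤ ∑ A ∈ G.edgeFinset.powerset with oddSet A = S,
        ∑ w : V, (if s(u, w) ∈ A then x * x ^ (A.erase s(u, w)).card else 0) :=
        Finset.sum_le_sum key
    _ = ∑ w : V, ∑ A ∈ G.edgeFinset.powerset with oddSet A = S,
        (if s(u, w) ∈ A then x * x ^ (A.erase s(u, w)).card else 0) := Finset.sum_comm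
    _ ≤ ∑ w : V, x * oddWeight G x (symmDiff S (oddSet {s(u, w)})) := by
        refine Finset.sum_le_sum fun w _ => ?_
        rw [← Finset.sum_filter, ← Finset.mul_sum]
        refine mul_le_mul_of_nonneg_left ?_ h0
        refine le_trans (Finset.sum_image (g := fun A : Finset (Sym2 V) => A.erase s(u, w))
          (f := fun B => x ^ B.card) ?_).ge ?_
        rotate_left
        · refine Finset.sum_le_sum_of_subset_of_nonneg ?_ fun _ _ _ => by positivity
          intro B hB
          obtain ⟨A, hA, rfl⟩ := Finset.mem_image.1 hB
          simp only [Finset.mem_filter, Finset.mem_powerset] at hA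
          obtain ⟨⟨hAE, rfl⟩, hw⟩ := hA
          rw [Finset.mem_filter, Finset.mem_powerset]
          refine ⟨(Finset.erase_subset _ _).trans hAE, ?_⟩
          rw [← symmDiff_singleton_of_mem hw, oddSet_symmDiff]
        · intro A hA B hB hAB
          simp only [Finset.coe_filter, Finset.mem_filter, Set.mem_ofPred_eq] at hA hB
          replace hAB : A.erase s(u, w) = B.erase s(u, w) := hAB
          rw [← Finset.insert_erase hA.2, hAB, Finset.insert_erase hB.2]
    _ ≤ ∑ w : V, x * oddWeight G x ∅ :=
        Finset.sum_le_sum fun w _ => mul_le_mul_of_nonneg_left (oddWeight_le h0 h1 _) h0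
    _ = Fintype.card V * x * oddWeight G x ∅ := by
        rw [Finset.sum_const, Finset.card_univ, nsmul_eq_mul, mul_assoc]

/-- At high temperature the even subgraphs have nearly full probability. -/
theorem one_le_mul_evenProb {β : ℝ} (hV : 0 < Fintype.card V) (hβ : 0 < β) :
    1 ≤ (1 + (Fintype.card V : ℝ) ^ 2 * Real.tanh β) * evenProb G β := by
  have hx := tanh_pos_of_pos hβ
  have hn : (0 : ℝ) < Fintype.card V := by exact_mod_cast hV
  rw [evenProb_eq, ← mul_div_assoc, one_le_div (sum_psSpace_pos hx hV), sum_psSpace_eq]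
  have h1 : (∑ u, ∑ v, if u = v then 0 else oddWeight G (Real.tanh β) (symmDiff {u} {v})) ≤
      ∑ _u : V, ∑ _v : V, Fintype.card V * Real.tanh β * oddWeight G (Real.tanh β) ∅ := by
    refine Finset.sum_le_sum fun u _ => Finset.sum_le_sum fun v _ => ?_
    have h0 := oddWeight_empty_pos (G := G) hx.le
    split_ifs with h
    · positivity
    · exact oddWeight_le_of_mem (u := u) hx.le (tanh_lt_one' β).le
        (by simp [symmDiff_singleton_pair h])
  simp only [Finset.sum_const, Finset.card_univ, nsmul_eq_mul] at h1
  linarith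

end Ising

/-! ### Lazy reversible chains -/

section Chain

variable {Ω : Type*}

/-- The transition matrix `P` on the finite set `W` is lazy, and reversible with respect to the
weights `w`. -/
structure IsLazyReversible (W : Finset Ω) (w : Ω → ℝ) (P : Ω → Ω → ℝ) : Prop where
  weight_nonneg : ∀ A ∈ W, 0 ≤ w A
  nonneg : ∀ A ∈ W, ∀ B ∈ W, 0 ≤ P A B
  sum_eq_one : ∀ A ∈ W, ∑ B ∈ W, P A B = 1
  reversible : ∀ A ∈ W, ∀ B ∈ W, w A * P A B = w B * P B A
  half_le : ∀ A ∈ W, 1 / 2 ≤ P A A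

/-- The Dirichlet form. -/
def dirichlet (W : Finset Ω) (w : Ω → ℝ) (P : Ω → Ω → ℝ) (f : Ω → ℝ) : ℝ :=
  (∑ A ∈ W, ∑ B ∈ W, w A * P A B * (f A - f B) ^ 2) / 2

/-- The action of the transition matrix on functions. -/
def transfer (W : Finset Ω) (P : Ω → Ω → ℝ) (f : Ω → ℝ) (A : Ω) : ℝ := ∑ B ∈ W, P A B * f B

namespace IsLazyReversible

variable {W : Finset Ω} {w : Ω → ℝ} {P : Ω → Ω → ℝ} (h : IsLazyReversible W w P)

include h

theorem sum_mul_sum_mul (f : Ω → ℝ) :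
    ∑ A ∈ W, ∑ B ∈ W, w A * P A B * f B = ∑ A ∈ W, w A * f A := by
  rw [Finset.sum_comm]
  refine Finset.sum_congr rfl fun B hB => ?_
  rw [← Finset.sum_mul, Finset.sum_congr rfl fun A hA => h.reversible A hA B hB,
    ← Finset.mul_sum, h.sum_eq_one B hB, mul_one]

theorem sum_mul_transfer (f : Ω → ℝ) :
    ∑ A ∈ W, w A * transfer W P f A = ∑ A ∈ W, w A * f A := by
  rw [← h.sum_mul_sum_mul f]
  refine Finset.sum_congr rfl fun A _ => ?_
  rw [transfer, Finset.mul_sum]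
  exact Finset.sum_congr rfl fun B _ => by ring

/-- A strengthened Jensen inequality, in which laziness buys half of the local energy. With `e` and
`q` the first and second moments of the increment f(A) - f(B), it reduces to e² ≤ q/2. -/
theorem transfer_sq_add_le (f : Ω → ℝ) {A : Ω} (hA : A ∈ W) :
    transfer W P f A ^ 2 + (∑ B ∈ W, P A B * (f A - f B) ^ 2) / 2 ≤ ∑ B ∈ W, P A B * f B ^ 2 := by
  classical
  set e : ℝ := ∑ B ∈ W, P A B * (f A - f B) with he
  set q : ℝ := ∑ B ∈ W, P A B * (f A - f B) ^ 2 with hq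
  have h1 := h.sum_eq_one A hA
  have ht : transfer W P f A = f A - e := by
    rw [he, transfer]
    simp only [mul_sub, Finset.sum_sub_distrib]
    rw [← Finset.sum_mul, h1]
    ring
  have hs : ∑ B ∈ W, P A B * f B ^ 2 = f A ^ 2 - 2 * f A * e + q := by
    have : ∀ B ∈ W, P A B * f B ^ 2 =
        P A B * f A ^ 2 - 2 * f A * (P A B * (f A - f B)) + P A B * (f A - f B) ^ 2 :=
      fun B _ => by ring
    rw [Finset.sum_congr rfl this, Finset.sum_add_distrib, Finset.sum_sub_distrib,
      ← Finset.sum_mul, h1, ← Finset.mul_sum]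
    ring
  -- Staying put contributes nothing to `e` or `q`, so Cauchy–Schwarz is applied off the diagonal,
  -- where the total mass is at most 1/2.
  have hcs : e ^ 2 ≤ q / 2 := by
    have hoff : e = ∑ B ∈ W.erase A, P A B * (f A - f B) := by
      rw [he, ← Finset.add_sum_erase _ _ hA]
      simp
    have hoffq : q = ∑ B ∈ W.erase A, P A B * (f A - f B) ^ 2 := by
      rw [hq, ← Finset.add_sum_erase _ _ hA]
      simp
    have hoff1 : ∑ B ∈ W.erase A, P A B ≤ 1 / 2 := by
      have := Finset.add_sum_erase W (P A) hA
      linarith [h.half_le A hA]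
    have hnn : ∀ B ∈ W.erase A, 0 ≤ P A B := fun B hB => h.nonneg A hA B (Finset.mem_of_mem_erase hB)
    have := Finset.sum_sq_le_sum_mul_sum_of_sq_le_mul (W.erase A)
      (r := fun B => P A B * (f A - f B)) (f := fun B => P A B)
      (g := fun B => P A B * (f A - f B) ^ 2) hnn
      (fun B hB => mul_nonneg (hnn B hB) (sq_nonneg _)) (fun B _ => le_of_eq (by ring))
    rw [← hoff, ← hoffq] at this
    have hq0 : 0 ≤ q := by
      rw [hoffq]
      exact Finset.sum_nonneg fun B hB => mul_nonneg (hnn B hB) (sq_nonneg _)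
    nlinarith
  rw [ht, hs]
  nlinarith

/-- One step loses at least the full Dirichlet form of the second moment. Negative eigenvalues need
no separate treatment, since laziness is already built into the pointwise inequality. -/
theorem sum_transfer_sq_add_dirichlet_le (f : Ω → ℝ) :
    ∑ A ∈ W, w A * transfer W P f A ^ 2 + dirichlet W w P f ≤ ∑ A ∈ W, w A * f A ^ 2 := by
  rw [← h.sum_mul_sum_mul fun A => f A ^ 2, dirichlet, Finset.sum_div, ← Finset.sum_add_distrib]
  refine Finset.sum_le_sum fun A hA => ?_
  have := mul_le_mul_of_nonneg_left (h.transfer_sq_add_le f hA) (h.weight_nonneg A hA)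
  simp only [mul_assoc, ← Finset.mul_sum]
  linarith

/-- A Poincaré inequality implies exponential decay of the variance. -/
theorem sum_iterate_sq_le {κ : ℝ} (hκ : 0 < κ)
    (hP : ∀ f : Ω → ℝ, ∑ A ∈ W, w A * f A = 0 →
      ∑ A ∈ W, w A * f A ^ 2 ≤ κ * dirichlet W w P f)
    {f : Ω → ℝ} (hf : ∑ A ∈ W, w A * f A = 0) (t : ℕ) :
    ∑ A ∈ W, w A * ((transfer W P)^[t] f A) ^ 2 ≤
      Real.exp (-(t / κ)) * ∑ A ∈ W, w A * f A ^ 2 := by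
  have hmean : ∀ t : ℕ, ∑ A ∈ W, w A * (transfer W P)^[t] f A = 0 := by
    intro t
    induction t with
    | zero => simpa using hf
    | succ t ih => rw [Function.iterate_succ_apply', h.sum_mul_transfer, ih]
  induction t with
  | zero => simp
  | succ t ih =>
    rw [Function.iterate_succ_apply']
    set g := (transfer W P)^[t] f with hg
    have h1 := h.sum_transfer_sq_add_dirichlet_le g
    have h2 := hP g (hmean t)
    have h0 : 0 ≤ ∑ A ∈ W, w A * g A ^ 2 :=
      Finset.sum_nonneg fun A hA => mul_nonneg (h.weight_nonneg A hA) (sq_nonneg _)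
    have h3 : (∑ A ∈ W, w A * g A ^ 2) / κ ≤ dirichlet W w P g := by
      rw [div_le_iff₀ hκ]
      linarith
    have h4 : 1 - 1 / κ ≤ Real.exp (-(1 / κ)) := by
      linarith [Real.add_one_le_exp (-(1 / κ))]
    have h5 : Real.exp (-((t + 1 : ℕ) / κ)) = Real.exp (-(1 / κ)) * Real.exp (-(t / κ)) := by
      rw [← Real.exp_add]
      congr 1
      push_cast
      ring
    calc ∑ A ∈ W, w A * transfer W P g A ^ 2
        ≤ (1 - 1 / κ) * ∑ A ∈ W, w A * g A ^ 2 := by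
          rw [sub_mul, one_mul, one_div_mul_eq_div]
          linarith
      _ ≤ Real.exp (-(1 / κ)) * ∑ A ∈ W, w A * g A ^ 2 := by gcongr
      _ ≤ Real.exp (-(1 / κ)) * (Real.exp (-(t / κ)) * ∑ A ∈ W, w A * f A ^ 2) := by gcongr
      _ = _ := by rw [h5]; ring

end IsLazyReversible

end Chain

/-! ### The transition probabilities of the PS chain -/

section Draw

theorem toReal_drawFrom_apply {α γ : Type*} {s : Finset α} (h : s.Nonempty) (d : PMF γ)
    (f : α → PMF γ) (b : γ) :
    (drawFrom s d f b).toReal = ∑ a ∈ s, (s.card : ℝ)⁻¹ * (f a b).toReal := by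
  classical
  rw [drawFrom, dif_pos h, PMF.bind_apply, tsum_eq_sum (s := s)]
  · rw [ENNReal.toReal_sum]
    · refine Finset.sum_congr rfl fun a ha => ?_
      rw [PMF.uniformOfFinset_apply_of_mem h ha, ENNReal.toReal_mul, ENNReal.toReal_inv,
        ENNReal.toReal_natCast]
    · intro a _
      exact ENNReal.mul_ne_top (PMF.apply_ne_top _ _) (PMF.apply_ne_top _ _)
  · intro a ha
    rw [PMF.uniformOfFinset_apply_of_notMem h ha, zero_mul]

theorem toReal_coin_map_apply {γ : Type*} [DecidableEq γ] {p : ℝ} (h0 : 0 ≤ p) (h1 : p ≤ 1)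
    (c d b : γ) : ((coin p).map (fun t => if t then c else d) b).toReal =
      p * (if b = c then 1 else 0) + (1 - p) * if b = d then 1 else 0 := by
  have hm : min 1 (ENNReal.ofReal p) = ENNReal.ofReal p :=
    min_eq_right (by simpa using h1)
  have hs : 1 - ENNReal.ofReal p = ENNReal.ofReal (1 - p) := by
    rw [ENNReal.ofReal_sub _ h0, ENNReal.ofReal_one]
  rw [PMF.map_apply, tsum_fintype, Fintype.sum_bool]
  simp only [coin, PMF.ofFintype_apply, cond_true, cond_false, hm, hs, if_true, Bool.false_eq_true,
    if_false]
  rw [ENNReal.toReal_add]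
  · congr 1
    · split_ifs <;> simp [h0]
    · split_ifs <;> simp [sub_nonneg.2 h1]
  · split_ifs <;> simp
  · split_ifs <;> simp

end Draw

section Kernel

variable {V : Type*} [Fintype V] [DecidableEq V] (G : SimpleGraph V) [DecidableRel G.Adj]

/-- The vertices from which a move of the PS chain may start. -/
def startSet (A : Finset (Sym2 V)) : Finset V := if oddSet A = ∅ then Finset.univ else oddSet A

/-- The factor by which the weight changes when the edge `e` is switched. -/
def ratio (x : ℝ) (A : Finset (Sym2 V)) (e : Sym2 V) : ℝ := if e ∈ A then 1 / x else x

variable {G}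

theorem pow_card_symmDiff {x : ℝ} (hx : 0 < x) (A : Finset (Sym2 V)) (e : Sym2 V) :
    x ^ (symmDiff A {e}).card = x ^ A.card * ratio x A e := by
  rw [ratio]
  split_ifs with h
  · rw [symmDiff_singleton_of_mem h, ← Finset.card_erase_add_one h, pow_succ]
    field_simp
  · rw [symmDiff_singleton_of_notMem h, Finset.card_insert_of_notMem h, pow_succ]

theorem ratio_symmDiff {x : ℝ} (A : Finset (Sym2 V)) (e : Sym2 V) :
    ratio x (symmDiff A {e}) e = (ratio x A e)⁻¹ := by
  by_cases h : e ∈ A <;> simp [ratio, Finset.mem_symmDiff, h]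

theorem le_ratio {x : ℝ} (hx : 0 < x) (h1 : x < 1) (A : Finset (Sym2 V)) (e : Sym2 V) :
    x ≤ ratio x A e := by
  rw [ratio]
  split_ifs
  · rw [le_div_iff₀ hx]
    nlinarith
  · exact le_rfl

/-- The factors n and 2 of the PS weight cancel against the number of vertices from which a move may
start, so only x^|A| enters detailed balance. -/
theorem card_startSet {A : Finset (Sym2 V)} (hA : A ∈ psSpace G) (x : ℝ)
    (hV : 0 < Fintype.card V) :
    psWeight x A * ((startSet A).card : ℝ)⁻¹ = x ^ A.card := by
  have hn : (Fintype.card V : ℝ) ≠ 0 := by exact_mod_cast hV.ne'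
  rw [psWeight, startSet]
  rcases (mem_psSpace.1 hA).2 with h | h
  · rw [Finset.card_eq_zero] at h
    simp only [h, if_true, Finset.card_univ]
    field_simp
  · have : oddSet A ≠ ∅ := by
      rintro h'
      simp [h'] at h
    simp only [this, if_false, h]
    push_cast
    ring

theorem startSet_nonempty (hV : 0 < Fintype.card V) (A : Finset (Sym2 V)) :
    (startSet A).Nonempty := by
  rw [startSet]
  split_ifs with h
  · exact Finset.card_pos.1 (by simpa using hV)
  · exact Finset.nonempty_iff_ne_empty.2 h

theorem oddSet_toggle {a b : V} (hab : a ≠ b) (A : Finset (Sym2 V)) :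
    oddSet (symmDiff A {s(a, b)}) = symmDiff (oddSet A) {a, b} := by
  rw [oddSet_symmDiff, oddSet_singleton hab, symmDiff_singleton_pair hab]

theorem toggle_subset {A : Finset (Sym2 V)} (hA : A ⊆ G.edgeFinset) {e : Sym2 V}
    (he : e ∈ G.edgeFinset) : symmDiff A {e} ⊆ G.edgeFinset := by
  intro f hf
  rcases Finset.mem_symmDiff.1 hf with h | h
  · exact hA h.1
  · rw [Finset.mem_singleton.1 h.1]
    exact he

/-- From an even set, a switch creates two odd vertices. From a set with two odd vertices, starting
at one of them moves it to the other end of the edge, or annihilates the pair. -/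
theorem toggle_mem_psSpace {A : Finset (Sym2 V)} (hA : A ∈ psSpace G) {u v : V}
    (hu : u ∈ startSet A) (huv : G.Adj u v) : symmDiff A {s(u, v)} ∈ psSpace G := by
  have hne := huv.ne
  refine mem_psSpace_iff_le.2 ⟨toggle_subset (mem_psSpace.1 hA).1 (by simpa using huv), ?_⟩
  rw [oddSet_toggle hne]
  rw [startSet] at hu
  split_ifs at hu with h
  · rw [h, ← Finset.bot_eq_empty, bot_symmDiff, Finset.card_pair hne]
  · have h2 := (mem_psSpace_iff_le.1 hA).2
    have hsub : symmDiff (oddSet A) {u, v} ⊆ insert v ((oddSet A).erase u) := by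
      intro w hw
      simp only [Finset.mem_symmDiff, Finset.mem_insert, Finset.mem_singleton,
        Finset.mem_erase] at hw ⊢
      rcases hw with ⟨h1, h2⟩ | ⟨h1 | h1, h2⟩
      · push Not at h2
        exact Or.inr ⟨h2.1, h1⟩
      · exact absurd (h1 ▸ hu) h2
      · exact Or.inl h1
    have h3 := Finset.card_le_card hsub
    have h4 := Finset.card_insert_le v ((oddSet A).erase u)
    have h5 := Finset.card_erase_add_one hu
    omega

/-- If a toggle stays in the PS space then one of its ends is an admissible start. -/
theorem mem_startSet_or {A : Finset (Sym2 V)} {a b : V} (hab : a ≠ b)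
    (hB : symmDiff A {s(a, b)} ∈ psSpace G) : a ∈ startSet A ∨ b ∈ startSet A := by
  by_contra hcon
  rw [startSet] at hcon
  split_ifs at hcon with h
  · simp at hcon
  · push Not at hcon
    have h2 := (mem_psSpace_iff_le.1 hB).2
    -- If neither end were an admissible start, the switch would add two new odd vertices to a
    -- nonempty boundary, which makes more than two.
    have hd : Disjoint (oddSet A) {a, b} := by
      rw [Finset.disjoint_right]
      intro w hw
      rcases Finset.mem_insert.1 hw with rfl | hw
      · exact hcon.1
      · rw [Finset.mem_singleton.1 hw]
        exact hcon.2
    rw [oddSet_toggle hab, hd.symmDiff_eq_sup, Finset.sup_eq_union,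
      Finset.card_union_of_disjoint hd, Finset.card_pair hab] at h2
    have := Finset.card_pos.2 (Finset.nonempty_iff_ne_empty.2 h)
    omega

theorem degree_pos_of_connected (hV : 2 ≤ Fintype.card V) (hG : G.Connected) (v : V) :
    0 < G.degree v := by
  have : Nontrivial V := Fintype.one_lt_card_iff_nontrivial.1 (by omega)
  exact hG.preconnected.degree_pos_of_nontrivial v

theorem acceptance_nonneg {x : ℝ} (hx : 0 < x) (A : Finset (Sym2 V)) (u v : V) :
    0 ≤ acceptance G x A u v := by
  unfold acceptance
  dsimp only
  split_ifs <;> positivity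

theorem acceptance_le_half (x : ℝ) (A : Finset (Sym2 V)) (u v : V) :
    acceptance G x A u v ≤ 1 / 2 := by
  unfold acceptance
  dsimp only
  split_ifs <;>
    exact mul_le_of_le_one_right (by norm_num) (min_le_left _ _)

variable (G)

/-- The transition probability of the PS chain. -/
def stepProb (x : ℝ) (A B : Finset (Sym2 V)) : ℝ := (psStep G x A B).toReal

variable {G}

theorem stepProb_eq {x : ℝ} (hx : 0 < x) (hV : 2 ≤ Fintype.card V) (hG : G.Connected)
    (A B : Finset (Sym2 V)) :
    stepProb G x A B = ∑ u ∈ startSet A, ((startSet A).card : ℝ)⁻¹ *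
      ∑ v ∈ G.neighborFinset u, (G.degree u : ℝ)⁻¹ *
        (acceptance G x A u v * (if B = symmDiff A {s(u, v)} then 1 else 0) +
          (1 - acceptance G x A u v) * if B = A then 1 else 0) := by
  unfold stepProb psStep
  rw [← startSet, toReal_drawFrom_apply (startSet_nonempty (by omega) A)]
  refine Finset.sum_congr rfl fun u _ => ?_
  congr 1
  rw [toReal_drawFrom_apply
    (Finset.card_pos.1 (by simpa using degree_pos_of_connected hV hG u))]
  refine Finset.sum_congr rfl fun v _ => ?_
  rw [G.card_neighborFinset_eq_degree, toReal_coin_map_apply (acceptance_nonneg hx A u v)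
    ((acceptance_le_half x A u v).trans (by norm_num))]

theorem stepProb_nonneg (x : ℝ) (A B : Finset (Sym2 V)) : 0 ≤ stepProb G x A B :=
  ENNReal.toReal_nonneg

theorem half_le_stepProb_self {x : ℝ} (hx : 0 < x) (hV : 2 ≤ Fintype.card V) (hG : G.Connected)
    (A : Finset (Sym2 V)) : 1 / 2 ≤ stepProb G x A A := by
  rw [stepProb_eq hx hV hG]
  have hs : (0 : ℝ) < (startSet A).card := by
    exact_mod_cast Finset.card_pos.2 (startSet_nonempty (by omega) A)
  have h1 : ∀ u ∈ startSet A, ((startSet A).card : ℝ)⁻¹ * (1 / 2) ≤ ((startSet A).card : ℝ)⁻¹ *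
      ∑ v ∈ G.neighborFinset u, (G.degree u : ℝ)⁻¹ *
        (acceptance G x A u v * (if A = symmDiff A {s(u, v)} then 1 else 0) +
          (1 - acceptance G x A u v) * if A = A then 1 else 0) := by
    intro u _
    refine mul_le_mul_of_nonneg_left ?_ (by positivity)
    have hd : (0 : ℝ) < G.degree u := by exact_mod_cast degree_pos_of_connected hV hG u
    calc (1 / 2 : ℝ) = ∑ v ∈ G.neighborFinset u, (G.degree u : ℝ)⁻¹ * (1 / 2) := by
          rw [Finset.sum_const, G.card_neighborFinset_eq_degree, nsmul_eq_mul]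
          field_simp
      _ ≤ _ := by
          refine Finset.sum_le_sum fun v _ => mul_le_mul_of_nonneg_left ?_ (by positivity)
          have h2 := acceptance_le_half (G := G) x A u v
          have h3 : 0 ≤ acceptance G x A u v *
              (if A = symmDiff A {s(u, v)} then (1 : ℝ) else 0) :=
            mul_nonneg (acceptance_nonneg hx A u v) (by split_ifs <;> norm_num)
          rw [if_pos rfl]
          linarith
  refine le_trans (le_of_eq ?_) (Finset.sum_le_sum h1)
  rw [Finset.sum_const, nsmul_eq_mul]
  field_simp

theorem exists_toggle_of_stepProb_ne_zero {x : ℝ} (hx : 0 < x) (hV : 2 ≤ Fintype.card V)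
    (hG : G.Connected) {A B : Finset (Sym2 V)} (hAB : B ≠ A) (h : stepProb G x A B ≠ 0) :
    ∃ u v, u ∈ startSet A ∧ G.Adj u v ∧ B = symmDiff A {s(u, v)} := by
  rw [stepProb_eq hx hV hG] at h
  obtain ⟨u, hu, h⟩ := Finset.exists_ne_zero_of_sum_ne_zero h
  obtain ⟨v, hv, h⟩ := Finset.exists_ne_zero_of_sum_ne_zero (right_ne_zero_of_mul h)
  refine ⟨u, v, hu, by simpa using hv, ?_⟩
  by_contra hB
  simp [hB, hAB] at h

theorem sum_stepProb {x : ℝ} (hx : 0 < x) (hV : 2 ≤ Fintype.card V)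
    (hG : G.Connected) {A : Finset (Sym2 V)} (hA : A ∈ psSpace G) :
    ∑ B ∈ psSpace G, stepProb G x A B = 1 := by
  have h1 : ∑ B, stepProb G x A B = 1 := by
    have := (psStep G x A).tsum_coe
    rw [tsum_fintype] at this
    unfold stepProb
    rw [← ENNReal.toReal_sum fun B _ => PMF.apply_ne_top _ _, this, ENNReal.toReal_one]
  rw [← h1]
  refine Finset.sum_subset (Finset.subset_univ _) fun B _ hB => ?_
  by_contra h
  have hBA : B ≠ A := fun h' => hB (h' ▸ hA)
  obtain ⟨u, v, hu, huv, rfl⟩ := exists_toggle_of_stepProb_ne_zero hx hV hG hBA h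
  exact hB (toggle_mem_psSpace hA hu huv)

/-! ### Detailed balance, and a lower bound for the flow across an edge switch -/

/-- The stationary flow through the move `A → A ∆ ab` started at `a`. -/
def flow (G : SimpleGraph V) [DecidableRel G.Adj] (x : ℝ) (A : Finset (Sym2 V)) (a b : V) : ℝ :=
  if a ∈ startSet A then x ^ A.card * ((G.degree a : ℝ)⁻¹ * acceptance G x A a b) else 0

theorem flow_nonneg {x : ℝ} (hx : 0 < x) (A : Finset (Sym2 V)) (a b : V) :
    0 ≤ flow G x A a b := by
  have := acceptance_nonneg (G := G) hx A a b
  rw [flow]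
  split_ifs <;> positivity

theorem toggle_ne (A : Finset (Sym2 V)) (e : Sym2 V) : symmDiff A {e} ≠ A := by
  intro h
  simp at h

/-- The same switch may be proposed from either end of the edge, so the stationary flow is the sum
of two directed flows, which are then matched with those of the reverse move. -/
theorem psWeight_mul_stepProb {x : ℝ} (hx : 0 < x) (hV : 2 ≤ Fintype.card V) (hG : G.Connected)
    {A : Finset (Sym2 V)} (hA : A ∈ psSpace G) {a b : V} (hab : G.Adj a b) :
    psWeight x A * stepProb G x A (symmDiff A {s(a, b)}) = flow G x A a b + flow G x A b a := by
  rw [stepProb_eq hx hV hG, ← Finset.mul_sum, ← mul_assoc, card_startSet hA x (by omega)]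
  have h1 : ∀ u v, ((symmDiff A {s(a, b)} = symmDiff A {s(u, v)}) ↔ s(u, v) = s(a, b)) := by
    intro u v
    rw [(symmDiff_right_injective A).eq_iff, Finset.singleton_inj, eq_comm]
  simp only [h1, toggle_ne, if_false, mul_zero, add_zero]
  have h2 : ∀ u, (∑ v ∈ G.neighborFinset u, (G.degree u : ℝ)⁻¹ *
      (acceptance G x A u v * if s(u, v) = s(a, b) then 1 else 0)) =
      (if u = a then (G.degree a : ℝ)⁻¹ * acceptance G x A a b else 0) +
        if u = b then (G.degree b : ℝ)⁻¹ * acceptance G x A b a else 0 := by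
    intro u
    by_cases hua : u = a
    · subst hua
      have hub : u ≠ b := hab.ne
      rw [if_pos rfl, if_neg hub, add_zero, Finset.sum_eq_single b]
      · simp
      · intro v _ hvb
        rw [if_neg, mul_zero, mul_zero]
        intro h
        rcases Sym2.eq_iff.1 h with ⟨-, h'⟩ | ⟨h', -⟩
        · exact hvb h'
        · exact hub h'
      · intro hb
        exact absurd ((G.mem_neighborFinset u b).2 hab) hb
    · by_cases hub : u = b
      · subst hub
        rw [if_neg hua, if_pos rfl, zero_add, Finset.sum_eq_single a]
        · simp [Sym2.eq_swap]
        · intro v _ hva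
          rw [if_neg, mul_zero, mul_zero]
          intro h
          rcases Sym2.eq_iff.1 h with ⟨h', -⟩ | ⟨-, h'⟩
          · exact hua h'
          · exact hva h'
        · intro ha
          exact absurd ((G.mem_neighborFinset u a).2 hab.symm) ha
      · rw [if_neg hua, if_neg hub, add_zero]
        refine Finset.sum_eq_zero fun v _ => ?_
        rw [if_neg, mul_zero, mul_zero]
        intro h
        rcases Sym2.eq_iff.1 h with ⟨h', -⟩ | ⟨h', -⟩
        · exact hua h'
        · exact hub h'
  simp only [h2, Finset.sum_add_distrib, Finset.sum_ite_eq', flow]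
  rw [mul_add]
  simp only [mul_ite, mul_zero]

/-- The Metropolis identity: both sides are the minimum of x^|A| and x^|A △ e|. -/
theorem mul_min_ratio {x : ℝ} (hx : 0 < x) (A : Finset (Sym2 V)) (e : Sym2 V) :
    x ^ A.card * min 1 (ratio x A e) =
      x ^ (symmDiff A {e}).card * min 1 (ratio x (symmDiff A {e}) e) := by
  have hr : 0 < ratio x A e := by
    rw [ratio]
    split_ifs <;> positivity
  rw [ratio_symmDiff, pow_card_symmDiff hx, mul_assoc, mul_min_of_nonneg _ _ hr.le,
    mul_inv_cancel₀ hr.ne', mul_one, min_comm]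

theorem acceptance_of_oddSet_eq_empty {x : ℝ} {A : Finset (Sym2 V)} {a b : V}
    (h : oddSet A = ∅ ∨ oddSet (symmDiff A {s(a, b)}) = ∅) :
    acceptance G x A a b = 1 / 2 * min 1 (ratio x A s(a, b)) := by
  unfold acceptance
  dsimp only
  rw [if_neg, ratio]
  rintro ⟨h1, h2, -⟩
  rw [mem_oddClass] at h1 h2
  rcases h with h | h
  · simp [h] at h1
  · simp [h] at h2

theorem acceptance_of_card {x : ℝ} {A : Finset (Sym2 V)} {a b : V} (hA : A ∈ psSpace G)
    (hB : symmDiff A {s(a, b)} ∈ psSpace G)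
    (h : oddSet A ≠ ∅) (h' : oddSet (symmDiff A {s(a, b)}) ≠ ∅) (ha : a ∈ oddSet A) :
    acceptance G x A a b = 1 / 2 * min 1 ((G.degree a : ℝ) / G.degree b * ratio x A s(a, b)) := by
  unfold acceptance
  dsimp only
  rw [if_pos, ratio]
  have card_two : ∀ C ∈ psSpace G, oddSet C ≠ ∅ → C ∈ oddClass G 2 := by
    intro C hC hne
    obtain ⟨h1, h2 | h2⟩ := mem_psSpace.1 hC
    · exact absurd (Finset.card_eq_zero.1 h2) hne
    · exact mem_oddClass.2 ⟨h1, h2⟩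
  exact ⟨card_two A hA h, card_two _ hB h', ha⟩

/-- Between an even set and a set with boundary {a, b}, a move from `a` is matched with the reverse
move from the same vertex `a`. The degree factors agree, so no degree correction is needed in the
acceptance. -/
theorem flow_toggle_of_empty {x : ℝ} (hx : 0 < x) {A : Finset (Sym2 V)} {a b : V} (hab : a ≠ b)
    (h : oddSet A = ∅) : flow G x A a b = flow G x (symmDiff A {s(a, b)}) a b := by
  have hB : oddSet (symmDiff A {s(a, b)}) = {a, b} := by
    rw [oddSet_toggle hab, h, ← Finset.bot_eq_empty, bot_symmDiff]
  rw [flow, flow, if_pos (by simp [startSet, h]), if_pos (by simp [startSet, hB]),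
    acceptance_of_oddSet_eq_empty (Or.inl h), acceptance_of_oddSet_eq_empty (Or.inr (by
      rw [symmDiff_symmDiff_cancel_right, h]))]
  have := mul_min_ratio hx A s(a, b)
  linear_combination (1 / 2 * (G.degree a : ℝ)⁻¹) * this

/-- Here the odd vertex travels from `a` to `b`, so the reverse move starts at `b`. The proposal
probabilities 1/d(a) and 1/d(b) differ, and the ratio of degrees in the acceptance corrects this. -/
theorem flow_toggle_of_ne {x : ℝ} (hx : 0 < x) (hV : 2 ≤ Fintype.card V) (hG : G.Connected)
    {A : Finset (Sym2 V)} {a b : V} (hA : A ∈ psSpace G) (hab : a ≠ b)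
    (hB : symmDiff A {s(a, b)} ∈ psSpace G) (h : oddSet A ≠ ∅)
    (h' : oddSet (symmDiff A {s(a, b)}) ≠ ∅) :
    flow G x A a b = flow G x (symmDiff A {s(a, b)}) b a := by
  have h2 : (oddSet A).card = 2 := by
    rcases (mem_psSpace.1 hA).2 with h0 | h0
    · exact absurd (Finset.card_eq_zero.1 h0) h
    · exact h0
  have hor := mem_startSet_or hab hB
  simp only [startSet, h, if_false] at hor
  -- With both ends odd, the switch would annihilate them and lead to an even set.
  have hnot : ¬(a ∈ oddSet A ∧ b ∈ oddSet A) := by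
    rintro ⟨ha, hb⟩
    apply h'
    have : ({a, b} : Finset V) = oddSet A := by
      refine Finset.eq_of_subset_of_card_le ?_ (by rw [h2, Finset.card_pair hab])
      intro w hw
      rcases Finset.mem_insert.1 hw with rfl | hw
      · exact ha
      · rwa [Finset.mem_singleton.1 hw]
    rw [oddSet_toggle hab, this, symmDiff_self, Finset.bot_eq_empty]
  have hmem : b ∈ oddSet (symmDiff A {s(a, b)}) ↔ a ∈ oddSet A := by
    rw [oddSet_toggle hab, Finset.mem_symmDiff]
    simp only [Finset.mem_insert, Finset.mem_singleton, or_true, not_true_eq_false, and_false,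
      true_and, false_or]
    tauto
  simp only [flow, startSet, h, h', if_false, hmem]
  split_ifs with ha
  · have hsw : s(b, a) = s(a, b) := Sym2.eq_swap
    have hA' : symmDiff (symmDiff A {s(a, b)}) {s(b, a)} = A := by
      rw [hsw, symmDiff_symmDiff_cancel_right]
    have hda : (0 : ℝ) < G.degree a := by exact_mod_cast degree_pos_of_connected hV hG a
    have hdb : (0 : ℝ) < G.degree b := by exact_mod_cast degree_pos_of_connected hV hG b
    have hr : 0 < ratio x A s(a, b) := by
      rw [ratio]
      split_ifs <;> positivity
    rw [acceptance_of_card hA hB h h' ha, acceptance_of_card hB (by rwa [hA']) h' (by rwa [hA'])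
      (hmem.2 ha), hsw, ratio_symmDiff, pow_card_symmDiff hx]
    set r := ratio x A s(a, b)
    -- Both directed flows reduce to min(1/d(a), r/d(b)), up to the common factor x^|A| / 2.
    have e1 : (G.degree a : ℝ)⁻¹ * min 1 ((G.degree a : ℝ) / G.degree b * r) =
        min (G.degree a : ℝ)⁻¹ (r * (G.degree b : ℝ)⁻¹) := by
      rw [mul_min_of_nonneg _ _ (by positivity)]
      congr 1
      · ring
      · field_simp
    have e2 : r * ((G.degree b : ℝ)⁻¹ * min 1 ((G.degree b : ℝ) / G.degree a * r⁻¹)) =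
        min (G.degree a : ℝ)⁻¹ (r * (G.degree b : ℝ)⁻¹) := by
      rw [← mul_assoc, mul_min_of_nonneg _ _ (by positivity), min_comm]
      congr 1
      · field_simp
      · ring
    linear_combination (x ^ A.card * (1 / 2)) * (e1 - e2)
  · rfl

theorem psWeight_mul_stepProb_toggle {x : ℝ} (hx : 0 < x) (hV : 2 ≤ Fintype.card V)
    (hG : G.Connected) {A : Finset (Sym2 V)} (hA : A ∈ psSpace G) {a b : V} (hab : G.Adj a b)
    (hB : symmDiff A {s(a, b)} ∈ psSpace G) :
    psWeight x A * stepProb G x A (symmDiff A {s(a, b)}) =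
      psWeight x (symmDiff A {s(a, b)}) * stepProb G x (symmDiff A {s(a, b)}) A := by
  have h1 := psWeight_mul_stepProb hx hV hG hB hab
  rw [symmDiff_symmDiff_cancel_right] at h1
  rw [h1, psWeight_mul_stepProb hx hV hG hA hab]
  have hsw : s(b, a) = s(a, b) := Sym2.eq_swap
  by_cases h : oddSet A = ∅
  · have e2 := flow_toggle_of_empty (G := G) hx hab.ne.symm h
    rw [hsw] at e2
    rw [flow_toggle_of_empty hx hab.ne h, e2]
  · by_cases h' : oddSet (symmDiff A {s(a, b)}) = ∅
    · have e1 := flow_toggle_of_empty (G := G) hx hab.ne h'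
      have e2 := flow_toggle_of_empty (G := G) hx hab.ne.symm h'
      rw [symmDiff_symmDiff_cancel_right] at e1
      rw [hsw, symmDiff_symmDiff_cancel_right] at e2
      rw [e1, e2]
    · have e2 := flow_toggle_of_ne (G := G) hx hV hG hA hab.ne.symm (by rwa [hsw]) h
        (by rwa [hsw])
      rw [hsw] at e2
      rw [flow_toggle_of_ne hx hV hG hA hab.ne hB h h', e2, add_comm]

theorem isLazyReversible_stepProb {x : ℝ} (hx : 0 < x) (hV : 2 ≤ Fintype.card V)
    (hG : G.Connected) : IsLazyReversible (psSpace G) (psWeight x) (stepProb G x) where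
  weight_nonneg A _ := (psWeight_pos hx (by omega) A).le
  nonneg A _ B _ := stepProb_nonneg x A B
  sum_eq_one A hA := sum_stepProb hx hV hG hA
  half_le A _ := half_le_stepProb_self hx hV hG A
  reversible := by
    have key : ∀ A ∈ psSpace G, ∀ B ∈ psSpace G, B ≠ A → stepProb G x A B ≠ 0 →
        psWeight x A * stepProb G x A B = psWeight x B * stepProb G x B A := by
      intro A hA B hB hne h
      obtain ⟨u, v, -, huv, rfl⟩ := exists_toggle_of_stepProb_ne_zero hx hV hG hne h
      exact psWeight_mul_stepProb_toggle hx hV hG hA huv hB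
    intro A hA B hB
    by_cases hne : B = A
    · rw [hne]
    · by_cases h : stepProb G x A B = 0
      · by_cases h' : stepProb G x B A = 0
        · rw [h, h', mul_zero, mul_zero]
        · exact (key B hB A hA (Ne.symm hne) h').symm
      · exact key A hA B hB hne h

/-- Multiplied by 1/d(a), the acceptance is one half of min(1/d(a), r/d(b)) or of min(1, r)/d(a). As
r ≥ x and the degrees are at most Δ, both are at least x/(2Δ). -/
theorem le_flow {x : ℝ} (hx : 0 < x) (h1 : x < 1) (hV : 2 ≤ Fintype.card V) (hG : G.Connected)
    {A : Finset (Sym2 V)} {a b : V} (ha : a ∈ startSet A) :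
    x ^ A.card * (x / (2 * G.maxDegree)) ≤ flow G x A a b := by
  have hda : (0 : ℝ) < G.degree a := by exact_mod_cast degree_pos_of_connected hV hG a
  have hdb : (0 : ℝ) < G.degree b := by exact_mod_cast degree_pos_of_connected hV hG b
  have hma : (G.degree a : ℝ) ≤ G.maxDegree := by exact_mod_cast G.degree_le_maxDegree a
  have hmb : (G.degree b : ℝ) ≤ G.maxDegree := by exact_mod_cast G.degree_le_maxDegree b
  have hm : (0 : ℝ) < G.maxDegree := hda.trans_le hma
  have hr : x ≤ ratio x A s(a, b) := le_ratio hx h1 A _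
  rw [flow, if_pos ha]
  refine mul_le_mul_of_nonneg_left ?_ (by positivity)
  have i1 : (G.maxDegree : ℝ)⁻¹ ≤ (G.degree a : ℝ)⁻¹ := inv_anti₀ hda hma
  have i2 : (G.maxDegree : ℝ)⁻¹ ≤ (G.degree b : ℝ)⁻¹ := inv_anti₀ hdb hmb
  have i0 : x / (2 * (G.maxDegree : ℝ)) = 1 / 2 * ((G.maxDegree : ℝ)⁻¹ * x) := by
    field_simp
  have e1 : (G.degree a : ℝ)⁻¹ * ((G.degree a : ℝ) / G.degree b * ratio x A s(a, b)) =
      (G.degree b : ℝ)⁻¹ * ratio x A s(a, b) := by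
    field_simp
  unfold acceptance
  dsimp only
  rw [← ratio, i0]
  split_ifs
  · rw [mul_left_comm _ (1 / 2 : ℝ)]
    refine mul_le_mul_of_nonneg_left ?_ (by norm_num)
    rw [mul_min_of_nonneg _ _ (by positivity), e1, mul_one]
    refine le_min ?_ (by gcongr)
    calc (G.maxDegree : ℝ)⁻¹ * x ≤ (G.maxDegree : ℝ)⁻¹ * 1 := by gcongr
      _ ≤ _ := by rwa [mul_one]
  · rw [mul_left_comm _ (1 / 2 : ℝ)]
    refine mul_le_mul_of_nonneg_left ?_ (by norm_num)
    gcongr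
    exact le_min h1.le hr

theorem le_psWeight_mul_stepProb {x : ℝ} (hx : 0 < x) (h1 : x < 1) (hV : 2 ≤ Fintype.card V)
    (hG : G.Connected) {A : Finset (Sym2 V)} (hA : A ∈ psSpace G) {e : Sym2 V}
    (he : e ∈ G.edgeFinset) (hB : symmDiff A {e} ∈ psSpace G) :
    x ^ A.card * (x / (2 * G.maxDegree)) ≤ psWeight x A * stepProb G x A (symmDiff A {e}) := by
  induction e using Sym2.ind with
  | _ a b =>
  have hab : G.Adj a b := by simpa using he
  rw [psWeight_mul_stepProb hx hV hG hA hab]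
  have ha := flow_nonneg (G := G) hx A a b
  have hb := flow_nonneg (G := G) hx A b a
  rcases mem_startSet_or hab.ne hB with h | h
  · linarith [le_flow (G := G) (b := b) hx h1 hV hG h]
  · linarith [le_flow (G := G) (b := a) hx h1 hV hG h]

end Kernel

/-! ### Canonical paths to the even subgraphs -/

section Peel

variable {V : Type*} [Fintype V] [DecidableEq V] {G : SimpleGraph V} [DecidableRel G.Adj]

/-- Removing any edge of an even set leaves two odd vertices. If there are odd vertices already,
remove an edge at one of them. Iterating dismantles the difference of two states inside the PS
space. -/
theorem exists_erase_mem_psSpace {D : Finset (Sym2 V)} (hD : D ∈ psSpace G) (hne : D.Nonempty) :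
    ∃ e ∈ D, D.erase e ∈ psSpace G := by
  have hsub := (mem_psSpace.1 hD).1
  by_cases h : oddSet D = ∅
  · obtain ⟨e, he⟩ := hne
    refine ⟨e, he, ?_⟩
    rw [← symmDiff_singleton_of_mem he]
    have heG := hsub he
    induction e using Sym2.ind with
    | _ a b => exact toggle_mem_psSpace hD (by simp [startSet, h]) (by simpa using heG)
  · obtain ⟨u, hu⟩ := Finset.nonempty_iff_ne_empty.2 h
    obtain ⟨w, hw⟩ := exists_mem_of_mem_oddSet hu
    refine ⟨_, hw, ?_⟩
    rw [← symmDiff_singleton_of_mem hw]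
    exact toggle_mem_psSpace hD (by simpa [startSet, h] using hu) (by simpa using hsub hw)

variable (G) in
/-- An edge of `D` whose removal does not leave the PS space. -/
def pick [Nonempty V] (D : Finset (Sym2 V)) : Sym2 V :=
  open Classical in
  if h : ∃ e ∈ D, D.erase e ∈ psSpace G then h.choose else s(Classical.arbitrary V,
    Classical.arbitrary V)

variable [Nonempty V]

theorem pick_mem {D : Finset (Sym2 V)} (hD : D ∈ psSpace G) (hne : D.Nonempty) :
    pick G D ∈ D ∧ D.erase (pick G D) ∈ psSpace G := by
  have h := exists_erase_mem_psSpace hD hne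
  rw [pick, dif_pos h]
  exact h.choose_spec

variable (G) in
/-- The set that is left of `D` after `j` removals. -/
def peel (D : Finset (Sym2 V)) (j : ℕ) : Finset (Sym2 V) :=
  (fun C => C.erase (pick G C))^[j] D

theorem peel_succ (D : Finset (Sym2 V)) (j : ℕ) :
    peel G D (j + 1) = (peel G D j).erase (pick G (peel G D j)) :=
  Function.iterate_succ_apply' _ _ _

theorem peel_spec {D : Finset (Sym2 V)} (hD : D ∈ psSpace G) {j : ℕ} (hj : j ≤ D.card) :
    peel G D j ∈ psSpace G ∧ (peel G D j).card = D.card - j := by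
  induction j with
  | zero => exact ⟨hD, rfl⟩
  | succ j ih =>
    obtain ⟨h1, h2⟩ := ih (by omega)
    have hne : (peel G D j).Nonempty := Finset.card_pos.1 (by omega)
    obtain ⟨h3, h4⟩ := pick_mem h1 hne
    rw [peel_succ]
    refine ⟨h4, ?_⟩
    rw [Finset.card_erase_of_mem h3, h2]
    omega

theorem pick_peel_mem {D : Finset (Sym2 V)} (hD : D ∈ psSpace G) {j : ℕ} (hj : j < D.card) :
    pick G (peel G D j) ∈ peel G D j := by
  obtain ⟨h1, h2⟩ := peel_spec hD hj.le
  exact (pick_mem h1 (Finset.card_pos.1 (by omega))).1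

theorem peel_antitone (D : Finset (Sym2 V)) : Antitone (peel G D) :=
  antitone_nat_of_succ_le fun j => by
    rw [peel_succ]
    exact Finset.erase_subset _ _

/-- A removed edge never returns, so the edge that is switched tells the time of the switch. The
decoding of a path depends on this. -/
theorem pick_peel_injective {D : Finset (Sym2 V)} (hD : D ∈ psSpace G) {i j : ℕ}
    (hi : i < D.card) (hj : j < D.card) (h : pick G (peel G D i) = pick G (peel G D j)) :
    i = j := by
  have key : ∀ {i j : ℕ}, j < D.card → i < j →
      pick G (peel G D i) ≠ pick G (peel G D j) := by
    intro i j hj hij h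
    have h1 := peel_antitone D (Nat.succ_le_of_lt hij) (pick_peel_mem hD hj)
    rw [Nat.succ_eq_add_one, peel_succ, ← h] at h1
    exact absurd rfl (Finset.ne_of_mem_erase h1)
  rcases lt_trichotomy i j with hlt | rfl | hlt
  · exact absurd h (key hj hlt)
  · rfl
  · exact absurd h.symm (key hi hlt)

theorem symmDiff_peel_succ {D : Finset (Sym2 V)} (hD : D ∈ psSpace G) (F : Finset (Sym2 V))
    {j : ℕ} (hj : j < D.card) :
    symmDiff F (peel G D (j + 1)) = symmDiff (symmDiff F (peel G D j)) {pick G (peel G D j)} := by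
  rw [peel_succ, ← symmDiff_singleton_of_mem (pick_peel_mem hD hj), symmDiff_assoc]

/-- Telescope `f` along the path from F △ D to F and apply Cauchy–Schwarz; the length of the path is
|D|. -/
theorem sq_sub_le_sum_peel {D : Finset (Sym2 V)} (hD : D ∈ psSpace G) (F : Finset (Sym2 V))
    (f : Finset (Sym2 V) → ℝ) :
    (f (symmDiff F D) - f F) ^ 2 ≤ D.card * ∑ j ∈ Finset.range D.card,
      (f (symmDiff F (peel G D j)) -
        f (symmDiff (symmDiff F (peel G D j)) {pick G (peel G D j)})) ^ 2 := by
  have hend : peel G D D.card = ∅ := by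
    have := (peel_spec hD le_rfl).2
    rwa [Nat.sub_self, Finset.card_eq_zero] at this
  have htel : f (symmDiff F D) - f F = ∑ j ∈ Finset.range D.card,
      (f (symmDiff F (peel G D j)) -
        f (symmDiff (symmDiff F (peel G D j)) {pick G (peel G D j)})) := by
    have := Finset.sum_range_sub' (fun j => f (symmDiff F (peel G D j))) D.card
    rw [hend] at this
    simp only [← Finset.bot_eq_empty, symmDiff_bot] at this
    have h0 : peel G D 0 = D := rfl
    rw [h0] at this
    rw [← this]
    exact Finset.sum_congr rfl fun j hj => by
      rw [symmDiff_peel_succ hD F (Finset.mem_range.1 hj)]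
  rw [htel]
  have := sq_sum_le_card_mul_sum_sq (s := Finset.range D.card) (f := fun j =>
    f (symmDiff F (peel G D j)) - f (symmDiff (symmDiff F (peel G D j)) {pick G (peel G D j)}))
  rwa [Finset.card_range] at this

end Peel

theorem card_symmDiff_add_card_inter {α : Type*} [DecidableEq α] (S T : Finset α) :
    (symmDiff S T).card + 2 * (S ∩ T).card = S.card + T.card := by
  have h1 : (symmDiff S T).card = (S \ T).card + (T \ S).card := by
    rw [symmDiff_def, Finset.sup_eq_union, Finset.card_union_of_disjoint]
    exact disjoint_sdiff_sdiff
  have h2 := Finset.card_sdiff_add_card_inter S T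
  have h3 := Finset.card_sdiff_add_card_inter T S
  rw [Finset.inter_comm] at h3
  omega

/-- Each edge of `D` lies in exactly one of `I` and `F`, so switching `D` in both sets only moves
edges from one to the other. Hence the weight x^|I| x^|F| of a pair equals the weight of its code.
-/
theorem card_symmDiff_add_card_symmDiff {α : Type*} [DecidableEq α] {I F D : Finset α}
    (hD : D ⊆ symmDiff I F) :
    (symmDiff F D).card + (symmDiff I D).card = I.card + F.card := by
  have h1 := card_symmDiff_add_card_inter F D
  have h2 := card_symmDiff_add_card_inter I D
  have h3 : (F ∩ D).card + (I ∩ D).card = D.card := by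
    rw [← Finset.card_union_of_disjoint]
    · congr 1
      ext e
      simp only [Finset.mem_union, Finset.mem_inter]
      constructor
      · tauto
      · intro he
        rcases Finset.mem_symmDiff.1 (hD he) with h | h <;> tauto
    · rw [Finset.disjoint_left]
      intro e he1 he2
      rw [Finset.mem_inter] at he1 he2
      rcases Finset.mem_symmDiff.1 (hD he1.2) with h | h <;> tauto
  omega

/-! ### The Poincaré inequality, by injective encoding of canonical paths -/

section Poincare

variable {V : Type*} [Fintype V] [DecidableEq V] {G : SimpleGraph V} [DecidableRel G.Adj]

theorem card_edgeFinset_pos (hV : 2 ≤ Fintype.card V) (hG : G.Connected) :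
    0 < G.edgeFinset.card := by
  obtain ⟨v⟩ := hG.nonempty
  obtain ⟨w, hw⟩ := Finset.card_pos.1 (by
    rw [G.card_neighborFinset_eq_degree]
    exact degree_pos_of_connected hV hG v : 0 < (G.neighborFinset v).card)
  exact Finset.card_pos.2 ⟨s(v, w), by simpa using hw⟩

variable (G) in
/-- The edge sets with at most four odd vertices. -/
def codeSpace : Finset (Finset (Sym2 V)) :=
  G.edgeFinset.powerset.filter fun A => (oddSet A).card ≤ 4

theorem card_even_subsets_le (hV : 2 ≤ Fintype.card V) :
    ((Finset.univ : Finset (Finset V)).filter fun S =>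
      S.card = 0 ∨ S.card = 2 ∨ S.card = 4).card ≤ (1 / 4 : ℝ) * (Fintype.card V : ℝ) ^ 4 := by
  set n := Fintype.card V with hn
  have h1 : ((Finset.univ : Finset (Finset V)).filter fun S =>
      S.card = 0 ∨ S.card = 2 ∨ S.card = 4).card ≤ n.choose 0 + n.choose 2 + n.choose 4 := by
    have hsub : ((Finset.univ : Finset (Finset V)).filter fun S =>
        S.card = 0 ∨ S.card = 2 ∨ S.card = 4) ⊆ (Finset.univ.powersetCard 0 ∪
          Finset.univ.powersetCard 2) ∪ Finset.univ.powersetCard 4 := by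
      intro S hS
      simpa [Finset.mem_powersetCard, or_assoc] using hS
    refine (Finset.card_le_card hsub).trans ((Finset.card_union_le _ _).trans ?_)
    have := Finset.card_union_le ((Finset.univ : Finset V).powersetCard 0)
      (Finset.univ.powersetCard 2)
    simp only [Finset.card_powersetCard, Finset.card_univ, ← hn] at this ⊢
    omega
  have h2 : ((n.choose 2 : ℕ) : ℝ) ≤ (n : ℝ) ^ 2 / 2 := by
    simpa [Nat.factorial] using Nat.choose_le_pow_div (α := ℝ) 2 n
  have h4 : ((n.choose 4 : ℕ) : ℝ) ≤ (n : ℝ) ^ 4 / 24 := by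
    simpa [Nat.factorial] using Nat.choose_le_pow_div (α := ℝ) 4 n
  have h1' : ((((Finset.univ : Finset (Finset V)).filter fun S =>
      S.card = 0 ∨ S.card = 2 ∨ S.card = 4).card : ℕ) : ℝ) ≤
        1 + (n.choose 2 : ℕ) + (n.choose 4 : ℕ) := by
    exact_mod_cast by simpa using h1
  have hn' : (2 : ℝ) ≤ n := by exact_mod_cast hV
  -- With n² ≥ 4, 1 + n²/2 + n⁴/24 ≤ (1/16 + 1/8 + 1/24) n⁴ = 11/48 · n⁴.
  have hn2 : (4 : ℝ) ≤ (n : ℝ) ^ 2 := by nlinarith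
  nlinarith

/-- Group the codes by their boundary: there are at most n⁴/4 even boundaries of size at most four,
and each of the generating functions is at most Z_∅. -/
theorem sum_codeSpace_le {x : ℝ} (h0 : 0 ≤ x) (h1 : x ≤ 1) (hV : 2 ≤ Fintype.card V) :
    ∑ A ∈ codeSpace G, x ^ A.card ≤ (1 / 4 : ℝ) * (Fintype.card V : ℝ) ^ 4 * oddWeight G x ∅ := by
  set 𝒮 := (Finset.univ : Finset (Finset V)).filter fun S =>
      S.card = 0 ∨ S.card = 2 ∨ S.card = 4
  have hmaps : ∀ A ∈ codeSpace G, oddSet A ∈ 𝒮 := by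
    intro A hA
    obtain ⟨hA, h4⟩ := Finset.mem_filter.1 hA
    have := even_card_oddSet (not_isDiag_of_subset G (Finset.mem_powerset.1 hA))
    rw [Nat.even_iff] at this
    rw [Finset.mem_filter]
    exact ⟨Finset.mem_univ _, by omega⟩
  rw [← Finset.sum_fiberwise_of_maps_to hmaps]
  calc ∑ S ∈ 𝒮, ∑ A ∈ codeSpace G with oddSet A = S, x ^ A.card
      ≤ ∑ S ∈ 𝒮, oddWeight G x ∅ := by
        refine Finset.sum_le_sum fun S _ => le_trans ?_ (oddWeight_le h0 h1 S)
        refine Finset.sum_le_sum_of_subset_of_nonneg ?_ fun _ _ _ => by positivity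
        intro A hA
        simp only [codeSpace, Finset.mem_filter] at hA ⊢
        exact ⟨hA.1.1, hA.2⟩
    _ = 𝒮.card * oddWeight G x ∅ := by rw [Finset.sum_const, nsmul_eq_mul]
    _ ≤ _ := mul_le_mul_of_nonneg_right (card_even_subsets_le hV) (oddWeight_nonneg h0 _)

theorem psWeight_le {x : ℝ} (h0 : 0 ≤ x) (hV : 2 ≤ Fintype.card V) (A : Finset (Sym2 V)) :
    psWeight x A ≤ Fintype.card V * x ^ A.card := by
  have hn : (2 : ℝ) ≤ Fintype.card V := by exact_mod_cast hV
  rw [psWeight, mul_comm]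
  refine mul_le_mul_of_nonneg_right ?_ (by positivity)
  split_ifs <;> linarith

theorem symmDiff_mem_psSpace_of_even {A F : Finset (Sym2 V)} (hA : A ∈ psSpace G)
    (hF : F ∈ oddClass G 0) : symmDiff F A ∈ psSpace G := by
  obtain ⟨h1, h2⟩ := mem_psSpace.1 hA
  obtain ⟨h3, h4⟩ := mem_oddClass.1 hF
  refine mem_psSpace.2 ⟨?_, ?_⟩
  · exact (Finset.symmDiff_subset_union).trans (Finset.union_subset h3 h1)
  · rw [oddSet_symmDiff, Finset.card_eq_zero.1 h4, ← Finset.bot_eq_empty, bot_symmDiff]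
    exact h2

variable (G) in
/-- The unnormalised energy of a function, as a sum over edge switches. -/
def toggleEnergy (x : ℝ) (f : Finset (Sym2 V) → ℝ) : ℝ :=
  ∑ p ∈ (psSpace G ×ˢ G.edgeFinset).filter (fun p => symmDiff p.1 {p.2} ∈ psSpace G),
    x ^ p.1.card * (f p.1 - f (symmDiff p.1 {p.2})) ^ 2

/-- The factor 4Δ/x combines the flow bound x/(2Δ) with the 1/2 in the Dirichlet form. Distinct
edges lead to distinct neighbours, so no transition is counted twice. -/
theorem toggleEnergy_le {x : ℝ} (hx : 0 < x) (h1 : x < 1) (hV : 2 ≤ Fintype.card V)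
    (hG : G.Connected) (f : Finset (Sym2 V) → ℝ) :
    toggleEnergy G x f ≤
      4 * G.maxDegree / x * dirichlet (psSpace G) (psWeight x) (stepProb G x) f := by
  have hm : (0 : ℝ) < G.maxDegree := by
    obtain ⟨v⟩ := hG.nonempty
    exact_mod_cast (degree_pos_of_connected hV hG v).trans_le (G.degree_le_maxDegree v)
  have hc : (0 : ℝ) < x / (2 * G.maxDegree) := by positivity
  have key : x / (2 * G.maxDegree) * toggleEnergy G x f ≤
      ∑ A ∈ psSpace G, ∑ B ∈ psSpace G, psWeight x A * stepProb G x A B * (f A - f B) ^ 2 := by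
    rw [toggleEnergy, Finset.mul_sum, Finset.sum_filter, Finset.sum_product]
    refine Finset.sum_le_sum fun A hA => ?_
    rw [← Finset.sum_filter]
    calc ∑ e ∈ G.edgeFinset with symmDiff A {e} ∈ psSpace G,
          x / (2 * G.maxDegree) * (x ^ A.card * (f A - f (symmDiff A {e})) ^ 2)
        ≤ ∑ e ∈ G.edgeFinset with symmDiff A {e} ∈ psSpace G,
          psWeight x A * stepProb G x A (symmDiff A {e}) * (f A - f (symmDiff A {e})) ^ 2 := by
          refine Finset.sum_le_sum fun e he => ?_
          obtain ⟨he, hB⟩ := Finset.mem_filter.1 he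
          rw [← mul_assoc, mul_comm (x / _)]
          exact mul_le_mul_of_nonneg_right (le_psWeight_mul_stepProb hx h1 hV hG hA he hB)
            (sq_nonneg _)
      _ = ∑ B ∈ (G.edgeFinset.filter fun e => symmDiff A {e} ∈ psSpace G).image
            fun e => symmDiff A {e},
          psWeight x A * stepProb G x A B * (f A - f B) ^ 2 := by
          rw [Finset.sum_image]
          intro e _ e' _ h
          simpa using symmDiff_right_injective A h
      _ ≤ _ := by
          refine Finset.sum_le_sum_of_subset_of_nonneg ?_ fun B _ _ => ?_
          · intro B hB
            obtain ⟨e, he, rfl⟩ := Finset.mem_image.1 hB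
            exact (Finset.mem_filter.1 he).2
          · exact mul_nonneg (mul_nonneg (psWeight_pos hx (by omega) A).le
              (stepProb_nonneg x A B)) (sq_nonneg _)
  rw [dirichlet]
  rw [← le_div_iff₀' hc] at key
  refine key.trans (le_of_eq ?_)
  field_simp
  ring

/-- The heart of the mixing bound. A move on the path from `I` to `F` is sent to its state `T`, its
edge `E` and the code `N`, the state that the same partial switch would give from the other end. The
map is injective, conserves the weight, and its codes have at most 2 + 2 odd vertices; so summing
over all moves is dominated by the energy times the weight of the code space. Since the end point
`F` is even, adding it to a part of `symmDiff I F` does not change the boundary, and the path stays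
in the PS space. -/
theorem sum_sum_sq_sub_le {x : ℝ} (hx : 0 < x) (hV : 2 ≤ Fintype.card V) (hG : G.Connected)
    (f : Finset (Sym2 V) → ℝ) :
    ∑ I ∈ psSpace G, ∑ F ∈ oddClass G 0, psWeight x I * psWeight x F * (f I - f F) ^ 2 ≤
      G.edgeFinset.card * (Fintype.card V : ℝ) ^ 2 * (∑ A ∈ codeSpace G, x ^ A.card) *
        toggleEnergy G x f := by
  have : Nonempty V := hG.nonempty
  set m := G.edgeFinset.card with hm
  set n : ℝ := ((Fintype.card V : ℕ) : ℝ) with hn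
  -- a point `((I, F), j)` stands for the `j`th move on the path from `I` to `F`
  set J := ((psSpace G ×ˢ oddClass G 0) ×ˢ Finset.range m).filter
    (fun p => p.2 < (symmDiff p.1.1 p.1.2).card) with hJ
  set K := ((psSpace G ×ˢ G.edgeFinset).filter (fun p => symmDiff p.1 {p.2} ∈ psSpace G)) ×ˢ
    codeSpace G with hK
  let T : (Finset (Sym2 V) × Finset (Sym2 V)) × ℕ → Finset (Sym2 V) := fun p =>
    symmDiff p.1.2 (peel G (symmDiff p.1.1 p.1.2) p.2)
  let E : (Finset (Sym2 V) × Finset (Sym2 V)) × ℕ → Sym2 V := fun p =>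
    pick G (peel G (symmDiff p.1.1 p.1.2) p.2)
  let N : (Finset (Sym2 V) × Finset (Sym2 V)) × ℕ → Finset (Sym2 V) := fun p =>
    symmDiff p.1.1 (peel G (symmDiff p.1.1 p.1.2) p.2)
  let φ : (Finset (Sym2 V) × Finset (Sym2 V)) × ℕ →
      (Finset (Sym2 V) × Sym2 V) × Finset (Sym2 V) := fun p => ((T p, E p), N p)
  let g : Finset (Sym2 V) → Sym2 V → ℝ := fun A e => (f A - f (symmDiff A {e})) ^ 2
  let h : (Finset (Sym2 V) × Sym2 V) × Finset (Sym2 V) → ℝ := fun q =>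
    m * n ^ 2 * (x ^ q.1.1.card * g q.1.1 q.1.2 * x ^ q.2.card)
  have hD : ∀ {I F}, I ∈ psSpace G → F ∈ oddClass G 0 → symmDiff I F ∈ psSpace G := by
    intro I F hI hF
    rw [symmDiff_comm]
    exact symmDiff_mem_psSpace_of_even hI hF
  have hcard : ∀ {A}, A ∈ psSpace G → A.card ≤ m := fun hA =>
    Finset.card_le_card (mem_psSpace.1 hA).1
  have hmem : ∀ p ∈ J, (p.1.1 ∈ psSpace G ∧ p.1.2 ∈ oddClass G 0) ∧
      p.2 < (symmDiff p.1.1 p.1.2).card := by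
    intro p hp
    simp only [hJ, Finset.mem_filter, Finset.mem_product] at hp
    exact ⟨hp.1.1, hp.2⟩
  have h_nonneg : ∀ q, 0 ≤ h q := fun q => by
    have : 0 ≤ g q.1.1 q.1.2 := sq_nonneg _
    positivity
  have hφ : ∀ p ∈ J, φ p ∈ K := by
    intro p hp
    obtain ⟨⟨hI, hF⟩, hj⟩ := hmem p hp
    have hDp := hD hI hF
    have hpeel := (peel_spec hDp hj.le).1
    have hpeel' := (peel_spec hDp (Nat.succ_le_of_lt hj)).1
    simp only [hK, φ, Finset.mem_product, Finset.mem_filter]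
    refine ⟨⟨⟨symmDiff_mem_psSpace_of_even hpeel hF, ?_⟩, ?_⟩, ?_⟩
    · exact (mem_psSpace.1 hpeel).1 (pick_peel_mem hDp hj)
    · simp only [T, E]
      rw [← symmDiff_peel_succ hDp _ hj]
      exact symmDiff_mem_psSpace_of_even hpeel' hF
    · rw [codeSpace, Finset.mem_filter, Finset.mem_powerset]
      refine ⟨(Finset.symmDiff_subset_union).trans
        (Finset.union_subset (mem_psSpace.1 hI).1 (mem_psSpace.1 hpeel).1), ?_⟩
      simp only [N]
      rw [oddSet_symmDiff]
      have i1 := Finset.card_le_card (Finset.symmDiff_subset_union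
        (s := oddSet p.1.1) (t := oddSet (peel G (symmDiff p.1.1 p.1.2) p.2)))
      have i2 := Finset.card_union_le (oddSet p.1.1)
        (oddSet (peel G (symmDiff p.1.1 p.1.2) p.2))
      have i3 := (mem_psSpace_iff_le.1 hI).2
      have i4 := (mem_psSpace_iff_le.1 hpeel).2
      omega
  -- Decoding: T △ N = I △ F recovers the difference, hence the order of removal; the edge gives the
  -- time `j`; then the remaining part of the difference is known, and cancelling it in T and N
  -- gives F and I.
  have hinj : Set.InjOn φ J := by
    rintro ⟨⟨I, F⟩, i⟩ hp ⟨⟨I', F'⟩, j⟩ hq hpq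
    obtain ⟨⟨hI, hF⟩, hi⟩ := hmem _ hp
    obtain ⟨⟨hI', hF'⟩, hj⟩ := hmem _ hq
    simp only [φ, T, E, N, Prod.mk.injEq] at hpq hi hj hI hF hI' hF'
    obtain ⟨⟨hT, hE⟩, hN⟩ := hpq
    have hDD : symmDiff I F = symmDiff I' F' := by
      have e1 : ∀ A B C : Finset (Sym2 V), symmDiff (symmDiff A C) (symmDiff B C) =
          symmDiff A B := fun A B C => by
        rw [symmDiff_symmDiff_symmDiff_comm, symmDiff_self, symmDiff_bot]
      rw [← e1 I F, hT, hN, e1]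
    rw [← hDD] at hE hT hN hj
    have hij := pick_peel_injective (hD hI hF) hi hj hE
    subst hij
    rw [symmDiff_left_injective _ hT, symmDiff_left_injective _ hN]
  calc ∑ I ∈ psSpace G, ∑ F ∈ oddClass G 0, psWeight x I * psWeight x F * (f I - f F) ^ 2
      ≤ ∑ I ∈ psSpace G, ∑ F ∈ oddClass G 0, ∑ j ∈ Finset.range (symmDiff I F).card,
          h (φ ((I, F), j)) := by
        refine Finset.sum_le_sum fun I hI => Finset.sum_le_sum fun F hF => ?_
        have hDp := hD hI hF
        have hpath := sq_sub_le_sum_peel hDp F f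
        have e1 : symmDiff F (symmDiff I F) = I := by
          rw [symmDiff_comm I F, symmDiff_symmDiff_cancel_left]
        rw [e1] at hpath
        have hw : psWeight x I * psWeight x F ≤ n ^ 2 * x ^ (I.card + F.card) := by
          calc psWeight x I * psWeight x F ≤ (n * x ^ I.card) * (n * x ^ F.card) :=
                mul_le_mul (psWeight_le hx.le hV I) (psWeight_le hx.le hV F)
                  (psWeight_pos hx (by omega) F).le (by positivity)
            _ = n ^ 2 * x ^ (I.card + F.card) := by rw [pow_add]; ring
        calc psWeight x I * psWeight x F * (f I - f F) ^ 2
            ≤ (n ^ 2 * x ^ (I.card + F.card)) * (m * ∑ j ∈ Finset.range (symmDiff I F).card,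
                g (T ((I, F), j)) (E ((I, F), j))) := by
              refine mul_le_mul hw (hpath.trans ?_) (sq_nonneg _) (by positivity)
              refine mul_le_mul_of_nonneg_right (by exact_mod_cast hcard hDp)
                (Finset.sum_nonneg fun _ _ => sq_nonneg _)
          _ = ∑ j ∈ Finset.range (symmDiff I F).card, h (φ ((I, F), j)) := by
              rw [Finset.mul_sum, Finset.mul_sum]
              refine Finset.sum_congr rfl fun j hj => ?_
              have hsub : peel G (symmDiff I F) j ⊆ symmDiff I F :=
                peel_antitone (G := G) (symmDiff I F) (Nat.zero_le j)
              rw [← card_symmDiff_add_card_symmDiff hsub, pow_add]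
              simp only [h, φ, T, N]
              ring
    _ = ∑ p ∈ J, h (φ p) := by
        rw [hJ, Finset.sum_filter, Finset.sum_product, Finset.sum_product]
        refine Finset.sum_congr rfl fun I hI => Finset.sum_congr rfl fun F hF => ?_
        rw [← Finset.sum_filter]
        refine Finset.sum_congr ?_ fun _ _ => rfl
        ext j
        have := hcard (hD hI hF)
        simp only [Finset.mem_range, Finset.mem_filter]
        omega
    _ = ∑ q ∈ J.image φ, h q := (Finset.sum_image hinj).symm
    _ ≤ ∑ q ∈ K, h q := by
        refine Finset.sum_le_sum_of_subset_of_nonneg ?_ fun q _ _ => h_nonneg q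
        intro q hq
        obtain ⟨p, hp, rfl⟩ := Finset.mem_image.1 hq
        exact hφ p hp
    _ = _ := by
        rw [hK, Finset.sum_product, toggleEnergy, Finset.mul_sum]
        refine Finset.sum_congr rfl fun q _ => ?_
        simp only [h, g, ← Finset.mul_sum]
        ring

/-- The Poincaré inequality for the PS chain. -/
theorem poincare_psChain {x : ℝ} (hx : 0 < x) (h1 : x < 1) (hV : 2 ≤ Fintype.card V)
    (hG : G.Connected) (f : Finset (Sym2 V) → ℝ)
    (hf : ∑ A ∈ psSpace G, psWeight x A * f A = 0) :
    ∑ A ∈ psSpace G, psWeight x A * f A ^ 2 ≤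
      G.edgeFinset.card * G.maxDegree * (Fintype.card V : ℝ) ^ 5 / x *
        dirichlet (psSpace G) (psWeight x) (stepProb G x) f := by
  have hn : (0 : ℝ) < Fintype.card V := by
    have : (2 : ℝ) ≤ Fintype.card V := by exact_mod_cast hV
    linarith
  set n : ℝ := ((Fintype.card V : ℕ) : ℝ)
  set W0 : ℝ := ∑ F ∈ oddClass G 0, psWeight x F with hW0
  have hW0' : W0 = n * oddWeight G x ∅ := sum_oddClass_zero x
  have hl := oddWeight_empty_pos (G := G) hx.le
  have hW0pos : 0 < W0 := by rw [hW0']; positivity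
  -- The variance is compared with the deviation from the mean over the even class alone. Only paths
  -- with an even end are then needed, at the price of dividing by the weight of that class.
  set c : ℝ := (∑ F ∈ oddClass G 0, psWeight x F * f F) / W0 with hc
  have hwpos : ∀ A : Finset (Sym2 V), 0 < psWeight x A := psWeight_pos hx (by omega)
  have hshift : ∑ A ∈ psSpace G, psWeight x A * f A ^ 2 ≤
      ∑ A ∈ psSpace G, psWeight x A * (f A - c) ^ 2 := by
    have e1 : ∑ A ∈ psSpace G, psWeight x A * (f A - c) ^ 2 =
        ∑ A ∈ psSpace G, psWeight x A * f A ^ 2 +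
          c ^ 2 * ∑ A ∈ psSpace G, psWeight x A := by
      have : ∀ A ∈ psSpace G, psWeight x A * (f A - c) ^ 2 = psWeight x A * f A ^ 2 -
          2 * c * (psWeight x A * f A) + c ^ 2 * psWeight x A := fun A _ => by ring
      rw [Finset.sum_congr rfl this, Finset.sum_add_distrib, Finset.sum_sub_distrib,
        ← Finset.mul_sum, ← Finset.mul_sum, hf]
      ring
    rw [e1]
    have : 0 ≤ ∑ A ∈ psSpace G, psWeight x A := Finset.sum_nonneg fun A _ => (hwpos A).le
    have := mul_nonneg (sq_nonneg c) this
    linarith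
  -- Jensen's inequality for the average over `F`, obtained from Cauchy–Schwarz.
  have hjensen : ∀ A, W0 * (f A - c) ^ 2 ≤
      ∑ F ∈ oddClass G 0, psWeight x F * (f A - f F) ^ 2 := by
    intro A
    have e1 : W0 * (f A - c) = ∑ F ∈ oddClass G 0, psWeight x F * (f A - f F) := by
      simp only [mul_sub, Finset.sum_sub_distrib]
      rw [← Finset.sum_mul, ← hW0, hc, mul_div_cancel₀ _ hW0pos.ne']
    have := Finset.sum_sq_le_sum_mul_sum_of_sq_le_mul (oddClass G 0)
      (r := fun F => psWeight x F * (f A - f F)) (f := fun F => psWeight x F)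
      (g := fun F => psWeight x F * (f A - f F) ^ 2) (fun F _ => (hwpos F).le)
      (fun F _ => mul_nonneg (hwpos F).le (sq_nonneg _)) (fun F _ => le_of_eq (by ring))
    rw [← e1, ← hW0, mul_pow, pow_two W0, mul_assoc] at this
    exact le_of_mul_le_mul_left this hW0pos
  have hE0 : 0 ≤ toggleEnergy G x f :=
    Finset.sum_nonneg fun p _ => mul_nonneg (by positivity) (sq_nonneg _)
  have hmain : W0 * ∑ A ∈ psSpace G, psWeight x A * f A ^ 2 ≤
      G.edgeFinset.card * n ^ 2 * ((1 / 4 : ℝ) * n ^ 4 * oddWeight G x ∅) *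
        toggleEnergy G x f := by
    calc W0 * ∑ A ∈ psSpace G, psWeight x A * f A ^ 2
        ≤ W0 * ∑ A ∈ psSpace G, psWeight x A * (f A - c) ^ 2 := by gcongr
      _ = ∑ A ∈ psSpace G, psWeight x A * (W0 * (f A - c) ^ 2) := by
          rw [Finset.mul_sum]
          exact Finset.sum_congr rfl fun A _ => by ring
      _ ≤ ∑ A ∈ psSpace G, psWeight x A *
            ∑ F ∈ oddClass G 0, psWeight x F * (f A - f F) ^ 2 :=
          Finset.sum_le_sum fun A _ => mul_le_mul_of_nonneg_left (hjensen A) (hwpos A).le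
      _ = ∑ I ∈ psSpace G, ∑ F ∈ oddClass G 0,
            psWeight x I * psWeight x F * (f I - f F) ^ 2 := by
          simp only [Finset.mul_sum, mul_assoc]
      _ ≤ _ := sum_sum_sq_sub_le hx hV hG f
      _ ≤ _ := by
          have := sum_codeSpace_le (G := G) hx.le h1.le hV
          gcongr
  -- The constants combine as m n² · n⁴/4 · 4Δ/x, with Z_∅ on both sides; one factor n is spent on
  -- the weight n Z_∅ of the even class.
  have hmain2 : n * oddWeight G x ∅ * ∑ A ∈ psSpace G, psWeight x A * f A ^ 2 ≤
      n * oddWeight G x ∅ * (G.edgeFinset.card * G.maxDegree * n ^ 5 / x *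
        dirichlet (psSpace G) (psWeight x) (stepProb G x) f) := by
    rw [← hW0']
    refine hmain.trans ((mul_le_mul_of_nonneg_left (toggleEnergy_le hx h1 hV hG f)
      (by positivity)).trans (le_of_eq ?_))
    rw [hW0']
    ring
  exact le_of_mul_le_mul_left hmain2 (by positivity)

end Poincare

/-! ### Mixing of the PS chain and accuracy of the estimator -/

section Mixing

variable {V : Type*} [Fintype V] [DecidableEq V] {G : SimpleGraph V} [DecidableRel G.Adj]

/-- `psRun` adds steps at the end, whereas hitting probabilities as functions of the initial state
evolve by conditioning on the first step. -/
theorem psRun_succ' (x : ℝ) (A : Finset (Sym2 V)) (t : ℕ) :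
    psRun G x A (t + 1) = (psStep G x A).bind fun B => psRun G x B t := by
  induction t generalizing A with
  | zero => simp [psRun]
  | succ t ih =>
    rw [psRun, ih, PMF.bind_bind]
    rfl

/-- The probability that the PS chain started at `A` is in `S` after `t` steps. -/
def hitProb (G : SimpleGraph V) [DecidableRel G.Adj] (x : ℝ) (S : Finset (Finset (Sym2 V))) (t : ℕ)
    (A : Finset (Sym2 V)) : ℝ :=
  ((psRun G x A t).toOuterMeasure (S : Set (Finset (Sym2 V)))).toReal

theorem hitProb_zero (x : ℝ) (S : Finset (Finset (Sym2 V))) (A : Finset (Sym2 V)) :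
    hitProb G x S 0 A = if A ∈ S then 1 else 0 := by
  rw [hitProb, psRun, PMF.toOuterMeasure_pure_apply]
  split_ifs <;> simp_all

theorem hitProb_succ (x : ℝ) (S : Finset (Finset (Sym2 V))) (t : ℕ) (A : Finset (Sym2 V)) :
    hitProb G x S (t + 1) A = ∑ B, stepProb G x A B * hitProb G x S t B := by
  rw [hitProb, psRun_succ', PMF.toOuterMeasure_bind_apply, tsum_fintype, ENNReal.toReal_sum]
  · exact Finset.sum_congr rfl fun B _ => ENNReal.toReal_mul
  · intro B _
    exact ENNReal.mul_ne_top (PMF.apply_ne_top _ _)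
      (ne_top_of_le_ne_top ENNReal.one_ne_top (toOuterMeasure_le_one _ _))

theorem stepProb_eq_zero {x : ℝ} (hx : 0 < x) (hV : 2 ≤ Fintype.card V)
    (hG : G.Connected) {A B : Finset (Sym2 V)} (hA : A ∈ psSpace G) (hB : B ∉ psSpace G) :
    stepProb G x A B = 0 := by
  by_contra h
  have hBA : B ≠ A := fun h' => hB (h' ▸ hA)
  obtain ⟨u, v, hu, huv, rfl⟩ := exists_toggle_of_stepProb_ne_zero hx hV hG hBA h
  exact hB (toggle_mem_psSpace hA hu huv)

/-- The transfer operator fixes constants, so subtracting `c` from the indicator commutes with the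
iteration. With `c` the stationary probability of `S`, the deviation is an iterate of a function of
mean zero. -/
theorem hitProb_eq_iterate {x : ℝ} (hx : 0 < x) (hV : 2 ≤ Fintype.card V)
    (hG : G.Connected) (S : Finset (Finset (Sym2 V))) (c : ℝ) (t : ℕ) {A : Finset (Sym2 V)}
    (hA : A ∈ psSpace G) :
    hitProb G x S t A =
      (transfer (psSpace G) (stepProb G x))^[t] (fun B => (if B ∈ S then 1 else 0) - c) A + c := by
  induction t generalizing A with
  | zero => simp [hitProb_zero]
  | succ t ih =>
    rw [hitProb_succ, Function.iterate_succ_apply', transfer]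
    rw [← Finset.sum_subset (Finset.subset_univ (psSpace G))
      fun B _ hB => by rw [stepProb_eq_zero hx hV hG hA hB, zero_mul]]
    rw [Finset.sum_congr rfl fun B hB => by rw [ih hB, mul_add], Finset.sum_add_distrib,
      ← Finset.sum_mul, sum_stepProb hx hV hG hA, one_mul]

theorem card_le_card_edgeFinset_add_one (hG : G.Connected) :
    Fintype.card V ≤ G.edgeFinset.card + 1 := by
  have := hG.card_vert_le_card_edgeSet_add_one
  rwa [Nat.card_eq_fintype_card, Nat.card_eq_fintype_card, ← SimpleGraph.edgeFinset_card] at this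

theorem sum_psSpace_le {x : ℝ} (h0 : 0 ≤ x) (h1 : x ≤ 1) (hV : 2 ≤ Fintype.card V) :
    ∑ A ∈ psSpace G, psWeight x A ≤ Fintype.card V * 2 ^ G.edgeFinset.card := by
  calc ∑ A ∈ psSpace G, psWeight x A ≤ ∑ A ∈ psSpace G, (Fintype.card V : ℝ) := by
        refine Finset.sum_le_sum fun A _ => (psWeight_le h0 hV A).trans ?_
        exact mul_le_of_le_one_right (by positivity) (pow_le_one₀ h0 h1)
    _ = (psSpace G).card * (Fintype.card V : ℝ) := by rw [Finset.sum_const, nsmul_eq_mul]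
    _ ≤ 2 ^ G.edgeFinset.card * (Fintype.card V : ℝ) := by
        have : (psSpace G).card ≤ 2 ^ G.edgeFinset.card := by
          rw [← Finset.card_powerset]
          exact Finset.card_le_card fun A hA => Finset.mem_powerset.2 (mem_psSpace.1 hA).1
        gcongr
        exact_mod_cast this
    _ = _ := mul_comm _ _

theorem le_psWeight {x : ℝ} (h0 : 0 ≤ x) (h1 : x ≤ 1) (hV : 2 ≤ Fintype.card V)
    {A : Finset (Sym2 V)} (hA : A ∈ psSpace G) : 2 * x ^ G.edgeFinset.card ≤ psWeight x A := by
  have hn : (2 : ℝ) ≤ Fintype.card V := by exact_mod_cast hV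
  have hp : x ^ G.edgeFinset.card ≤ x ^ A.card :=
    pow_le_pow_of_le_one h0 h1 (Finset.card_le_card (mem_psSpace.1 hA).1)
  have h2 : 0 ≤ x ^ A.card := by positivity
  rw [psWeight]
  split_ifs <;> nlinarith

theorem psProb_mem_Icc {x : ℝ} (hx : 0 < x) (hV : 2 ≤ Fintype.card V)
    {S : Finset (Finset (Sym2 V))} (hS : S ⊆ psSpace G) : psProb G x S ∈ Set.Icc (0 : ℝ) 1 := by
  have hw : ∀ A : Finset (Sym2 V), 0 ≤ psWeight x A := fun A => (psWeight_pos hx (by omega) A).le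
  have hpos := sum_psSpace_pos (G := G) hx (by omega)
  rw [psProb]
  refine ⟨div_nonneg (Finset.sum_nonneg fun A _ => hw A) hpos.le, ?_⟩
  rw [div_le_one hpos]
  exact Finset.sum_le_sum_of_subset_of_nonneg hS fun A _ _ => hw A

/-- One of the two factors m clears the denominator in the bracket, which turns the bracket into the
logarithm of (8/x)^m / δ. -/
theorem mixBound_eq {x : ℝ} (hm : 0 < G.edgeFinset.card) (δ : ℝ) :
    mixBound G x δ = (1 / (2 * x) * (3 + 1 / (G.edgeFinset.card * x)) * G.maxDegree *
      (Fintype.card V : ℝ) ^ 6 * G.edgeFinset.card) *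
        (G.edgeFinset.card * Real.log (8 / x) - Real.log δ) := by
  have : (G.edgeFinset.card : ℝ) ≠ 0 := by exact_mod_cast hm.ne'
  rw [mixBound]
  field_simp

/-- After `mixBound` steps the law of the PS chain is `δ`-close to the PS measure. -/
theorem abs_hitProb_sub_psProb_le {x δ : ℝ} (hx : 0 < x) (h1 : x < 1) (hV : 2 ≤ Fintype.card V)
    (hG : G.Connected) (hδ : 0 < δ) {S : Finset (Finset (Sym2 V))} (hS : S ⊆ psSpace G)
    {A : Finset (Sym2 V)} (hA : A ∈ psSpace G) {t : ℕ} (ht : mixBound G x δ ≤ t) :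
    |hitProb G x S t A - psProb G x S| ≤ δ := by
  have hm := card_edgeFinset_pos hV hG
  rw [mixBound_eq hm] at ht
  have hnm : (Fintype.card V : ℝ) ≤ G.edgeFinset.card + 1 := by
    exact_mod_cast card_le_card_edgeFinset_add_one hG
  have hn : (2 : ℝ) ≤ Fintype.card V := by exact_mod_cast hV
  have hΔ : (0 : ℝ) < G.maxDegree := by
    obtain ⟨v⟩ := hG.nonempty
    exact_mod_cast (degree_pos_of_connected hV hG v).trans_le (G.degree_le_maxDegree v)
  have hrev := isLazyReversible_stepProb hx hV hG
  have hpoin := poincare_psChain hx h1 hV hG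
  have hW := sum_psSpace_le (G := G) hx.le h1.le hV
  have hwA := le_psWeight hx.le h1.le hV hA
  have hm' : (0 : ℝ) < G.edgeFinset.card := by exact_mod_cast hm
  have hc := psProb_mem_Icc hx hV hS
  set c := psProb G x S with hcdef
  rw [hitProb_eq_iterate hx hV hG S c t hA, add_sub_cancel_right]
  set f : Finset (Sym2 V) → ℝ := fun B => (if B ∈ S then 1 else 0) - c with hf
  have hmean : ∑ B ∈ psSpace G, psWeight x B * f B = 0 := by
    have hpos := sum_psSpace_pos (G := G) hx (by omega)
    simp only [hf, mul_sub, Finset.sum_sub_distrib, mul_ite, mul_one, mul_zero]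
    rw [← Finset.sum_filter, Finset.filter_mem_eq_inter, Finset.inter_eq_right.2 hS,
      ← Finset.sum_mul, hcdef, psProb, mul_div_cancel₀ _ hpos.ne', sub_self]
  set m := G.edgeFinset.card with hmdef
  set n : ℝ := ((Fintype.card V : ℕ) : ℝ) with hndef
  set κ : ℝ := m * G.maxDegree * n ^ 5 / x with hκ
  have hκpos : 0 < κ := by positivity
  set K : ℝ := 1 / (2 * x) * (3 + 1 / (m * x)) * G.maxDegree * n ^ 6 * m with hK
  -- The prefactor of R(δ) exceeds twice the Poincaré constant because 4n⁵ ≤ 3n⁶. The factor 2 is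
  -- needed since the decay is that of a square.
  have hκK : 2 * κ ≤ K := by
    have e1 : 2 * κ = 1 / (2 * x) * 4 * G.maxDegree * n ^ 5 * m := by
      rw [hκ]
      field_simp
      ring
    have e2 : 1 / (2 * x) * 3 * G.maxDegree * n ^ 6 * m ≤ K := by
      rw [hK]
      gcongr
      have : 0 ≤ 1 / (m * x) := by positivity
      linarith
    refine le_trans ?_ e2
    rw [e1]
    have e3 : 4 * n ^ 5 ≤ 3 * n ^ 6 := by
      have : 0 ≤ n ^ 5 := by positivity
      nlinarith
    calc 1 / (2 * x) * 4 * G.maxDegree * n ^ 5 * m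
        = 1 / (2 * x) * G.maxDegree * m * (4 * n ^ 5) := by ring
      _ ≤ 1 / (2 * x) * G.maxDegree * m * (3 * n ^ 6) := by gcongr
      _ = _ := by ring
  have hKpos : 0 < K := lt_of_lt_of_le (by positivity) hκK
  have hdecay := hrev.sum_iterate_sq_le hκpos hpoin hmean t
  set u : ℝ := (transfer (psSpace G) (stepProb G x))^[t] f A with hu
  -- The second moment bounds the deviation at the single state `A`, at the cost of its weight,
  -- which is at least 2 x^m.
  have hsingle : psWeight x A * u ^ 2 ≤ ∑ B ∈ psSpace G,
      psWeight x B * ((transfer (psSpace G) (stepProb G x))^[t] f B) ^ 2 :=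
    Finset.single_le_sum (f := fun B => psWeight x B *
      ((transfer (psSpace G) (stepProb G x))^[t] f B) ^ 2)
      (fun B _ => mul_nonneg (psWeight_pos hx (by omega) B).le (sq_nonneg _)) hA
  have hf1 : ∑ B ∈ psSpace G, psWeight x B * f B ^ 2 ≤ n * 2 ^ m := by
    refine le_trans (Finset.sum_le_sum fun B _ => ?_) hW
    refine mul_le_of_le_one_right (psWeight_pos hx (by omega) B).le ?_
    simp only [hf]
    obtain ⟨hc0, hc1⟩ := hc
    split_ifs <;> nlinarith
  -- From t/κ ≥ 2t/K ≥ 2(m log(8/x) - log δ).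
  have hexp : Real.exp (-(t / κ)) ≤ ((x / 8) ^ m * δ) ^ 2 := by
    have i1 : m * Real.log (8 / x) - Real.log δ ≤ t / K := by
      rw [le_div_iff₀ hKpos]
      linarith
    have i2 : 2 * (t / K) ≤ t / κ := by
      rw [← mul_div_assoc, div_le_div_iff₀ hKpos hκpos]
      have : (0 : ℝ) ≤ t := by positivity
      nlinarith
    have i3 : Real.log (((x / 8) ^ m * δ) ^ 2) =
        -(2 * (m * Real.log (8 / x) - Real.log δ)) := by
      rw [Real.log_pow, Real.log_mul (by positivity) hδ.ne', Real.log_pow, ← inv_div x 8,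
        Real.log_inv]
      push_cast
      ring
    rw [← Real.exp_log (show 0 < ((x / 8) ^ m * δ) ^ 2 by positivity), i3, Real.exp_le_exp]
    linarith
  have hfin : 2 * x ^ m * u ^ 2 ≤ 2 * x ^ m * δ ^ 2 := by
    calc 2 * x ^ m * u ^ 2 ≤ psWeight x A * u ^ 2 := by gcongr
      _ ≤ _ := hsingle
      _ ≤ _ := hdecay
      _ ≤ ((x / 8) ^ m * δ) ^ 2 * (n * 2 ^ m) :=
          mul_le_mul hexp hf1 (Finset.sum_nonneg fun B _ =>
            mul_nonneg (psWeight_pos hx (by omega) B).le (sq_nonneg _)) (by positivity)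
      -- The factor 64^(-m) absorbs the 2^m that bounds the number of states, and what remains
      -- absorbs n ≤ m + 1 ≤ 2^m.
      _ = x ^ m * δ ^ 2 * (x ^ m * (n * (1 / 32) ^ m)) := by
          have e : (1 / 32 : ℝ) ^ m = 2 ^ m * ((1 / 8) ^ m) ^ 2 := by
            rw [← pow_mul, mul_comm m 2, pow_mul, ← mul_pow]
            norm_num
          rw [e, div_eq_mul_one_div x, mul_pow]
          ring
      _ ≤ x ^ m * δ ^ 2 * (1 * 2) := by
          have j1 : x ^ m ≤ 1 := pow_le_one₀ hx.le h1.le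
          have j2 : n * (1 / 32) ^ m ≤ 2 := by
            have j3 : (m : ℝ) + 1 ≤ 2 ^ m := by exact_mod_cast Nat.lt_two_pow_self
            have j4 : (2 : ℝ) ^ m * (1 / 32) ^ m ≤ 1 := by
              rw [← mul_pow]
              exact pow_le_one₀ (by norm_num) (by norm_num)
            calc n * (1 / 32) ^ m ≤ 2 ^ m * (1 / 32) ^ m := by
                  gcongr
                  exact hnm.trans j3
              _ ≤ 1 := j4
              _ ≤ 2 := one_le_two
          gcongr
      _ = 2 * x ^ m * δ ^ 2 := by ring
  have := le_of_mul_le_mul_left hfin (by positivity)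
  exact abs_le_of_sq_le_sq this hδ.le

end Mixing

/-! ### Accuracy of the median of means -/

section Accuracy

variable {V : Type*} [Fintype V] [DecidableEq V] {G : SimpleGraph V} [DecidableRel G.Adj]

theorem oddClass_zero_subset_psSpace : oddClass G 0 ⊆ psSpace G := Finset.subset_union_left

theorem evenEstimator_accurate {β ε η : ℝ} (h : Admissible G β ε η) {A₀ : Finset (Sym2 V)}
    (hA : A₀ ∈ psSpace G) :
    ENNReal.ofReal (1 - η) ≤ (evenEstimator G β ε η A₀).toOuterMeasure
      (Set.Icc ((1 - ε) * evenProb G β) ((1 + ε) * evenProb G β)) := by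
  obtain ⟨hV, hG, hβ, hε, hε', hη, -⟩ := h
  have hx := tanh_pos_of_pos hβ
  have hx1 := tanh_lt_one' β
  have hn : (2 : ℝ) ≤ Fintype.card V := by exact_mod_cast hV
  have hp1 : 1 / (Fintype.card V : ℝ) ≤ evenProb G β := one_div_card_le_evenProb (by omega) hβ
  have hppos := evenProb_pos (G := G) (by omega) hβ
  rw [evenEstimator, estimator]
  refine le_toOuterMeasure_median ?_ hη
  set s : ℝ := 2 * (Fintype.card V : ℝ) + 1 with hs
  set p := evenProb G β with hp
  have hspos : 0 < s := by positivity
  have hsp : 1 ≤ s * p := by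
    have : 1 ≤ Fintype.card V * p := by
      rwa [div_le_iff₀ (by linarith), mul_comm] at hp1
    nlinarith
  set N := 20 * ⌈s * (ε ^ 2)⁻¹ + 1⌉₊ with hN
  have hNge : 20 * (s * (ε ^ 2)⁻¹) ≤ (N : ℝ) := by
    have := Nat.le_ceil (s * (ε ^ 2)⁻¹ + 1)
    rw [hN]
    push_cast
    linarith
  have hNpos : 0 < N := by
    have : (0 : ℝ) < N := lt_of_lt_of_le (by positivity) hNge
    exact_mod_cast this
  set δ : ℝ := ε / (16 * s) with hδ
  have hδpos : 0 < δ := by positivity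
  set q := hitProb G (Real.tanh β) (oddClass G 0) ⌈mixBound G (Real.tanh β) δ⌉₊ A₀ with hq
  have hqp : |q - p| ≤ δ := abs_hitProb_sub_psProb_le hx hx1 hV hG hδpos
    oddClass_zero_subset_psSpace hA (Nat.le_ceil _)
  have hbern : IsBernoulli (oneSample G (Real.tanh β) (oddClass G 0) s ε A₀) q :=
    isBernoulli_map_indicator _ _
  have hq0 : 0 ≤ q := ENNReal.toReal_nonneg
  have hq1 : q ≤ 1 := ENNReal.toReal_le_of_le_ofReal zero_le_one
    (by
      rw [ENNReal.ofReal_one]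
      exact toOuterMeasure_le_one _ _)
  -- Since s p ≥ 1, the absolute accuracy ε/(16 s) of the chain is a relative accuracy ε/16; the
  -- remaining 15/16 of the tolerance are left to the random fluctuation.
  have hδp : δ ≤ ε * p / 16 := by
    rw [hδ, div_le_div_iff₀ (by positivity) (by norm_num)]
    nlinarith
  obtain ⟨hl, hr⟩ := abs_le.1 hqp
  set t : ℝ := 15 / 16 * (ε * p) with ht
  have htpos : 0 < t := by positivity
  refine le_trans (toOuterMeasure_mono_support (T := {y | t < |y - q|}) fun y _ hy => ?_)
    ((toOuterMeasure_mean_le hbern hq0 hq1 hNpos htpos).trans ?_)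
  · by_contra hcon
    apply hy
    rw [Set.mem_ofPred_eq, not_lt, abs_le] at hcon
    constructor <;> linarith [hcon.1, hcon.2]
  · have e16 : (16⁻¹ : ℝ≥0∞) = ENNReal.ofReal (16⁻¹) := by
      rw [ENNReal.ofReal_inv_of_pos (by norm_num)]
      norm_num
    rw [e16]
    refine ENNReal.ofReal_le_ofReal ?_
    -- The variance is at most q ≤ (1 + ε/16) p ≤ 65/64 · p, and 16 · 65/64 = 16.25 is less than 20
    -- · 225/256 ≈ 17.6, so Chebyshev's bound is below 1/16.
    have hNt : 20 * (225 / 256) * p ≤ N * t ^ 2 := by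
      calc 20 * (225 / 256) * p ≤ 20 * (225 / 256) * p * (s * p) :=
            le_mul_of_one_le_right (by positivity) hsp
        _ = 20 * (s * (ε ^ 2)⁻¹) * t ^ 2 := by
            rw [ht]
            field_simp
            ring
        _ ≤ N * t ^ 2 := by gcongr
    have hNtpos : 0 < N * t ^ 2 := lt_of_lt_of_le (by positivity) hNt
    rw [div_le_iff₀ hNtpos]
    have i1 : q * (1 - q) ≤ q := by nlinarith
    have i2 : q ≤ 65 / 64 * p := by nlinarith
    linarith

theorem Admissible.half {β ε η : ℝ} (h : Admissible G β ε η) : Admissible G β (ε / 2) η :=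
  ⟨h.two_le_card, h.connected, h.beta_pos, half_pos h.eps_pos, by linarith [h.eps_lt, h.eps_pos],
    h.eta_pos, h.eta_lt⟩

/-- Inverting an approximation with relative error ε/2 costs at most a factor 2 in the error: (1 -
ε)(1 + ε/2) ≤ 1 ≤ (1 + ε)(1 - ε/2). -/
theorem evenEstimator_accurate_susceptibility {β ε η : ℝ} (h : Admissible G β ε η)
    {A₀ : Finset (Sym2 V)} (hA : A₀ ∈ psSpace G) :
    ENNReal.ofReal (1 - η) ≤ (evenEstimator G β (ε / 2) η A₀).toOuterMeasure
      {y | (1 - ε) * susceptibility G β ≤ β / y ∧ β / y ≤ (1 + ε) * susceptibility G β} := by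
  refine (evenEstimator_accurate h.half hA).trans (toOuterMeasure_mono_support fun y _ hy => ?_)
  have hβ := h.beta_pos
  have hε := h.eps_pos
  have hε' := h.eps_lt
  have hp := evenProb_pos (G := G) (by linarith [h.two_le_card]) hβ
  obtain ⟨h1, h2⟩ := hy
  have hy0 : 0 < y := lt_of_lt_of_le (mul_pos (by linarith) hp) h1
  rw [susceptibility_eq hβ, Set.mem_ofPred_eq]
  set p := evenProb G β
  constructor
  · rw [← mul_div_assoc, div_le_div_iff₀ hp hy0]
    have : (1 - ε) * y ≤ p := by nlinarith
    nlinarith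
  · rw [← mul_div_assoc, div_le_div_iff₀ hy0 hp]
    have : p ≤ (1 + ε) * y := by nlinarith [mul_pos hε hp]
    nlinarith

end Accuracy

/-! ### A program logic: frames -/

/-- Does the program write to the integer variable `j`? -/
def Program.writesIdx (j : ℕ) : Program → Bool
  | .skip => false
  | .assignIdx i _ => i == j
  | .assign _ _ => false
  | .store _ _ _ _ => false
  | .seq c d => c.writesIdx j || d.writesIdx j
  | .ifLt _ _ c d => c.writesIdx j || d.writesIdx j
  | .loop _ c => c.writesIdx j
  | .uniform i _ => i == j
  | .flip i _ => i == j

/-- Does the program write to the real variable `y`? -/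
def Program.writesVar (y : ℕ) : Program → Bool
  | .skip => false
  | .assignIdx _ _ => false
  | .assign x _ => x == y
  | .store _ _ _ _ => false
  | .seq c d => c.writesVar y || d.writesVar y
  | .ifLt _ _ c d => c.writesVar y || d.writesVar y
  | .loop _ c => c.writesVar y
  | .uniform _ _ => false
  | .flip _ _ => false

/-- Does the program write to the array `b`? -/
def Program.writesArr (b : ℕ) : Program → Bool
  | .skip => false
  | .assignIdx _ _ => false
  | .assign _ _ => false
  | .store a _ _ _ => a == b
  | .seq c d => c.writesArr b || d.writesArr b
  | .ifLt _ _ c d => c.writesArr b || d.writesArr b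
  | .loop _ c => c.writesArr b
  | .uniform _ _ => false
  | .flip _ _ => false

/-- The stores `s` and `s'` agree on everything that `c` does not write to. -/
structure Program.Frame (c : Program) (s s' : Store) : Prop where
  idx : ∀ {i : ℕ}, c.writesIdx i = false → s'.idx i = s.idx i
  var : ∀ {x : ℕ}, c.writesVar x = false → s'.var x = s.var x
  arr : ∀ {a : ℕ}, c.writesArr a = false → s'.arr a = s.arr a

theorem Program.Frame.refl (c : Program) (s : Store) : c.Frame s s :=
  ⟨fun _ => rfl, fun _ => rfl, fun _ => rfl⟩

theorem Program.Frame.trans {c : Program} {s s' s'' : Store} (h : c.Frame s s')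
    (h' : c.Frame s' s'') : c.Frame s s'' :=
  ⟨fun hi => (h'.idx hi).trans (h.idx hi), fun hi => (h'.var hi).trans (h.var hi),
    fun hi => (h'.arr hi).trans (h.arr hi)⟩

theorem Program.Frame.mono {c d : Program} {s s' : Store} (h : c.Frame s s')
    (hi : ∀ i, d.writesIdx i = false → c.writesIdx i = false)
    (hv : ∀ x, d.writesVar x = false → c.writesVar x = false)
    (ha : ∀ a, d.writesArr a = false → c.writesArr a = false) : d.Frame s s' :=
  ⟨fun hd => h.idx (hi _ hd), fun hd => h.var (hv _ hd), fun hd => h.arr (ha _ hd)⟩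

theorem mem_support_charge {k : ℕ} {p : PMF (Store × ℕ)} {r : Store × ℕ}
    (h : r ∈ (charge k p).support) : ∃ t, (r.1, t) ∈ p.support ∧ r.2 = k + t := by
  rw [charge, PMF.mem_support_map_iff] at h
  obtain ⟨q, hq, rfl⟩ := h
  exact ⟨q.2, hq, rfl⟩

theorem frame_iterRun {c : Program} (hc : ∀ s, ∀ r ∈ (c.run s).support, c.Frame s r.1) (k : ℕ) :
    ∀ s, ∀ r ∈ (iterRun c.run k s).support, c.Frame s r.1 := by
  induction k with
  | zero =>
    intro s r hr
    rw [iterRun, PMF.mem_support_pure_iff] at hr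
    subst hr
    exact Program.Frame.refl c s
  | succ k ih =>
    intro s r hr
    rw [iterRun, PMF.mem_support_bind_iff] at hr
    obtain ⟨q, hq, hr⟩ := hr
    obtain ⟨t, ht, -⟩ := mem_support_charge hr
    exact (hc s q hq).trans (ih q.1 (r.1, t) ht)

theorem Program.frame_run (c : Program) :
    ∀ s, ∀ r ∈ (c.run s).support, c.Frame s r.1 := by
  induction c with
  | skip =>
    intro s r hr
    rw [Program.run, PMF.mem_support_pure_iff] at hr
    subst hr
    exact Program.Frame.refl _ s
  | assignIdx i e =>
    intro s r hr
    rw [Program.run, PMF.mem_support_pure_iff] at hr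
    subst hr
    refine ⟨fun {j} hj => ?_, fun _ => rfl, fun _ => rfl⟩
    have hj' : j ≠ i := by
      rintro rfl
      simp [Program.writesIdx] at hj
    simp [Store.setIdx, hj']
  | assign x e =>
    intro s r hr
    rw [Program.run, PMF.mem_support_pure_iff] at hr
    subst hr
    refine ⟨fun _ => rfl, fun {j} hj => ?_, fun _ => rfl⟩
    have hj' : j ≠ x := by
      rintro rfl
      simp [Program.writesVar] at hj
    simp [Store.setVar, hj']
  | store a i j e =>
    intro s r hr
    rw [Program.run, PMF.mem_support_pure_iff] at hr
    subst hr
    refine ⟨fun _ => rfl, fun _ => rfl, fun {b} hb => ?_⟩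
    have hb' : b ≠ a := by
      rintro rfl
      simp [Program.writesArr] at hb
    funext k l
    simp [Store.setArr, hb']
  | seq c d hc hd =>
    intro s r hr
    rw [Program.run, PMF.mem_support_bind_iff] at hr
    obtain ⟨q, hq, hr⟩ := hr
    obtain ⟨t, ht, -⟩ := mem_support_charge hr
    refine ((hc s q hq).mono ?_ ?_ ?_).trans ((hd q.1 _ ht).mono ?_ ?_ ?_) <;>
      intro i hi <;> simp_all [Program.writesIdx, Program.writesVar, Program.writesArr]
  | ifLt e f c d hc hd =>
    intro s r hr
    rw [Program.run] at hr
    obtain ⟨t, ht, -⟩ := mem_support_charge hr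
    split_ifs at ht
    · refine (hc s _ ht).mono ?_ ?_ ?_ <;>
        intro i hi <;> simp_all [Program.writesIdx, Program.writesVar, Program.writesArr]
    · refine (hd s _ ht).mono ?_ ?_ ?_ <;>
        intro i hi <;> simp_all [Program.writesIdx, Program.writesVar, Program.writesArr]
  | loop e c hc =>
    intro s r hr
    rw [Program.run] at hr
    obtain ⟨t, ht, -⟩ := mem_support_charge hr
    exact (frame_iterRun hc _ s _ ht).mono (fun i hi => hi) (fun i hi => hi) (fun i hi => hi)
  | uniform i e =>
    intro s r hr
    have key : ∃ k, r.1 = s ∨ r.1 = s.setIdx i k := by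
      rw [Program.run] at hr
      beta_reduce at hr
      rw [drawFrom] at hr
      split_ifs at hr with h
      · rw [PMF.mem_support_bind_iff] at hr
        obtain ⟨k, -, hr⟩ := hr
        rw [PMF.mem_support_pure_iff] at hr
        exact ⟨k, Or.inr (by rw [hr])⟩
      · rw [PMF.mem_support_pure_iff] at hr
        exact ⟨0, Or.inl (by rw [hr])⟩
    obtain ⟨k, hk | hk⟩ := key
    · rw [hk]
      exact Program.Frame.refl _ s
    · rw [hk]
      refine ⟨fun {j} hj => ?_, fun _ => rfl, fun _ => rfl⟩
      have hj' : j ≠ i := by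
        rintro rfl
        simp [Program.writesIdx] at hj
      simp [Store.setIdx, hj']
  | flip i e =>
    intro s r hr
    rw [Program.run, PMF.mem_support_map_iff] at hr
    obtain ⟨b, -, rfl⟩ := hr
    refine ⟨fun {j} hj => ?_, fun _ => rfl, fun _ => rfl⟩
    have hj' : j ≠ i := by
      rintro rfl
      simp [Program.writesIdx] at hj
    simp [Store.setIdx, hj']

/-! ### A program logic: postconditions that hold for every outcome -/

/-- Every execution of `c` from `s` ends in `Q` and takes at most `T` steps. -/
def Safe (c : Program) (s : Store) (Q : Store → Prop) (T : ℕ) : Prop :=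
  ∀ r ∈ (c.run s).support, Q r.1 ∧ r.2 ≤ T

namespace Safe

variable {c d : Program} {s : Store} {Q Q' : Store → Prop} {T T' : ℕ}

/-- The consequence step may use the frame, so a postcondition need only mention what the program
changes. -/
theorem mono (h : Safe c s Q T) (hT : T ≤ T') (hQ : ∀ s', c.Frame s s' → Q s' → Q' s') :
    Safe c s Q' T' := fun r hr =>
  ⟨hQ _ (c.frame_run s r hr) (h r hr).1, (h r hr).2.trans hT⟩

theorem mono_time (h : Safe c s Q T) (hT : T ≤ T') : Safe c s Q T' :=
  h.mono hT fun _ _ h => h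

theorem skip (h : Q s) : Safe .skip s Q 1 := by
  intro r hr
  rw [Program.run, PMF.mem_support_pure_iff] at hr
  subst hr
  exact ⟨h, le_rfl⟩

theorem assignIdx {i : ℕ} {e : IExpr} (h : Q (s.setIdx i (e.eval s))) :
    Safe (.assignIdx i e) s Q (1 + e.cost) := by
  intro r hr
  rw [Program.run, PMF.mem_support_pure_iff] at hr
  subst hr
  exact ⟨h, le_rfl⟩

theorem assign {x : ℕ} {e : Expr} (h : Q (s.setVar x (e.eval s))) :
    Safe (.assign x e) s Q (1 + e.cost) := by
  intro r hr
  rw [Program.run, PMF.mem_support_pure_iff] at hr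
  subst hr
  exact ⟨h, le_rfl⟩

theorem store {a : ℕ} {i j : IExpr} {e : Expr}
    (h : Q (s.setArr a (i.eval s) (j.eval s) (e.eval s))) :
    Safe (.store a i j e) s Q (1 + i.cost + j.cost + e.cost) := by
  intro r hr
  rw [Program.run, PMF.mem_support_pure_iff] at hr
  subst hr
  exact ⟨h, le_rfl⟩

theorem seq (h : Safe c s Q T) (h' : ∀ s', c.Frame s s' → Q s' → Safe d s' Q' T') :
    Safe (.seq c d) s Q' (T + T') := by
  intro r hr
  rw [Program.run, PMF.mem_support_bind_iff] at hr
  obtain ⟨q, hq, hr⟩ := hr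
  obtain ⟨t, ht, hrt⟩ := mem_support_charge hr
  have h1 := h q hq
  have h2 := h' q.1 (c.frame_run s q hq) h1.1 _ ht
  exact ⟨h2.1, by have := h1.2; have := h2.2; simp only at this; omega⟩

theorem ifLt {e f : Expr} (h : e.eval s < f.eval s → Safe c s Q T)
    (h' : ¬e.eval s < f.eval s → Safe d s Q T') :
    Safe (.ifLt e f c d) s Q (1 + e.cost + f.cost + max T T') := by
  intro r hr
  rw [Program.run] at hr
  obtain ⟨t, ht, hrt⟩ := mem_support_charge hr
  split_ifs at ht with hlt
  · have := h hlt _ ht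
    exact ⟨this.1, by have := this.2; simp only at this; omega⟩
  · have := h' hlt _ ht
    exact ⟨this.1, by have := this.2; simp only at this; omega⟩

theorem iterRun {R : ℕ → Store → Prop} (k : ℕ) {s₀ : Store} (hs : c.Frame s₀ s) {j : ℕ}
    (h : ∀ i s', i < j + k → c.Frame s₀ s' → R i s' → Safe c s' (R (i + 1)) T) (h0 : R j s) :
    ∀ r ∈ (iterRun c.run k s).support, R (j + k) r.1 ∧ r.2 ≤ k * (T + 1) := by
  induction k generalizing s j with
  | zero =>
    intro r hr
    rw [Worm.iterRun, PMF.mem_support_pure_iff] at hr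
    subst hr
    exact ⟨h0, by simp⟩
  | succ k ih =>
    intro r hr
    rw [Worm.iterRun, PMF.mem_support_bind_iff] at hr
    obtain ⟨q, hq, hr⟩ := hr
    obtain ⟨t, ht, hrt⟩ := mem_support_charge hr
    have h1 := h j s (by omega) hs h0 q hq
    have h2 := ih (j := j + 1) (hs.trans (c.frame_run s q hq))
      (fun i s' hi => h i s' (by omega)) h1.1 _ ht
    refine ⟨by rw [show j + (k + 1) = j + 1 + k by omega]; exact h2.1, ?_⟩
    have h3 := h1.2
    have h4 := h2.2
    simp only at h4
    rw [hrt, add_mul, one_mul]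
    omega

theorem loop {e : Expr} {R : ℕ → Store → Prop} {k : ℕ} (hk : ⌈e.eval s⌉₊ = k) (h0 : R 0 s)
    (h : ∀ i s', i < k → c.Frame s s' → R i s' → Safe c s' (R (i + 1)) T) :
    Safe (.loop e c) s (R k) (1 + e.cost + k * (T + 1)) := by
  intro r hr
  rw [Program.run] at hr
  beta_reduce at hr
  rw [hk] at hr
  obtain ⟨t, ht, hrt⟩ := mem_support_charge hr
  have := Safe.iterRun (R := R) k (Program.Frame.refl c s) (j := 0)
    (fun i s' hi => h i s' (by omega)) h0 _ ht
  rw [zero_add] at this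
  exact ⟨this.1, by have := this.2; simp only at this; omega⟩

end Safe

/-- Run `c` with the integer variable `w` counting from `0` up to the value of the integer
variable `b`, exclusively. -/
def forEach (w b : ℕ) (c : Program) : Program :=
  .seq (.assignIdx w (.lit 0))
    (.loop (.int (.idx b)) (.seq c (.assignIdx w (.add (.idx w) (.lit 1)))))

theorem Store.setIdx_idx (s : Store) (i k j : ℕ) :
    (s.setIdx i k).idx j = if j = i then k else s.idx j := rfl

theorem Store.setIdx_var (s : Store) (i k : ℕ) : (s.setIdx i k).var = s.var := rfl

theorem Store.setIdx_arr (s : Store) (i k : ℕ) : (s.setIdx i k).arr = s.arr := rfl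

theorem Store.setVar_var (s : Store) (x y : ℕ) (r : ℝ) :
    (s.setVar x r).var y = if y = x then r else s.var y := rfl

theorem Store.setArr_idx (s : Store) (a i j : ℕ) (r : ℝ) : (s.setArr a i j r).idx = s.idx := rfl

theorem Store.setArr_arr (s : Store) (a i j b k l : ℕ) (r : ℝ) :
    (s.setArr a i j r).arr b k l = if b = a ∧ k = i ∧ l = j then r else s.arr b k l := rfl

/-- The invariant is required after the counter has been advanced, hence the `setIdx` in the
hypothesis on the body. Frames are relative to the whole loop, so the body may rely on everything
that no iteration changes. -/
theorem Safe.forEach {c : Program} {w b : ℕ} {s : Store} {T : ℕ} {R : ℕ → Store → Prop}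
    (hwb : w ≠ b) (hw : c.writesIdx w = false)
    (h0 : R 0 (s.setIdx w 0))
    (h : ∀ i s', i < s.idx b → s'.idx w = i → (Worm.forEach w b c).Frame s s' → R i s' →
      Safe c s' (fun s'' => R (i + 1) (s''.setIdx w (i + 1))) T) :
    Safe (Worm.forEach w b c) s (R (s.idx b)) (5 + s.idx b * (T + 5)) := by
  have hloop : ∀ s', Program.Frame (.assignIdx w (.lit 0)) s s' → s' = s.setIdx w 0 →
      Safe (.loop (.int (.idx b)) (.seq c (.assignIdx w (.add (.idx w) (.lit 1))))) s'
        (R (s.idx b)) (3 + s.idx b * (T + 5)) := by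
    rintro s' hF rfl
    have hk : ⌈(Expr.int (.idx b)).eval (s.setIdx w 0)⌉₊ = s.idx b := by
      simp [Expr.eval, IExpr.eval, Store.setIdx_idx, hwb.symm]
    refine ((Safe.loop (R := fun i s' => s'.idx w = i ∧ R i s') (T := T + 4) hk
      ⟨by simp [Store.setIdx_idx], h0⟩ ?_).mono
      (by simp [Expr.cost, IExpr.cost, add_assoc]) fun s' _ h => h.2)
    rintro i s' hi hF' ⟨hwi, hR⟩
    have hF'' : (Worm.forEach w b c).Frame s s' := by
      refine (hF.mono ?_ ?_ ?_).trans (hF'.mono ?_ ?_ ?_) <;> intro j hj <;>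
        simp_all [Worm.forEach, Program.writesIdx, Program.writesVar, Program.writesArr]
    refine ((h i s' hi hwi hF'' hR).seq fun s'' hF3 hR' => Safe.assignIdx ?_).mono_time
      (by simp [IExpr.cost])
    have : s''.idx w = i := (hF3.idx hw).trans hwi
    simp only [IExpr.eval, this]
    exact ⟨by simp [Store.setIdx_idx], hR'⟩
  refine (Safe.seq (Safe.assignIdx (Q := fun s' => s' = s.setIdx w 0) rfl) hloop).mono_time ?_
  simp only [IExpr.cost]
  omega

/-! ### A program logic: laws of outcomes -/

/-- The outcome `p` of a program can be coupled with the law `μ` so that `R` holds, and the running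
time is at most `T`. -/
def Impl {α : Type*} (p : PMF (Store × ℕ)) (μ : PMF α) (R : α → Store → Prop) (T : ℕ) : Prop :=
  ∃ κ : PMF (α × (Store × ℕ)), κ.map Prod.fst = μ ∧ κ.map Prod.snd = p ∧
    ∀ z ∈ κ.support, R z.1 z.2.1 ∧ z.2.2 ≤ T

theorem pmf_bind_congr {α γ : Type*} {μ : PMF α} {f g : α → PMF γ}
    (h : ∀ a ∈ μ.support, f a = g a) : μ.bind f = μ.bind g := by
  ext b
  rw [PMF.bind_apply, PMF.bind_apply]
  refine tsum_congr fun a => ?_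
  by_cases ha : μ a = 0
  · rw [ha, zero_mul, zero_mul]
  · rw [h a ((PMF.mem_support_iff _ _).2 ha)]

theorem pmf_map_congr {α γ : Type*} {μ : PMF α} {f g : α → γ}
    (h : ∀ a ∈ μ.support, f a = g a) : μ.map f = μ.map g :=
  pmf_bind_congr fun a ha => by simp [h a ha]

namespace Impl

variable {α γ : Type*} {p : PMF (Store × ℕ)} {μ : PMF α} {R R' : α → Store → Prop} {T T' : ℕ}
  {c d : Program} {s : Store}

theorem mono (h : Impl p μ R T) (hT : T ≤ T') (hR : ∀ a s, R a s → R' a s) : Impl p μ R' T' := by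
  obtain ⟨κ, h1, h2, h3⟩ := h
  exact ⟨κ, h1, h2, fun z hz => ⟨hR _ _ (h3 z hz).1, (h3 z hz).2.trans hT⟩⟩

theorem mono_time (h : Impl p μ R T) (hT : T ≤ T') : Impl p μ R T' := h.mono hT fun _ _ h => h

theorem map {f : α → γ} {R : γ → Store → Prop} (h : Impl p μ (fun a s => R (f a) s) T) :
    Impl p (μ.map f) R T := by
  obtain ⟨κ, rfl, rfl, h3⟩ := h
  refine ⟨κ.map fun z => (f z.1, z.2), ?_, ?_, ?_⟩
  · rw [PMF.map_comp, PMF.map_comp]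
    rfl
  · rw [PMF.map_comp]
    rfl
  · intro z hz
    rw [PMF.mem_support_map_iff] at hz
    obtain ⟨y, hy, rfl⟩ := hz
    exact h3 y hy

theorem of_safe {a : α} (h : Safe c s (R a) T) : Impl (c.run s) (PMF.pure a) R T := by
  refine ⟨(c.run s).map fun r => (a, r), ?_, ?_, ?_⟩
  · rw [PMF.map_comp]
    exact PMF.map_const _ _
  · rw [PMF.map_comp]
    exact PMF.map_id _
  · intro z hz
    rw [PMF.mem_support_map_iff] at hz
    obtain ⟨r, hr, rfl⟩ := hz
    exact h r hr

theorem charge (h : Impl p μ R T) (k : ℕ) : Impl (charge k p) μ R (k + T) := by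
  obtain ⟨κ, rfl, rfl, h3⟩ := h
  refine ⟨κ.map fun z => (z.1, (z.2.1, k + z.2.2)), ?_, ?_, ?_⟩
  · rw [PMF.map_comp]
    rfl
  · rw [Worm.charge, PMF.map_comp, PMF.map_comp]
    rfl
  · intro z hz
    rw [PMF.mem_support_map_iff] at hz
    obtain ⟨y, hy, rfl⟩ := hz
    exact ⟨(h3 y hy).1, by simpa using (h3 y hy).2⟩

/-- Couplings are glued: draw a coupled pair for the first program, then a coupling of the second
stage given that pair. -/
theorem bind {q : Store → PMF (Store × ℕ)} {ν : α → PMF γ} {R' : γ → Store → Prop}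
    (h : Impl p μ R T) (h' : ∀ a s, R a s → Impl (q s) (ν a) R' T') :
    Impl (p.bind fun r => Worm.charge r.2 (q r.1)) (μ.bind ν) R' (T + T') := by
  classical
  obtain ⟨κ, rfl, rfl, h3⟩ := h
  have hch : ∀ z : α × (Store × ℕ), ∃ K : PMF (γ × (Store × ℕ)), K.map Prod.fst = ν z.1 ∧
      (R z.1 z.2.1 → K.map Prod.snd = Worm.charge z.2.2 (q z.2.1) ∧
        ∀ y ∈ K.support, R' y.1 y.2.1 ∧ y.2.2 ≤ z.2.2 + T') := by
    intro z
    by_cases hz : R z.1 z.2.1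
    · obtain ⟨K, h1, h2, h3⟩ := (h' z.1 z.2.1 hz).charge z.2.2
      exact ⟨K, h1, fun _ => ⟨h2, h3⟩⟩
    -- Pairs that violate `R` have mass zero under the coupling, but the kernel must be defined on
    -- them; any choice with the right first marginal will do.
    · refine ⟨(ν z.1).map fun b => (b, z.2), ?_, fun h => absurd h hz⟩
      rw [PMF.map_comp]
      exact PMF.map_id _
  choose K hK1 hK2 using hch
  refine ⟨κ.bind K, ?_, ?_, ?_⟩
  · rw [PMF.map_bind, PMF.bind_map]
    congr 1
    funext z
    exact hK1 z
  · rw [PMF.map_bind, PMF.bind_map]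
    exact pmf_bind_congr fun z hz => (hK2 z (h3 z hz).1).1
  · intro y hy
    rw [PMF.mem_support_bind_iff] at hy
    obtain ⟨z, hz, hy⟩ := hy
    have h4 := (hK2 z (h3 z hz).1).2 y hy
    exact ⟨h4.1, h4.2.trans (Nat.add_le_add_right (h3 z hz).2 _)⟩

theorem frame (h : Impl (c.run s) μ R T) :
    Impl (c.run s) μ (fun a s' => c.Frame s s' ∧ R a s') T := by
  obtain ⟨κ, h1, h2, h3⟩ := h
  refine ⟨κ, h1, h2, fun z hz => ⟨⟨?_, (h3 z hz).1⟩, (h3 z hz).2⟩⟩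
  refine c.frame_run s z.2 ?_
  rw [← h2, PMF.mem_support_map_iff]
  exact ⟨z, hz, rfl⟩

theorem seq {ν : α → PMF γ} {R' : γ → Store → Prop} (h : Impl (c.run s) μ R T)
    (h' : ∀ a s', c.Frame s s' → R a s' → Impl (d.run s') (ν a) R' T') :
    Impl ((Program.seq c d).run s) (μ.bind ν) R' (T + T') :=
  h.frame.bind fun a s' hs => h' a s' hs.1 hs.2

theorem safe_seq {Q : Store → Prop} (h : Safe c s Q T)
    (h' : ∀ s', c.Frame s s' → Q s' → Impl (d.run s') μ R T') :
    Impl ((Program.seq c d).run s) μ R (T + T') := by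
  have := (of_safe (R := fun _ => Q) (a := ()) h).seq (d := d) (ν := fun _ => μ) (R' := R)
    fun _ s' hF hQ => h' s' hF hQ
  rwa [PMF.pure_bind] at this

theorem ifLt {e f : Expr} (h : e.eval s < f.eval s → Impl (c.run s) μ R T)
    (h' : ¬e.eval s < f.eval s → Impl (d.run s) μ R T') :
    Impl ((Program.ifLt e f c d).run s) μ R (1 + e.cost + f.cost + max T T') := by
  rw [Program.run]
  beta_reduce
  split_ifs with hlt
  · exact ((h hlt).mono_time (le_max_left _ _)).charge _
  · exact ((h' hlt).mono_time (le_max_right _ _)).charge _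

theorem uniform {i : ℕ} {e : IExpr} {R : ℕ → Store → Prop}
    (hne : (Finset.range (e.eval s)).Nonempty)
    (h : ∀ k < e.eval s, R k (s.setIdx i k)) :
    Impl ((Program.uniform i e).run s) (PMF.uniformOfFinset (Finset.range (e.eval s)) hne) R
      (1 + e.cost) := by
  refine ⟨(PMF.uniformOfFinset (Finset.range (e.eval s)) hne).map
    fun k => (k, (s.setIdx i k, 1 + e.cost)), ?_, ?_, ?_⟩
  · rw [PMF.map_comp]
    exact PMF.map_id _
  · rw [PMF.map_comp, Program.run]
    beta_reduce
    rw [drawFrom, dif_pos hne]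
    rfl
  · intro z hz
    rw [PMF.mem_support_map_iff] at hz
    obtain ⟨k, hk, rfl⟩ := hz
    rw [PMF.mem_support_uniformOfFinset_iff, Finset.mem_range] at hk
    exact ⟨h k hk, le_rfl⟩

theorem flip {i : ℕ} {e : Expr} {R : Bool → Store → Prop}
    (h : ∀ b : Bool, R b (s.setIdx i (if b then 1 else 0))) :
    Impl ((Program.flip i e).run s) (coin (e.eval s)) R (1 + e.cost) := by
  refine ⟨(coin (e.eval s)).map
    fun b => (b, (s.setIdx i (if b then 1 else 0), 1 + e.cost)), ?_, ?_, ?_⟩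
  · rw [PMF.map_comp]
    exact PMF.map_id _
  · rw [PMF.map_comp, Program.run]
    rfl
  · intro z hz
    rw [PMF.mem_support_map_iff] at hz
    obtain ⟨k, hk, rfl⟩ := hz
    exact ⟨h k, le_rfl⟩

/-- The law of a Markov chain after a number of steps. -/
def iterLaw (ν : α → PMF α) : ℕ → α → PMF α
  | 0, a => PMF.pure a
  | k + 1, a => (ν a).bind (iterLaw ν k)

theorem iterRun {ν : α → PMF α} (k : ℕ) {s₀ : Store} (hs : c.Frame s₀ s) {a : α}
    (h : ∀ a s', c.Frame s₀ s' → R a s' → Impl (c.run s') (ν a) R T) (h0 : R a s) :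
    Impl (iterRun c.run k s) (iterLaw ν k a) R (k * (T + 1)) := by
  induction k generalizing s a with
  | zero =>
    refine ⟨PMF.pure (a, (s, 0)), ?_, ?_, ?_⟩
    · rw [PMF.pure_map]
      rfl
    · rw [PMF.pure_map]
      rfl
    · intro z hz
      rw [PMF.mem_support_pure_iff] at hz
      subst hz
      exact ⟨h0, by simp⟩
  | succ k ih =>
    have h1 := (h a s hs h0).frame.bind (q := fun s' => Worm.charge 1 (Worm.iterRun c.run k s'))
      (ν := iterLaw ν k) (R' := R) (T' := 1 + k * (T + 1))
      fun b s' hb => (ih (hs.trans hb.1) hb.2).charge 1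
    refine (?_ : Impl _ _ R (T + (1 + k * (T + 1)))).mono_time (by rw [add_mul]; omega)
    rw [iterLaw]
    convert h1 using 1
    rw [Worm.iterRun]
    congr 1
    funext r
    rw [Worm.charge, Worm.charge, Worm.charge, PMF.map_comp]
    congr 1
    funext q
    simp only [Function.comp_apply, Prod.mk.injEq, true_and]
    omega

theorem loop {e : Expr} {ν : α → PMF α} {k : ℕ} {a : α} (hk : ⌈e.eval s⌉₊ = k) (h0 : R a s)
    (h : ∀ a s', c.Frame s s' → R a s' → Impl (c.run s') (ν a) R T) :
    Impl ((Program.loop e c).run s) (iterLaw ν k a) R (1 + e.cost + k * (T + 1)) := by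
  rw [Program.run]
  beta_reduce
  rw [hk]
  exact (iterRun k (Program.Frame.refl c s) h h0).charge _

theorem output_eq {f : α → ℝ} (h : Impl (c.run s) μ R T) (hf : ∀ a s, R a s → s.var 0 = f a) :
    c.output s = μ.map f := by
  obtain ⟨κ, rfl, h2, h3⟩ := h
  rw [Program.output, ← h2, PMF.map_comp, PMF.map_comp]
  exact pmf_map_congr fun z hz => hf _ _ (h3 z hz).1

theorem time_le (h : Impl (c.run s) μ R T) {r : Store × ℕ} (hr : r ∈ (c.run s).support) :
    r.2 ≤ T := by
  obtain ⟨κ, -, h2, h3⟩ := h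
  rw [← h2, PMF.mem_support_map_iff] at hr
  obtain ⟨z, hz, rfl⟩ := hr
  exact (h3 z hz).2

end Impl

/-! ### Uniform distributions and iterated laws -/

/-- Programs draw only initial segments of the integers. A bijection turns such a draw into a
uniform vertex, odd vertex or neighbour. -/
theorem map_uniformOfFinset {α γ : Type*} [DecidableEq γ] {S : Finset α} {S' : Finset γ}
    (hS : S.Nonempty) (hS' : S'.Nonempty) {f : α → γ} (hf : Set.BijOn f S S') :
    (PMF.uniformOfFinset S hS).map f = PMF.uniformOfFinset S' hS' := by
  classical
  have hcard : S'.card = S.card := by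
    rw [← Finset.card_image_of_injOn hf.injOn]
    congr 1
    ext b
    rw [Finset.mem_image]
    constructor
    · intro hb
      obtain ⟨a, ha, rfl⟩ := hf.surjOn hb
      exact ⟨a, ha, rfl⟩
    · rintro ⟨a, ha, rfl⟩
      exact hf.mapsTo ha
  ext b
  rw [PMF.map_apply]
  by_cases hb : b ∈ S'
  · obtain ⟨a, ha, rfl⟩ := hf.surjOn hb
    rw [tsum_eq_single a, if_pos rfl, PMF.uniformOfFinset_apply_of_mem hS ha,
      PMF.uniformOfFinset_apply_of_mem hS' hb, hcard]
    intro a' ha'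
    split_ifs with h
    · refine PMF.uniformOfFinset_apply_of_notMem hS fun ha'' => ha' ?_
      exact (hf.injOn ha ha'' h).symm
    · rfl
  · rw [PMF.uniformOfFinset_apply_of_notMem hS' hb, ENNReal.tsum_eq_zero]
    intro a
    split_ifs with h
    · refine PMF.uniformOfFinset_apply_of_notMem hS fun ha => hb ?_
      rw [h]
      exact hf.mapsTo ha
    · rfl

/-- A loop that records one fresh sample per iteration is a Markov chain on lists; this identifies
its law with that of independent samples, in the order of recording. -/
theorem iterLaw_snoc {α : Type*} (μ : PMF α) (k : ℕ) (l : List α) :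
    Impl.iterLaw (fun l => μ.map fun a => l ++ [a]) k l = (iid μ k).map fun l' => l ++ l' := by
  induction k generalizing l with
  | zero => simp [Impl.iterLaw, iid, PMF.pure_map]
  | succ k ih =>
    rw [Impl.iterLaw, iid, PMF.bind_map, PMF.map_bind]
    congr 1
    funext a
    rw [Function.comp_apply, ih, PMF.map_comp]
    congr 1
    funext l'
    simp

theorem iterLaw_psStep {V : Type*} [Fintype V] [DecidableEq V] (G : SimpleGraph V)
    [DecidableRel G.Adj] (x : ℝ) (k : ℕ) (A : Finset (Sym2 V)) :
    Impl.iterLaw (psStep G x) k A = psRun G x A k := by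
  induction k generalizing A with
  | zero => rfl
  | succ k ih =>
    rw [Impl.iterLaw, psRun_succ']
    congr 1
    funext B
    exact ih B

/-! ### Adjacency arrays -/

section Adjacency

variable {n : ℕ} (G : SimpleGraph (Fin n)) [DecidableRel G.Adj]

/-- The adjacency matrix of `G`, indexed by natural numbers. -/
def adjArr (i j : ℕ) : ℝ :=
  if h : i < n ∧ j < n then if G.Adj ⟨i, h.1⟩ ⟨j, h.2⟩ then 1 else 0 else 0

theorem input_arr_zero (β ε η : ℝ) : (input G β ε η).arr 0 = adjArr G := by
  funext i j
  simp [input, adjArr]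

variable {G}

theorem adjArr_pos_iff (u : Fin n) (w : ℕ) : 0 < adjArr G u w ↔ ∃ h : w < n, G.Adj u ⟨w, h⟩ := by
  rw [adjArr]
  by_cases h : w < n
  · by_cases h' : G.Adj u ⟨w, h⟩ <;> simp [h, h']
  · simp [h]

theorem count_adjArr (u : Fin n) : Nat.count (fun w => 0 < adjArr G u w) n = G.degree u := by
  rw [Nat.count_eq_card_filter_range, ← G.card_neighborFinset_eq_degree]
  refine Finset.card_bij' (fun w _ => if h : w < n then ⟨w, h⟩ else u) (fun v _ => (v : ℕ))
    ?_ ?_ ?_ ?_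
  · intro w hw
    simp only [Finset.mem_filter, Finset.mem_range, adjArr_pos_iff] at hw
    obtain ⟨hw, hw', h⟩ := hw
    simpa [hw] using h
  · intro v hv
    simpa [adjArr_pos_iff] using hv
  · intro w hw
    simp only [Finset.mem_filter, Finset.mem_range] at hw
    simp [hw.1]
  · intro v _
    simp

variable (G) in
/-- The `k`th neighbour of `u`. -/
def nthNeighbor (u : Fin n) (k : ℕ) : Fin n :=
  if h : Nat.nth (fun w => 0 < adjArr G u w) k < n then ⟨_, h⟩ else u

theorem nthNeighbor_val {u : Fin n} {k : ℕ} (hk : k < G.degree u) :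
    (nthNeighbor G u k : ℕ) = Nat.nth (fun w => 0 < adjArr G u w) k := by
  rw [← count_adjArr] at hk
  rw [nthNeighbor, dif_pos (Nat.nth_lt_of_lt_count hk)]

/-- A neighbour is numbered by how many neighbours precede it, so `Nat.count` inverts `Nat.nth`. -/
theorem bijOn_nthNeighbor (u : Fin n) :
    Set.BijOn (nthNeighbor G u) (Finset.range (G.degree u)) (G.neighborFinset u) := by
  have hfin : ∀ {k : ℕ}, k < G.degree u →
      ∀ hf : (Set.ofPred fun w => 0 < adjArr G u w).Finite, k < hf.toFinset.card := by
    intro k hk hf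
    rw [← count_adjArr] at hk
    exact hk.trans_le (Nat.count_le_card hf n)
  refine ⟨?_, ?_, ?_⟩
  · intro k hk
    rw [Finset.mem_coe, Finset.mem_range] at hk
    have h1 := Nat.nth_mem k (hfin hk)
    rw [adjArr_pos_iff] at h1
    obtain ⟨h, h1⟩ := h1
    have h2 : nthNeighbor G u k = ⟨_, h⟩ := Fin.ext (nthNeighbor_val hk)
    rw [h2]
    simpa using h1
  · intro k hk l hl h
    rw [Finset.mem_coe, Finset.mem_range] at hk hl
    have h1 := congrArg Fin.val h
    rw [nthNeighbor_val hk, nthNeighbor_val hl] at h1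
    rw [← Nat.count_nth (hfin hk), h1, Nat.count_nth (hfin hl)]
  · intro v hv
    have hv' : 0 < adjArr G u v := (adjArr_pos_iff u v).2 ⟨v.2, by simpa using hv⟩
    have hlt : Nat.count (fun w => 0 < adjArr G u w) v < G.degree u := by
      rw [← count_adjArr]
      exact Nat.count_strict_mono hv' v.2
    refine ⟨Nat.count (fun w => 0 < adjArr G u w) v, by simpa using hlt, ?_⟩
    refine Fin.ext ?_
    rw [nthNeighbor_val hlt]
    exact Nat.nth_count (p := fun w => 0 < adjArr G u w) hv'

end Adjacency

/-! ### Subroutines -/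

/-- Run `c` if the two integers are equal, and `d` otherwise. -/
def ifEq (e f : IExpr) (c d : Program) : Program :=
  .ifLt (.int e) (.int f) d (.ifLt (.int f) (.int e) d c)

theorem Safe.ifEq {e f : IExpr} {c d : Program} {s : Store} {Q : Store → Prop} {T T' : ℕ}
    (h : e.eval s = f.eval s → Safe c s Q T) (h' : e.eval s ≠ f.eval s → Safe d s Q T') :
    Safe (Worm.ifEq e f c d) s Q (6 + 2 * (e.cost + f.cost) + max T T') := by
  refine (Safe.ifLt (fun hlt => h' ?_) fun hge => Safe.ifLt (fun hlt => h' ?_) fun hge' =>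
    h ?_).mono_time ?_
  · simp only [Expr.eval, Nat.cast_lt] at hlt
    omega
  · simp only [Expr.eval, Nat.cast_lt] at hlt
    omega
  · simp only [Expr.eval, Nat.cast_lt] at hge hge'
    omega
  · simp only [Expr.cost]
    omega

theorem Impl.ifEq {α : Type*} {μ : PMF α} {R : α → Store → Prop} {e f : IExpr} {c d : Program}
    {s : Store} {T T' : ℕ} (h : e.eval s = f.eval s → Impl (c.run s) μ R T)
    (h' : e.eval s ≠ f.eval s → Impl (d.run s) μ R T') :
    Impl ((Worm.ifEq e f c d).run s) μ R (6 + 2 * (e.cost + f.cost) + max T T') := by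
  refine (Impl.ifLt (fun hlt => h' ?_) fun hge => Impl.ifLt (fun hlt => h' ?_) fun hge' =>
    h ?_).mono_time ?_
  · simp only [Expr.eval, Nat.cast_lt] at hlt
    omega
  · simp only [Expr.eval, Nat.cast_lt] at hlt
    omega
  · simp only [Expr.eval, Nat.cast_lt] at hge hge'
    omega
  · simp only [Expr.cost]
    omega

/-- Write the degree of the vertex in the integer variable `v` to the integer variable `o`. -/
def degProg (v o : ℕ) : Program :=
  .seq (.assignIdx o (.lit 0))
    (forEach 3 0 (.ifLt (.int (.lit 0)) (.get 0 (.idx v) (.idx 3))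
      (.assignIdx o (.add (.idx o) (.lit 1))) .skip))

theorem safe_degProg {v o : ℕ} (ho0 : o ≠ 0) (ho3 : o ≠ 3) (hv3 : v ≠ 3) (hvo : v ≠ o)
    (s : Store) : Safe (degProg v o) s
      (fun s' => s'.idx o = Nat.count (fun w => 0 < s.arr 0 (s.idx v) w) (s.idx 0))
      (7 + s.idx 0 * 15) := by
  refine (Safe.seq (Safe.assignIdx (Q := fun s' => s' = s.setIdx o 0) rfl)
    (Q' := fun s' => s'.idx o = Nat.count (fun w => 0 < s.arr 0 (s.idx v) w) (s.idx 0))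
    (T' := 5 + s.idx 0 * 15) ?_).mono_time (by simp [IExpr.cost]; omega)
  rintro s' - rfl
  have h0 : (s.setIdx o 0).idx 0 = s.idx 0 := by simp [Store.setIdx_idx, ho0.symm]
  rw [← h0]
  refine Safe.forEach (T := 10)
    (R := fun i s' => s'.idx o = Nat.count (fun w => 0 < s.arr 0 (s.idx v) w) i) (by norm_num)
    (by simp [Program.writesIdx, ho3]) (by simp [Store.setIdx_idx, ho3]) ?_
  intro i s' _ hi hF hR
  have hv : s'.idx v = s.idx v := by
    rw [hF.idx (by simp [Worm.forEach, Program.writesIdx, hv3.symm, hvo.symm])]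
    simp [Store.setIdx_idx, hvo]
  have ha : s'.arr 0 = s.arr 0 := hF.arr rfl
  have hev : ((Expr.int (.lit 0)).eval s' < (Expr.get 0 (.idx v) (.idx 3)).eval s') ↔
      0 < s.arr 0 (s.idx v) i := by
    simp [Expr.eval, IExpr.eval, hv, ha, hi]
  refine (Safe.ifLt (fun h => Safe.assignIdx ?_) fun h => Safe.skip ?_).mono_time
    (by simp [Expr.cost, IExpr.cost])
  · rw [hev] at h
    simp [Store.setIdx_idx, ho3, IExpr.eval, hR, Nat.count_succ, h]
  · rw [hev] at h
    simp [Store.setIdx_idx, ho3, hR, Nat.count_succ, h]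

/-- Find the neighbour of the vertex in the integer variable `1` with the number in the integer
variable `6`. -/
def findProg : Program :=
  .seq (.assignIdx 8 (.lit 0))
    (forEach 3 0 (.ifLt (.int (.lit 0)) (.get 0 (.idx 1) (.idx 3))
      (.seq (.ifLt (.int (.idx 6)) (.int (.idx 8)) .skip (.assignIdx 5 (.idx 3)))
        (.assignIdx 8 (.add (.idx 8) (.lit 1)))) .skip))

/-- Each neighbour overwrites the candidate as long as no more neighbours precede it than the target
number. The last overwriting therefore occurs at exactly that number, counted from 0, which makes
the invariant conditional on the neighbour having been reached. -/
theorem safe_findProg {s : Store} {p : ℕ → Prop} [DecidablePred p]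
    (hp : ∀ w, 0 < s.arr 0 (s.idx 1) w ↔ p w) : Safe findProg s
      (fun s' => s.idx 6 < Nat.count p (s.idx 0) → s'.idx 5 = Nat.nth p (s.idx 6))
      (7 + s.idx 0 * 22) := by
  refine (Safe.seq (Safe.assignIdx (Q := fun s' => s' = s.setIdx 8 0) rfl)
    (Q' := fun s' => s.idx 6 < Nat.count p (s.idx 0) → s'.idx 5 = Nat.nth p (s.idx 6))
    (T' := 5 + s.idx 0 * 22) ?_).mono_time (by simp [IExpr.cost]; omega)
  rintro s' - rfl
  have h0 : (s.setIdx 8 0).idx 0 = s.idx 0 := rfl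
  rw [← h0]
  refine (Safe.forEach (T := 17) (R := fun i s' => s'.idx 8 = Nat.count p i ∧
    (s.idx 6 < Nat.count p i → s'.idx 5 = Nat.nth p (s.idx 6))) (by norm_num)
    (by rfl) (by simp [Store.setIdx_idx]) ?_).mono le_rfl fun s' _ h => h.2
  rintro i s' - hi hF ⟨h8, h5⟩
  have h1 : s'.idx 1 = s.idx 1 := hF.idx rfl
  have h6 : s'.idx 6 = s.idx 6 := hF.idx rfl
  have ha : s'.arr 0 = s.arr 0 := hF.arr rfl
  have hev : ((Expr.int (.lit 0)).eval s' < (Expr.get 0 (.idx 1) (.idx 3)).eval s') ↔ p i := by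
    simp [Expr.eval, IExpr.eval, h1, ha, hi, hp]
  refine (Safe.ifLt (fun h => Safe.seq (Safe.ifLt (Q := fun s'' => s''.idx 8 = Nat.count p i ∧
      (s.idx 6 < Nat.count p i + 1 → s''.idx 5 = Nat.nth p (s.idx 6)))
      (fun hlt => Safe.skip ?_) fun hge => Safe.assignIdx ?_)
      fun s'' _ h'' => Safe.assignIdx ?_) fun h => Safe.skip ?_).mono_time
    (by simp [Expr.cost, IExpr.cost])
  · simp only [Expr.eval, IExpr.eval, Nat.cast_lt, h6, h8] at hlt
    exact ⟨h8, fun _ => h5 hlt⟩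
  · rw [hev] at h
    simp only [Expr.eval, IExpr.eval, Nat.cast_lt, h6, h8, not_lt] at hge
    refine ⟨by simpa [Store.setIdx_idx] using h8, fun hlt => ?_⟩
    have he : s.idx 6 = Nat.count p i := by omega
    simp [Store.setIdx_idx, IExpr.eval, hi, he, Nat.nth_count h]
  · rw [hev] at h
    simpa [Store.setIdx_idx, IExpr.eval, Nat.count_succ, h] using h''
  · rw [hev] at h
    simpa [Store.setIdx_idx, Nat.count_succ, h] using ⟨h8, h5⟩

/-! ### One step of the PS chain -/

/-- Choose the start of the move, and write it to the integer variable `1`. -/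
def chooseProg : Program :=
  ifEq (.idx 1) (.idx 2)
    (.seq (.uniform 1 (.idx 0)) (.assignIdx 2 (.idx 1)))
    (.seq (.uniform 6 (.lit 2)) (.ifLt (.int (.idx 6)) (.int (.lit 1)) .skip
      (.seq (.assignIdx 4 (.idx 1)) (.seq (.assignIdx 1 (.idx 2)) (.assignIdx 2 (.idx 4))))))

/-- Choose the end of the move, and write it to the integer variable `5`. -/
def neighborProg : Program :=
  .seq (degProg 1 4) (.seq (.uniform 6 (.idx 4)) findProg)

/-- Compute twice the acceptance probability in the real variable `6`. -/
def ratioProg : Program :=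
  .seq (degProg 5 8)
    (.seq (.ifLt (.int (.lit 0)) (.get 1 (.idx 1) (.idx 5))
        (.assign 6 (.div (.int (.lit 1)) (.var 3))) (.assign 6 (.var 3)))
      (.seq (ifEq (.idx 1) (.idx 2) .skip (ifEq (.idx 5) (.idx 2) .skip
          (.assign 6 (.mul (.div (.int (.idx 4)) (.int (.idx 8))) (.var 6)))))
        (.ifLt (.int (.lit 1)) (.var 6) (.assign 6 (.int (.lit 1))) .skip)))

/-- Switch the edge between the vertices in the integer variables `1` and `5`. -/
def toggleProg : Program :=
  .seq (.store 1 (.idx 1) (.idx 5) (.sub (.int (.lit 1)) (.get 1 (.idx 1) (.idx 5))))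
    (.seq (.store 1 (.idx 5) (.idx 1) (.get 1 (.idx 1) (.idx 5))) (.assignIdx 1 (.idx 5)))

/-- One step of the PS chain. -/
def stepProg : Program :=
  .seq chooseProg (.seq neighborProg (.seq ratioProg
    (.seq (.flip 7 (.div (.var 6) (.int (.lit 2))))
      (.ifLt (.int (.lit 0)) (.int (.idx 7)) toggleProg .skip))))

section Step

variable {n : ℕ} (G : SimpleGraph (Fin n)) [DecidableRel G.Adj]

/-- The data that are constant throughout the simulation of the chain. -/
structure Env (x : ℝ) (s : Store) : Prop where
  idx0 : s.idx 0 = n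
  arr0 : s.arr 0 = adjArr G
  var3 : s.var 3 = x

/-- The array `1` holds `A`, and the integer variables `1` and `2` hold the vertices `a` and `b`,
which are the odd vertices of `A` or coincide. -/
structure Holds (A : Finset (Sym2 (Fin n))) (a b : Fin n) (s : Store) : Prop where
  subset : A ⊆ G.edgeFinset
  arr1 : ∀ i j : Fin n, s.arr 1 i j = if s(i, j) ∈ A then 1 else 0
  idx1 : s.idx 1 = a
  idx2 : s.idx 2 = b
  odd : oddSet A = symmDiff {a} {b}

variable {G}

theorem Env.of_frame {x : ℝ} {s s' : Store} {c : Program} (h : Env G x s) (hF : c.Frame s s')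
    (h0 : c.writesIdx 0 = false := by rfl) (h1 : c.writesArr 0 = false := by rfl)
    (h2 : c.writesVar 3 = false := by rfl) : Env G x s' :=
  ⟨(hF.idx h0).trans h.idx0, (hF.arr h1).trans h.arr0, (hF.var h2).trans h.var3⟩

theorem Holds.mem_psSpace {A : Finset (Sym2 (Fin n))} {a b : Fin n} {s : Store}
    (h : Holds G A a b s) : A ∈ psSpace G := by
  refine mem_psSpace_iff_le.2 ⟨h.subset, ?_⟩
  rw [h.odd]
  by_cases hab : a = b
  · simp [hab]
  · rw [card_symmDiff_singleton hab]

/-- An even set is represented by any pair a = b, so a uniform vertex can be written to both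
variables without changing the state. If a ≠ b, a fair bit decides whether they are exchanged. In
both cases the start ends up in the first variable and the representation stays valid. -/
theorem impl_chooseProg {x : ℝ} {A : Finset (Sym2 (Fin n))} {a b : Fin n} {s : Store}
    (hE : Env G x s) (h : Holds G A a b s) :
    Impl (chooseProg.run s) (PMF.uniformOfFinset (startSet A)
      (startSet_nonempty (by simpa using a.pos) A))
      (fun u s' => u ∈ startSet A ∧ ∃ b, Holds G A u b s') 30 := by
  have hst : startSet A = if a = b then Finset.univ else {a, b} := by
    rw [startSet, h.odd]
    simp only [symmDiff_pair_eq_empty]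
    split_ifs with hab
    · rfl
    · exact symmDiff_singleton_pair hab
  refine (Impl.ifEq (T := 4) (T' := 16) (fun heq => ?_) fun hne => ?_).mono_time
    (by simp [IExpr.cost])
  · simp only [IExpr.eval, h.idx1, h.idx2] at heq
    have hab : a = b := Fin.ext heq
    have hev : (IExpr.idx 0).eval s = n := hE.idx0
    have hr : (Finset.range ((IExpr.idx 0).eval s)).Nonempty := by
      rw [hev]
      exact ⟨0, Finset.mem_range.2 a.pos⟩
    have hu := Impl.uniform (s := s) (i := 1) (R := fun k s' => k < n ∧ s' = s.setIdx 1 k) hr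
      fun k hk => ⟨by rwa [hev] at hk, rfl⟩
    have hseq := (hu.seq (d := .assignIdx 2 (.idx 1)) (ν := PMF.pure)
      (R' := fun k s' => ∃ hk : k < n, Holds G A ⟨k, hk⟩ ⟨k, hk⟩ s') (T' := 2) ?_)
    · rw [PMF.bind_pure] at hseq
      have hm : (PMF.uniformOfFinset (Finset.range ((IExpr.idx 0).eval s)) hr).map
          (fun k => if hk : k < n then (⟨k, hk⟩ : Fin n) else a) =
          PMF.uniformOfFinset (startSet A) (startSet_nonempty (by simpa using a.pos) A) := by
        refine map_uniformOfFinset _ _ ⟨?_, ?_, ?_⟩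
        · intro k _
          simp [hst, hab]
        · intro k hk l hl hkl
          rw [Finset.mem_coe, Finset.mem_range, hev] at hk hl
          simpa [hk, hl] using hkl
        · intro v _
          refine ⟨v, by simp [hev], by simp⟩
      rw [← hm]
      refine Impl.map (hseq.mono (by simp [IExpr.cost]) ?_)
      rintro k s' ⟨hk, hs'⟩
      simp only [hk, dif_pos]
      exact ⟨by simp [hst, hab], _, hs'⟩
    · rintro k s' - ⟨hk, rfl⟩
      refine Impl.of_safe (Safe.assignIdx ⟨hk, ?_⟩)
      refine ⟨h.subset, h.arr1, rfl, rfl, ?_⟩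
      rw [h.odd, hab]
      simp
  · simp only [IExpr.eval, h.idx1, h.idx2] at hne
    have hab : a ≠ b := fun hab => hne (congrArg Fin.val hab)
    have hr : (Finset.range ((IExpr.lit 2).eval s)).Nonempty := ⟨0, by simp [IExpr.eval]⟩
    have hu := Impl.uniform (s := s) (i := 6) (R := fun k s' => k < 2 ∧ s' = s.setIdx 6 k) hr
      fun k hk => ⟨hk, rfl⟩
    have hseq := (hu.seq (d := .ifLt (.int (.idx 6)) (.int (.lit 1)) .skip
      (.seq (.assignIdx 4 (.idx 1)) (.seq (.assignIdx 1 (.idx 2)) (.assignIdx 2 (.idx 4)))))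
      (ν := PMF.pure)
      (R' := fun k s' => if k = 0 then Holds G A a b s' else Holds G A b a s') (T' := 14) ?_)
    · rw [PMF.bind_pure] at hseq
      have hm : (PMF.uniformOfFinset (Finset.range ((IExpr.lit 2).eval s)) hr).map
          (fun k => if k = 0 then a else b) =
          PMF.uniformOfFinset (startSet A) (startSet_nonempty (by simpa using a.pos) A) := by
        refine map_uniformOfFinset _ _ ⟨?_, ?_, ?_⟩
        · intro k _
          simp only [hst, hab, if_false]
          split_ifs <;> simp
        · intro k hk l hl hkl
          simp only [IExpr.eval, Finset.coe_range, Set.mem_Iio] at hk hl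
          have := hab.symm
          interval_cases k <;> interval_cases l <;> simp_all
        · intro v hv
          simp only [hst, hab, if_false, Finset.coe_insert, Finset.coe_singleton,
            Set.mem_insert_iff, Set.mem_singleton_iff] at hv
          rcases hv with rfl | rfl
          · exact ⟨0, by simp [IExpr.eval], by simp⟩
          · exact ⟨1, by simp [IExpr.eval], by simp⟩
      rw [← hm]
      refine Impl.map (hseq.mono (by simp [IExpr.cost]) ?_)
      intro k s' hs'
      by_cases hk : k = 0
      · simp only [hk, if_true] at hs' ⊢
        exact ⟨by simp [hst, hab], _, hs'⟩
      · simp only [hk, if_false] at hs' ⊢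
        exact ⟨by simp [hst, hab], _, hs'⟩
    · rintro k s' - ⟨hk, rfl⟩
      refine Impl.of_safe ((Safe.ifLt (fun hlt => Safe.skip ?_) fun hge =>
        Safe.seq (Safe.assignIdx (Q := fun s' => s' = (s.setIdx 6 k).setIdx 4 a) ?_)
          fun s' _ hs' => Safe.seq (Safe.assignIdx (Q := fun s'' =>
            s'' = ((s.setIdx 6 k).setIdx 4 a).setIdx 1 b) ?_) fun s'' _ hs'' =>
              Safe.assignIdx ?_).mono_time
        (by simp [Expr.cost, IExpr.cost]))
      · have : k = 0 := by simpa [Expr.eval, IExpr.eval, Store.setIdx_idx] using hlt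
        rw [if_pos this]
        exact ⟨h.subset, h.arr1, h.idx1, h.idx2, h.odd⟩
      · simp [IExpr.eval, Store.setIdx_idx, h.idx1]
      · subst hs'
        simp [IExpr.eval, Store.setIdx_idx, h.idx2]
      · subst hs''
        have : k ≠ 0 := by
          rintro rfl
          simp [Expr.eval, IExpr.eval, Store.setIdx_idx] at hge
        rw [if_neg this]
        refine ⟨h.subset, h.arr1, rfl, rfl, ?_⟩
        rw [h.odd, symmDiff_comm]

theorem Holds.of_frame {A : Finset (Sym2 (Fin n))} {a b : Fin n} {s s' : Store} {c : Program}
    (h : Holds G A a b s) (hF : c.Frame s s') (h1 : c.writesArr 1 = false := by rfl)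
    (h2 : c.writesIdx 1 = false := by rfl) (h3 : c.writesIdx 2 = false := by rfl) :
    Holds G A a b s' :=
  ⟨h.subset, by rw [hF.arr h1]; exact h.arr1, (hF.idx h2).trans h.idx1,
    (hF.idx h3).trans h.idx2, h.odd⟩

theorem impl_neighborProg {x : ℝ} {A : Finset (Sym2 (Fin n))} {u b : Fin n} {s : Store}
    (hE : Env G x s) (h : Holds G A u b s) (hne : (G.neighborFinset u).Nonempty) :
    Impl (neighborProg.run s) (PMF.uniformOfFinset (G.neighborFinset u) hne)
      (fun v s' => G.Adj u v ∧ s'.idx 5 = v ∧ s'.idx 4 = G.degree u) (16 + n * 37) := by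
  have hd : 0 < G.degree u := by
    rw [← G.card_neighborFinset_eq_degree]
    exact Finset.card_pos.2 hne
  have hdeg := safe_degProg (v := 1) (o := 4) (by norm_num) (by norm_num) (by norm_num)
    (by norm_num) s
  simp only [hE.idx0, hE.arr0, h.idx1, count_adjArr] at hdeg
  refine (Impl.safe_seq hdeg (T' := 9 + n * 22) fun s1 hF1 h4 => ?_).mono_time (by omega)
  have hE1 := hE.of_frame hF1
  have hH1 := h.of_frame hF1
  have hev : (IExpr.idx 4).eval s1 = G.degree u := h4
  have hr : (Finset.range ((IExpr.idx 4).eval s1)).Nonempty := by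
    rw [hev]
    exact ⟨0, Finset.mem_range.2 hd⟩
  have hu := Impl.uniform (s := s1) (i := 6)
    (R := fun k s' => k < G.degree u ∧ s' = s1.setIdx 6 k) hr
    fun k hk => ⟨by rwa [hev] at hk, rfl⟩
  have hseq := hu.seq (d := findProg) (ν := PMF.pure)
    (R' := fun k s' => k < G.degree u ∧ s'.idx 5 = nthNeighbor G u k ∧ s'.idx 4 = G.degree u)
    (T' := 7 + n * 22) ?_
  · rw [PMF.bind_pure] at hseq
    have hm : (PMF.uniformOfFinset (Finset.range ((IExpr.idx 4).eval s1)) hr).map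
        (nthNeighbor G u) = PMF.uniformOfFinset (G.neighborFinset u) hne := by
      refine map_uniformOfFinset _ _ ?_
      rw [hev]
      exact bijOn_nthNeighbor u
    rw [← hm]
    refine Impl.map (hseq.mono (by simp [IExpr.cost]; omega) ?_)
    rintro k s' ⟨hk, h5, h4'⟩
    have := (bijOn_nthNeighbor (G := G) u).mapsTo (Finset.mem_coe.2 (Finset.mem_range.2 hk))
    exact ⟨by simpa using this, h5, h4'⟩
  · rintro k s' - ⟨hk, rfl⟩
    have hp : ∀ w, 0 < (s1.setIdx 6 k).arr 0 ((s1.setIdx 6 k).idx 1) w ↔ 0 < adjArr G u w := by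
      intro w
      rw [show (s1.setIdx 6 k).idx 1 = u from hH1.idx1,
        show (s1.setIdx 6 k).arr 0 = adjArr G from hE1.arr0]
    refine Impl.of_safe (((safe_findProg hp).mono ?_) ?_)
    · rw [show (s1.setIdx 6 k).idx 0 = n from hE1.idx0]
    · intro s' hF' h5
      have e6 : (s1.setIdx 6 k).idx 6 = k := rfl
      have e0 : (s1.setIdx 6 k).idx 0 = n := hE1.idx0
      simp only [e6, e0, count_adjArr] at h5
      refine ⟨hk, ?_, (hF'.idx rfl).trans h4⟩
      rw [h5 hk, nthNeighbor_val hk]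

theorem safe_ratioProg {x : ℝ} {A : Finset (Sym2 (Fin n))} {u b v : Fin n} {s : Store}
    (hE : Env G x s) (h : Holds G A u b s) (hu : u ∈ startSet A) (huv : G.Adj u v)
    (h5 : s.idx 5 = v) (h4 : s.idx 4 = G.degree u) :
    Safe ratioProg s (fun s' => s'.var 6 = 2 * acceptance G x A u v) (56 + n * 15) := by
  have hdeg := safe_degProg (v := 5) (o := 8) (by norm_num) (by norm_num) (by norm_num)
    (by norm_num) s
  simp only [hE.idx0, hE.arr0, h5, count_adjArr] at hdeg
  have hA := h.mem_psSpace
  have hB := toggle_mem_psSpace hA hu huv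
  -- The case distinction becomes one between integers: u = b means that `A` is even, v = b that the
  -- switched set is even, and only otherwise do the degrees enter.
  have hacc : 2 * acceptance G x A u v = min 1 (if u = b then ratio x A s(u, v) else
      if v = b then ratio x A s(u, v) else
        (G.degree u : ℝ) / G.degree v * ratio x A s(u, v)) := by
    have hodd := h.odd
    have hoddB := oddSet_symmDiff A {s(u, v)}
    rw [oddSet_singleton huv.ne, hodd, symmDiff_comm ({u} : Finset (Fin n)) {b},
      symmDiff_assoc, symmDiff_symmDiff_cancel_left] at hoddB
    by_cases hub : u = b
    · rw [if_pos hub, acceptance_of_oddSet_eq_empty (Or.inl (by rw [hodd, hub]; simp))]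
      ring
    · by_cases hvb : v = b
      · rw [if_neg hub, if_pos hvb,
          acceptance_of_oddSet_eq_empty (Or.inr (by rw [hoddB, hvb]; simp))]
        ring
      · rw [if_neg hub, if_neg hvb, acceptance_of_card hA hB]
        · ring
        · rw [hodd]
          exact fun he => hub (symmDiff_pair_eq_empty.1 he)
        · rw [hoddB]
          exact fun he => hvb (symmDiff_pair_eq_empty.1 he).symm
        · rw [hodd, symmDiff_singleton_pair hub]
          simp
  rw [hacc]
  refine (Safe.seq hdeg (T' := 49) fun s1 hF1 h8 => ?_).mono_time (by omega)
  have hE1 := hE.of_frame hF1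
  have hH1 := h.of_frame hF1
  have h51 : s1.idx 5 = v := (hF1.idx rfl).trans h5
  have h41 : s1.idx 4 = G.degree u := (hF1.idx rfl).trans h4
  have hget : s1.arr 1 (s1.idx 1) (s1.idx 5) = if s(u, v) ∈ A then 1 else 0 := by
    rw [hH1.idx1, h51, hH1.arr1]
  refine (Safe.seq (Q := fun s' => s'.var 6 = ratio x A s(u, v)) (T := 11) (T' := 38)
    ((Safe.ifLt (fun hlt => Safe.assign ?_) fun hge => Safe.assign ?_).mono_time
      (by simp [Expr.cost, IExpr.cost])) fun s2 hF2 h6 => ?_).mono_time le_rfl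
  · simp only [Expr.eval, IExpr.eval, hget] at hlt
    have hmem : s(u, v) ∈ A := by
      by_contra hmem
      simp [hmem] at hlt
    simp [Store.setVar_var, Expr.eval, IExpr.eval, ratio, hmem, hE1.var3]
  · simp only [Expr.eval, IExpr.eval, hget] at hge
    have hmem : s(u, v) ∉ A := by
      intro hmem
      simp [hmem] at hge
    simp [Store.setVar_var, Expr.eval, ratio, hmem, hE1.var3]
  have hH2 := hH1.of_frame hF2
  have h52 : s2.idx 5 = v := (hF2.idx rfl).trans h51
  have h42 : s2.idx 4 = G.degree u := (hF2.idx rfl).trans h41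
  have h82 : s2.idx 8 = G.degree v := (hF2.idx rfl).trans h8
  refine (Safe.seq (Q := fun s' => s'.var 6 = if u = b then ratio x A s(u, v) else
      if v = b then ratio x A s(u, v) else
        (G.degree u : ℝ) / G.degree v * ratio x A s(u, v)) (T := 30) (T' := 8)
    ((Safe.ifEq (fun heq => Safe.skip ?_) fun hne => Safe.ifEq (fun heq => Safe.skip ?_)
      fun hne' => Safe.assign ?_).mono_time (by simp [Expr.cost, IExpr.cost]))
      fun s3 hF3 h63 => ?_).mono_time le_rfl
  · simp only [IExpr.eval, hH2.idx1, hH2.idx2] at heq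
    rw [if_pos (Fin.ext heq), h6]
  · simp only [IExpr.eval, hH2.idx1, hH2.idx2] at hne
    simp only [IExpr.eval, h52, hH2.idx2] at heq
    rw [if_neg fun hc => hne (congrArg Fin.val hc), if_pos (Fin.ext heq), h6]
  · simp only [IExpr.eval, hH2.idx1, hH2.idx2] at hne
    simp only [IExpr.eval, h52, hH2.idx2] at hne'
    rw [if_neg fun hc => hne (congrArg Fin.val hc), if_neg fun hc => hne' (congrArg Fin.val hc)]
    simp [Store.setVar_var, Expr.eval, IExpr.eval, h42, h82, h6]
  · refine (Safe.ifLt (fun hlt => Safe.assign ?_) fun hge => Safe.skip ?_).mono_time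
      (by simp [Expr.cost, IExpr.cost])
    · simp only [Expr.eval, IExpr.eval, h63, Nat.cast_one] at hlt
      rw [min_eq_left hlt.le]
      simp [Store.setVar_var, Expr.eval, IExpr.eval]
    · simp only [Expr.eval, IExpr.eval, h63, Nat.cast_one, not_lt] at hge
      rw [min_eq_right hge, h63]

/-- Adding {u} △ {v} to the boundary {u} △ {b} gives {v} △ {b}, also when u = b or v = b. So
replacing `u` by `v` suffices. Both symmetric entries of the array are updated. -/
theorem safe_toggleProg {A : Finset (Sym2 (Fin n))} {u b v : Fin n} {s : Store}
    (h : Holds G A u b s) (huv : G.Adj u v) (h5 : s.idx 5 = v) :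
    Safe toggleProg s (Holds G (symmDiff A {s(u, v)}) v b) 17 := by
  have e1 : s.idx 1 = u := h.idx1
  refine (Safe.seq (Safe.store (Q := fun s' => s' = s.setArr 1 u v (1 - s.arr 1 u v)) ?_)
    fun s1 _ hs1 => Safe.seq (Safe.store (Q := fun s' => s' =
      (s.setArr 1 u v (1 - s.arr 1 u v)).setArr 1 v u (1 - s.arr 1 u v)) ?_)
      fun s2 _ hs2 => Safe.assignIdx ?_).mono_time (by simp [Expr.cost, IExpr.cost])
  · simp [Expr.eval, IExpr.eval, e1, h5]
  · subst hs1
    simp [Expr.eval, IExpr.eval, e1, h5, Store.setArr_idx, Store.setArr_arr]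
  · subst hs2
    refine ⟨toggle_subset h.subset (by simpa using huv), ?_, ?_, ?_, ?_⟩
    · intro i j
      simp only [Store.setIdx_arr, Store.setArr_arr, true_and, Fin.val_inj]
      have hmem : s(i, j) ∈ symmDiff A {s(u, v)} ↔
          (s(i, j) ∈ A ∧ s(i, j) ≠ s(u, v)) ∨ (s(i, j) = s(u, v) ∧ s(i, j) ∉ A) := by
        rw [Finset.mem_symmDiff, Finset.mem_singleton]
      by_cases h1 : i = v ∧ j = u
      · obtain ⟨rfl, rfl⟩ := h1
        rw [if_pos ⟨rfl, rfl⟩, h.arr1]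
        have hsw : s(i, j) = s(j, i) := Sym2.eq_swap
        rw [hsw]
        by_cases hA : s(j, i) ∈ A <;> simp [Finset.mem_symmDiff, hA]
      · by_cases h2 : i = u ∧ j = v
        · obtain ⟨rfl, rfl⟩ := h2
          rw [if_neg h1, if_pos ⟨rfl, rfl⟩, h.arr1]
          by_cases hA : s(i, j) ∈ A <;> simp [hmem, hA]
        · rw [if_neg h1, if_neg h2, h.arr1]
          have hne : s(i, j) ≠ s(u, v) := by
            intro he
            rcases Sym2.eq_iff.1 he with h' | h'
            · exact h2 h'
            · exact h1 h'
          simp [hmem, hne]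
    · simp [Store.setIdx_idx, IExpr.eval, Store.setArr_idx, h5]
    · simp [Store.setIdx_idx, Store.setArr_idx, h.idx2]
    · rw [oddSet_symmDiff, oddSet_singleton huv.ne, h.odd, symmDiff_comm ({u} : Finset (Fin n)) {b},
        symmDiff_assoc, symmDiff_symmDiff_cancel_left, symmDiff_comm]

theorem psStep_eq_bind {V : Type*} [Fintype V] [DecidableEq V] {G : SimpleGraph V}
    [DecidableRel G.Adj] (hV : 0 < Fintype.card V)
    (hN : ∀ u, (G.neighborFinset u).Nonempty) (x : ℝ) (A : Finset (Sym2 V)) :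
    psStep G x A = (PMF.uniformOfFinset (startSet A) (startSet_nonempty hV A)).bind fun u =>
      (PMF.uniformOfFinset (G.neighborFinset u) (hN u)).bind fun v =>
        (coin (acceptance G x A u v)).bind fun t =>
          PMF.pure (if t then symmDiff A {s(u, v)} else A) := by
  unfold psStep
  rw [← startSet]
  unfold drawFrom
  rw [dif_pos (startSet_nonempty hV A)]
  congr 1
  funext u
  rw [dif_pos (hN u)]
  rfl

/-- The program `stepProg` carries out one step of the PS chain. -/
theorem impl_stepProg {x : ℝ} {A : Finset (Sym2 (Fin n))} {s : Store}
    (hN : ∀ u, (G.neighborFinset u).Nonempty) (hE : Env G x s) (h : ∃ a b, Holds G A a b s) :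
    Impl (stepProg.run s) (psStep G x A) (fun B s' => ∃ a b, Holds G B a b s')
      (133 + n * 52) := by
  obtain ⟨a, b, h⟩ := h
  rw [psStep_eq_bind (by simpa using a.pos) hN]
  refine (Impl.seq (impl_chooseProg hE h) (T' := 103 + n * 52) fun u s1 hF1 h1 => ?_).mono_time
    (by omega)
  obtain ⟨hu, b, h1⟩ := h1
  have hE1 := hE.of_frame hF1
  refine (Impl.seq (impl_neighborProg hE1 h1 (hN u)) (T' := 87 + n * 15)
    fun v s2 hF2 h2 => ?_).mono_time (by omega)
  obtain ⟨huv, h5, h4⟩ := h2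
  have hE2 := hE1.of_frame hF2
  have hH2 := h1.of_frame hF2
  refine (Impl.safe_seq (safe_ratioProg hE2 hH2 hu huv h5 h4) (T' := 31)
    fun s3 hF3 h6 => ?_).mono_time (by omega)
  have hH3 := hH2.of_frame hF3
  have h53 : s3.idx 5 = v := (hF3.idx rfl).trans h5
  have hacc : (Expr.div (.var 6) (.int (.lit 2))).eval s3 = acceptance G x A u v := by
    simp [Expr.eval, IExpr.eval, h6]
  rw [← hacc]
  refine (Impl.seq (Impl.flip (R := fun t s' => s' = s3.setIdx 7 (if t then 1 else 0))
    fun t => rfl) (T' := 24) fun t s4 _ hs4 => ?_).mono_time (by simp [Expr.cost, IExpr.cost])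
  subst hs4
  have hH4 : Holds G A u b (s3.setIdx 7 (if t then 1 else 0)) :=
    ⟨hH3.subset, hH3.arr1, hH3.idx1, hH3.idx2, hH3.odd⟩
  refine Impl.of_safe ((Safe.ifLt (fun hlt => (safe_toggleProg hH4 huv h53).mono le_rfl
    fun s' _ h' => ?_) fun hge => Safe.skip ?_).mono_time (by simp [Expr.cost, IExpr.cost]))
  · have ht : t = true := by
      by_contra ht
      simp [ht, Expr.eval, IExpr.eval, Store.setIdx_idx] at hlt
    rw [if_pos ht]
    exact ⟨_, _, h'⟩
  · have ht : ¬(t = true) := by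
      intro ht
      simp [ht, Expr.eval, IExpr.eval, Store.setIdx_idx] at hge
    rw [if_neg ht]
    exact ⟨_, _, hH4⟩

end Step

/-! ### Sampling -/

theorem Impl.support {α : Type*} {p : PMF (Store × ℕ)} {μ : PMF α} {R : α → Store → Prop} {T : ℕ}
    (h : Impl p μ R T) : Impl p μ (fun a s => a ∈ μ.support ∧ R a s) T := by
  obtain ⟨κ, h1, h2, h3⟩ := h
  refine ⟨κ, h1, h2, fun z hz => ⟨⟨?_, (h3 z hz).1⟩, (h3 z hz).2⟩⟩
  rw [← h1, PMF.mem_support_map_iff]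
  exact ⟨z, hz, rfl⟩

/-- Clear the array `1`. -/
def clearProg : Program := forEach 9 0 (forEach 3 0 (.store 1 (.idx 9) (.idx 3) (.int (.lit 0))))

theorem safe_clearProg (s : Store) : Safe clearProg s
    (fun s' => ∀ k < s.idx 0, ∀ l < s.idx 0, s'.arr 1 k l = 0)
    (5 + s.idx 0 * (10 + s.idx 0 * 10)) := by
  refine (Safe.forEach (T := 5 + s.idx 0 * 10)
    (R := fun i s' => ∀ k < i, ∀ l < s.idx 0, s'.arr 1 k l = 0) (by norm_num) rfl
    (by simp) ?_).mono_time (by rw [show 5 + s.idx 0 * 10 + 5 = 10 + s.idx 0 * 10 by omega])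
  intro i s' hi h9 hF hR
  have h0 : s'.idx 0 = s.idx 0 := hF.idx rfl
  rw [← h0]
  refine (Safe.forEach (T := 5) (R := fun j s'' => (∀ k < i, ∀ l < s.idx 0, s''.arr 1 k l = 0) ∧
    ∀ l < j, s''.arr 1 i l = 0) (by norm_num) rfl ⟨hR, by simp⟩ ?_).mono le_rfl ?_
  · rintro j s2 hj h3 hF2 ⟨h1, h2⟩
    have h92 : s2.idx 9 = i := (hF2.idx rfl).trans h9
    refine (Safe.store ?_).mono_time (by simp [Expr.cost, IExpr.cost])
    simp only [IExpr.eval, Expr.eval, h92, h3, Store.setIdx_arr, Store.setArr_arr, true_and]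
    refine ⟨fun k hk l hl => ?_, fun l hl => ?_⟩
    · rw [if_neg (by omega)]
      exact h1 k hk l hl
    · split_ifs with hlj
      · simp
      · exact h2 l (by omega)
  · rintro s2 - ⟨h1, h2⟩ k hk l hl
    rw [Store.setIdx_arr]
    rcases Nat.lt_succ_iff_lt_or_eq.1 hk with hk | rfl
    · exact h1 k hk l (by omega)
    · exact h2 l (by omega)

/-- Run the chain once, and add the indicator of the even subgraphs to the real variable `5`. -/
def sampleProg : Program :=
  .seq clearProg (.seq (.assignIdx 1 (.lit 0)) (.seq (.assignIdx 2 (.lit 0))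
    (.seq (.loop (.var 4) stepProg)
      (ifEq (.idx 1) (.idx 2) (.assign 5 (.add (.var 5) (.int (.lit 1)))) .skip))))

/-- Run the chain repeatedly, and append the mean of the indicators to the array `2`. -/
def meanProg : Program :=
  .seq (.assign 5 (.int (.lit 0))) (.seq (.loop (.int (.idx 13)) sampleProg)
    (.seq (.store 2 (.lit 0) (.idx 15) (.div (.var 5) (.int (.idx 13))))
      (.assignIdx 15 (.add (.idx 15) (.lit 1)))))

section Sample

variable {n : ℕ} {G : SimpleGraph (Fin n)} [DecidableRel G.Adj]

/-- A bound for the time of one run of `k` steps. -/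
def sampleTime (n k : ℕ) : ℕ := 26 + n * (10 + n * 10) + k * (134 + n * 52)

theorem impl_sampleProg {x sz ε : ℝ} {s : Store} (hn : 0 < n)
    (hN : ∀ u, (G.neighborFinset u).Nonempty) (hE : Env G x s)
    (h4 : s.var 4 = mixBound G x (ε / (16 * sz))) :
    Impl (sampleProg.run s) (oneSample G x (oddClass G 0) sz ε ∅)
      (fun y s' => s'.var 5 = s.var 5 + y)
      (sampleTime n ⌈mixBound G x (ε / (16 * sz))⌉₊) := by
  set k := ⌈mixBound G x (ε / (16 * sz))⌉₊ with hk
  have hclear := safe_clearProg s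
  rw [hE.idx0] at hclear
  refine (Impl.safe_seq hclear (T' := 21 + k * (134 + n * 52)) fun s1 hF1 h1 => ?_).mono_time
    (by unfold sampleTime; omega)
  refine (Impl.safe_seq (Safe.assignIdx (Q := fun s' => s' = s1.setIdx 1 0) rfl)
    (T' := 19 + k * (134 + n * 52)) fun s2 hF2 h2 => ?_).mono_time (by simp [IExpr.cost]; omega)
  refine (Impl.safe_seq (Safe.assignIdx (Q := fun s' => s' = s2.setIdx 2 0) rfl)
    (T' := 17 + k * (134 + n * 52)) fun s3 hF3 h3 => ?_).mono_time (by simp [IExpr.cost]; omega)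
  have hE3 : Env G x s3 := ((hE.of_frame hF1).of_frame hF2).of_frame hF3
  have h43 : s3.var 4 = s.var 4 := by rw [hF3.var rfl, hF2.var rfl, hF1.var rfl]
  have h53 : s3.var 5 = s.var 5 := by rw [hF3.var rfl, hF2.var rfl, hF1.var rfl]
  have hk3 : ⌈(Expr.var 4).eval s3⌉₊ = k := by rw [Expr.eval, h43, h4]
  -- The empty set is represented by any two equal vertices; 0 is a vertex because n is positive.
  have hH3 : Holds G ∅ ⟨0, hn⟩ ⟨0, hn⟩ s3 := by
    subst h3 h2
    refine ⟨Finset.empty_subset _, fun i j => ?_, rfl, rfl, ?_⟩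
    · simpa [Store.setIdx_arr] using h1 i i.2 j j.2
    · simp [oddSet_empty]
  have hloop := Impl.loop (c := stepProg) (ν := psStep G x)
    (R := fun A s' => ∃ a b, Holds G A a b s') (T := 133 + n * 52) hk3 ⟨_, _, hH3⟩
    fun A s' hF hA => impl_stepProg hN (hE3.of_frame hF) hA
  rw [iterLaw_psStep] at hloop
  refine (hloop.seq (ν := fun A => PMF.pure (if A ∈ oddClass G 0 then (1 : ℝ) else 0))
    (T' := 15) fun A s4 hF4 hA => ?_).mono_time ?_
  · obtain ⟨a, b, hH⟩ := hA
    have h54 : s4.var 5 = s.var 5 := (hF4.var rfl).trans h53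
    -- Membership in the even class is read off the two vertices, without inspecting the edge array.
    have hmem : A ∈ oddClass G 0 ↔ a = b := by
      rw [mem_oddClass, hH.odd, Finset.card_eq_zero, symmDiff_pair_eq_empty]
      exact ⟨fun h => h.2, fun h => ⟨hH.subset, h⟩⟩
    refine Impl.of_safe ((Safe.ifEq (fun heq => Safe.assign ?_) fun hne =>
      Safe.skip ?_).mono_time (by simp [Expr.cost, IExpr.cost]))
    · simp only [IExpr.eval, hH.idx1, hH.idx2] at heq
      rw [if_pos (hmem.2 (Fin.ext heq))]
      simp [Store.setVar_var, Expr.eval, IExpr.eval, h54]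
    · simp only [IExpr.eval, hH.idx1, hH.idx2] at hne
      rw [if_neg fun h => hne (congrArg Fin.val (hmem.1 h)), h54, add_zero]
  · rw [show 133 + n * 52 + 1 = 134 + n * 52 by omega]
    simp only [Expr.cost]
    omega

/-- A bound for the time of `meanProg`. -/
def meanTime (n k N : ℕ) : ℕ := 17 + N * (sampleTime n k + 1)

theorem impl_meanProg {x sz ε : ℝ} {s : Store} {N : ℕ} (hn : 0 < n)
    (hN : ∀ u, (G.neighborFinset u).Nonempty) (hE : Env G x s)
    (h4 : s.var 4 = mixBound G x (ε / (16 * sz))) (h13 : s.idx 13 = N) :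
    Impl (meanProg.run s) ((iid (oneSample G x (oddClass G 0) sz ε ∅) N).map mean)
      (fun y s' => s'.idx 15 = s.idx 15 + 1 ∧ s'.arr 2 0 (s.idx 15) = y ∧
        ∀ k, k ≠ s.idx 15 → s'.arr 2 0 k = s.arr 2 0 k)
      (meanTime n ⌈mixBound G x (ε / (16 * sz))⌉₊ N) := by
  set T := sampleTime n ⌈mixBound G x (ε / (16 * sz))⌉₊ with hT
  refine (Impl.safe_seq (Safe.assign (Q := fun s' => s'.var 5 = 0)
    (by simp [Store.setVar_var, Expr.eval, IExpr.eval]))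
    (T' := 14 + N * (T + 1)) fun s1 hF1 h51 => ?_).mono_time
    (by simp only [Expr.cost, IExpr.cost, meanTime, ← hT]; omega)
  have hE1 := hE.of_frame hF1
  have hk1 : ⌈(Expr.int (.idx 13)).eval s1⌉₊ = N := by
    simp [Expr.eval, IExpr.eval, hF1.idx (i := 13) rfl, h13]
  have hloop := Impl.loop (c := sampleProg) (a := [])
    (ν := fun l => (oneSample G x (oddClass G 0) sz ε ∅).map fun a => l ++ [a])
    (R := fun l s' => s'.var 5 = l.sum) (T := T) hk1 (by simpa using h51)
    fun l s' hF hl => Impl.map ((impl_sampleProg hn hN (hE1.of_frame hF)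
      (((hF.var rfl).trans (hF1.var rfl)).trans h4)).mono le_rfl fun y s'' hy => by
        rw [hy, hl]
        simp)
  rw [iterLaw_snoc] at hloop
  simp only [List.nil_append] at hloop
  rw [show (fun l' : List ℝ => l') = id from rfl, PMF.map_id] at hloop
  -- Restricting to the support provides the length of the sample list, so that division by the
  -- stored number of runs is the mean.
  refine (hloop.support.seq (ν := fun l => PMF.pure (mean l)) (T' := 11)
    fun l s2 hF2 hl => ?_).mono_time (by simp [Expr.cost, IExpr.cost]; omega)
  obtain ⟨hls, hl⟩ := hl
  have hlen := length_of_mem_support_iid hls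
  have h132 : s2.idx 13 = N := ((hF2.idx rfl).trans (hF1.idx rfl)).trans h13
  have h152 : s2.idx 15 = s.idx 15 := (hF2.idx rfl).trans (hF1.idx rfl)
  have ha2 : s2.arr 2 = s.arr 2 := (hF2.arr rfl).trans (hF1.arr rfl)
  refine Impl.of_safe ((Safe.seq (Safe.store (Q := fun s' => s' = s2.setArr 2 0 (s.idx 15) (mean l))
    ?_) fun s3 _ hs3 => Safe.assignIdx ?_).mono_time (by simp [Expr.cost, IExpr.cost]))
  · simp [Expr.eval, IExpr.eval, h152, h132, hl, mean, hlen]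
  · subst hs3
    refine ⟨?_, ?_, fun k hk => ?_⟩
    · simp [Store.setIdx_idx, IExpr.eval, Store.setArr_idx, h152]
    · simp [Store.setIdx_arr, Store.setArr_arr]
    · simp [Store.setIdx_arr, Store.setArr_arr, hk, ha2]

theorem impl_loop_meanProg {x sz ε : ℝ} {s : Store} {N K : ℕ} (hn : 0 < n)
    (hN : ∀ u, (G.neighborFinset u).Nonempty) (hE : Env G x s)
    (h4 : s.var 4 = mixBound G x (ε / (16 * sz))) (h13 : s.idx 13 = N) (h12 : s.idx 12 = K)
    (h15 : s.idx 15 = 0) :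
    Impl ((Program.loop (.int (.idx 12)) meanProg).run s)
      (iid ((iid (oneSample G x (oddClass G 0) sz ε ∅) N).map mean) K)
      (fun l s' => ∀ i (hi : i < l.length), s'.arr 2 0 i = l[i])
      (3 + K * (meanTime n ⌈mixBound G x (ε / (16 * sz))⌉₊ N + 1)) := by
  have hk : ⌈(Expr.int (.idx 12)).eval s⌉₊ = K := by simp [Expr.eval, IExpr.eval, h12]
  have hloop := Impl.loop (c := meanProg) (a := [])
    (ν := fun l => ((iid (oneSample G x (oddClass G 0) sz ε ∅) N).map mean).map fun a => l ++ [a])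
    (R := fun l s' => s'.idx 15 = l.length ∧ ∀ i (hi : i < l.length), s'.arr 2 0 i = l[i])
    (T := meanTime n ⌈mixBound G x (ε / (16 * sz))⌉₊ N) hk ⟨h15, by simp⟩
    fun l s' hF hl => Impl.map ((impl_meanProg hn hN (hE.of_frame hF)
      ((hF.var rfl).trans h4) ((hF.idx rfl).trans h13)).mono le_rfl ?_)
  · rw [iterLaw_snoc] at hloop
    simp only [List.nil_append] at hloop
    rw [show (fun l' : List ℝ => l') = id from rfl, PMF.map_id] at hloop
    exact hloop.mono (by simp [Expr.cost, IExpr.cost]) fun l s' h => h.2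
  · rintro y s'' ⟨h1, h2, h3⟩
    obtain ⟨hl1, hl2⟩ := hl
    refine ⟨by simp [h1, hl1], fun i hi => ?_⟩
    rw [List.length_append, List.length_singleton] at hi
    by_cases hil : i = l.length
    · subst hil
      rw [hl1] at h2
      simp [h2]
    · rw [h3 i (by omega), hl2 i (by omega), List.getElem_append_left]

end Sample

/-! ### The median by counting -/

theorem countP_lt_add_countP_ge (l : List ℝ) (y : ℝ) :
    l.countP (· < y) + l.countP (y ≤ ·) = l.length := by
  rw [List.length_eq_countP_add_countP (· < y)]
  congr 1
  refine List.countP_congr fun a _ => ?_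
  simp

theorem countP_le_add_countP_gt (l : List ℝ) (y : ℝ) :
    l.countP (· ≤ y) + l.countP (y < ·) = l.length := by
  rw [List.length_eq_countP_add_countP (· ≤ y)]
  congr 1
  refine List.countP_congr fun a _ => ?_
  simp

/-- Characterises order statistics by counting, ties included; with it the median can be found
without sorting. -/
theorem insertionSort_getElem_eq_iff (l : List ℝ) (y : ℝ) {j : ℕ}
    (hj : j < (l.insertionSort (· ≤ ·)).length) :
    (l.insertionSort (· ≤ ·))[j] = y ↔ l.countP (· < y) ≤ j ∧ j < l.countP (· ≤ y) := by
  set L := l.insertionSort (· ≤ ·) with hL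
  have hperm : L.Perm l := List.perm_insertionSort _ l
  have hsort : L.Pairwise (· ≤ ·) := pairwise_insertionSort_le l
  have hmono : ∀ i j (hi : i < L.length) (hj : j < L.length), i ≤ j → L[i] ≤ L[j] := by
    intro i j hi hj hij
    rcases hij.eq_or_lt with rfl | hlt
    · exact le_rfl
    · exact List.pairwise_iff_getElem.1 hsort i j hi hj hlt
  rw [← hperm.countP_eq (· < y), ← hperm.countP_eq (· ≤ y)]
  have h1 := countP_lt_add_countP_ge L y
  have h2 := countP_le_add_countP_gt L y
  constructor
  · intro he
    constructor
    · have := le_countP_of_forall_getElem (l := L) (q := (y ≤ ·)) (i := j)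
        (j := L.length) le_rfl fun m hm hjm _ => by
          rw [← he]
          exact hmono j m hj hm hjm
      omega
    · have := le_countP_of_forall_getElem (l := L) (q := (· ≤ y)) (i := 0)
        (j := j + 1) (by omega) fun m hm _ hmj => by
          rw [← he]
          exact hmono m j hm hj (by omega)
      omega
  · rintro ⟨hlo, hhi⟩
    refine le_antisymm ?_ ?_
    · by_contra hcon
      rw [not_le] at hcon
      have := le_countP_of_forall_getElem (l := L) (q := (y < ·)) (i := j)
        (j := L.length) le_rfl fun m hm hjm _ => hcon.trans_le (hmono j m hj hm hjm)
      omega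
    · by_contra hcon
      rw [not_le] at hcon
      have := le_countP_of_forall_getElem (l := L) (q := (· < y)) (i := 0)
        (j := j + 1) (by omega) fun m hm _ hmj =>
          (hmono m j hm hj (by omega)).trans_lt hcon
      omega

/-- Compute the two middle entries of row `0` of the array `2`, whose length is in the integer
variable `12`, in the real variables `8` and `9`. -/
def medianProg : Program :=
  forEach 9 12
    (.seq (.assignIdx 10 (.lit 0)) (.seq (.assignIdx 11 (.lit 0)) (.seq
      (forEach 3 12 (.seq
        (.ifLt (.get 2 (.lit 0) (.idx 3)) (.get 2 (.lit 0) (.idx 9))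
          (.assignIdx 10 (.add (.idx 10) (.lit 1))) .skip)
        (.ifLt (.get 2 (.lit 0) (.idx 9)) (.get 2 (.lit 0) (.idx 3))
          .skip (.assignIdx 11 (.add (.idx 11) (.lit 1))))))
      (.seq
        (.ifLt (.int (.add (.idx 10) (.idx 10))) (.int (.idx 12))
          (.ifLt (.int (.add (.idx 11) (.idx 11))) (.int (.idx 12)) .skip
            (.assign 8 (.get 2 (.lit 0) (.idx 9)))) .skip)
        (.ifLt (.int (.idx 12)) (.int (.add (.idx 10) (.idx 10))) .skip
          (.ifLt (.int (.idx 12)) (.int (.add (.idx 11) (.idx 11)))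
            (.assign 9 (.get 2 (.lit 0) (.idx 9))) .skip))))))

theorem countP_take_succ {l : List ℝ} {p : ℝ → Bool} {j : ℕ} (hj : j < l.length) :
    (l.take (j + 1)).countP p = (l.take j).countP p + if p l[j] then 1 else 0 := by
  rw [← List.take_append_getElem hj, List.countP_append, List.countP_singleton]

theorem safe_medianProg {s : Store} {l : List ℝ} (h12 : s.idx 12 = l.length)
    (hpos : 0 < l.length) (hl : ∀ i (hi : i < l.length), s.arr 2 0 i = l[i]) :
    Safe medianProg s
      (fun s' => s'.var 8 = (l.insertionSort (· ≤ ·)).getD ((l.length - 1) / 2) 0 ∧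
        s'.var 9 = (l.insertionSort (· ≤ ·)).getD (l.length / 2) 0)
      (5 + l.length * (50 + l.length * 27)) := by
  set L := l.insertionSort (· ≤ ·) with hL
  have hlen : L.length = l.length := (List.perm_insertionSort _ l).length_eq
  set K := l.length with hK
  have hj1 : (K - 1) / 2 < L.length := by omega
  have hj2 : K / 2 < L.length := by omega
  rw [List.getD_eq_getElem _ _ hj1, List.getD_eq_getElem _ _ hj2]
  -- Invariant: a result variable is correct once some entry examined so far has the value sought.
  -- Entries of another value do not write, and repeated ones write the same value again. Every
  -- sorted entry occurs in the list, so both values are found by the end.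
  have key : Safe medianProg s (fun s' =>
      ((∃ k, ∃ hk : k < l.length, k < s.idx 12 ∧ L[(K - 1) / 2] = l[k]) →
        s'.var 8 = L[(K - 1) / 2]) ∧
      ((∃ k, ∃ hk : k < l.length, k < s.idx 12 ∧ L[K / 2] = l[k]) → s'.var 9 = L[K / 2]))
      (5 + s.idx 12 * (45 + K * 27 + 5)) := by
    refine Safe.forEach (T := 45 + K * 27) (R := fun i s' =>
      ((∃ k, ∃ hk : k < l.length, k < i ∧ L[(K - 1) / 2] = l[k]) →
        s'.var 8 = L[(K - 1) / 2]) ∧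
      ((∃ k, ∃ hk : k < l.length, k < i ∧ L[K / 2] = l[k]) → s'.var 9 = L[K / 2]))
      (by norm_num) rfl (by simp) ?_
    rintro i s0 hi h9 hF0 ⟨hR8, hR9⟩
    rw [h12] at hi
    have h120 : s0.idx 12 = K := (hF0.idx rfl).trans h12
    have ha0 : s0.arr 2 = s.arr 2 := hF0.arr rfl
    set y := l[i] with hy
    refine (Safe.seq (Safe.assignIdx (Q := fun s' => s' = s0.setIdx 10 0) rfl)
      (T' := 43 + K * 27) fun s1 hF1 hs1 => ?_).mono_time (by simp only [IExpr.cost]; omega)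
    refine (Safe.seq (Safe.assignIdx (Q := fun s' => s' = s1.setIdx 11 0) rfl)
      (T' := 41 + K * 27) fun s2 hF2 hs2 => ?_).mono_time (by simp only [IExpr.cost]; omega)
    have h122 : s2.idx 12 = K := ((hF2.idx rfl).trans (hF1.idx rfl)).trans h120
    have h92 : s2.idx 9 = i := ((hF2.idx rfl).trans (hF1.idx rfl)).trans h9
    have ha2 : s2.arr 2 = s.arr 2 := ((hF2.arr rfl).trans (hF1.arr rfl)).trans ha0
    have h102 : s2.idx 10 = 0 := by
      subst hs2 hs1
      rfl
    have h112 : s2.idx 11 = 0 := by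
      subst hs2 hs1
      rfl
    have hinner := Safe.forEach (w := 3) (b := 12) (s := s2) (T := 22) (c := .seq
        (.ifLt (.get 2 (.lit 0) (.idx 3)) (.get 2 (.lit 0) (.idx 9))
          (.assignIdx 10 (.add (.idx 10) (.lit 1))) .skip)
        (.ifLt (.get 2 (.lit 0) (.idx 9)) (.get 2 (.lit 0) (.idx 3))
          .skip (.assignIdx 11 (.add (.idx 11) (.lit 1)))))
      (R := fun j s' => s'.idx 10 = (l.take j).countP (· < y) ∧
        s'.idx 11 = (l.take j).countP (· ≤ y)) (by norm_num) rfl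
      (by simp [Store.setIdx_idx, h102, h112]) ?_
    · rw [h122, hK, List.take_length, ← hK] at hinner
      refine (Safe.seq hinner (T' := 36) fun s3 hF3 h3 => ?_).mono_time (by omega)
      obtain ⟨h10, h11⟩ := h3
      have h123 : s3.idx 12 = K := (hF3.idx rfl).trans h122
      have h93 : s3.idx 9 = i := (hF3.idx rfl).trans h92
      have ha3 : s3.arr 2 = s.arr 2 := (hF3.arr rfl).trans ha2
      have hget : ∀ s' : Store, s'.arr 2 = s.arr 2 → s'.idx 9 = i →
          (Expr.get 2 (.lit 0) (.idx 9)).eval s' = y := by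
        intro s' h1 h2
        simp only [Expr.eval, IExpr.eval, h1, h2, hl i hi, hy]
      have hv8 : s3.var 8 = s0.var 8 := by rw [hF3.var rfl, hF2.var rfl, hF1.var rfl]
      have hv9 : s3.var 9 = s0.var 9 := by rw [hF3.var rfl, hF2.var rfl, hF1.var rfl]
      have hstep : ∀ {j : ℕ} (hj : j < L.length) (v : ℝ),
          ((∃ k, ∃ hk : k < l.length, k < i ∧ L[j] = l[k]) → v = L[j]) → L[j] ≠ y →
          (∃ k, ∃ hk : k < l.length, k < i + 1 ∧ L[j] = l[k]) → v = L[j] := by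
        rintro j hj v hv hne ⟨k, hk, hki, he⟩
        refine hv ⟨k, hk, ?_, he⟩
        rcases Nat.lt_succ_iff_lt_or_eq.1 hki with h | rfl
        · exact h
        · exact absurd he hne
      -- With integer division, #{< y} ≤ (K-1)/2 < #{≤ y} says 2 #{< y} < K ≤ 2 #{≤ y}, and #{< y} ≤
      -- K/2 < #{≤ y} says 2 #{< y} ≤ K < 2 #{≤ y}. The program tests these doubled inequalities,
      -- which need only addition.
      have h1 := insertionSort_getElem_eq_iff l y hj1
      have h2 := insertionSort_getElem_eq_iff l y hj2
      rw [← h10, ← h11] at h1 h2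
      refine (Safe.seq (T := 18) (T' := 18) (Q := fun s' =>
          (∃ k, ∃ hk : k < l.length, k < i + 1 ∧ L[(K - 1) / 2] = l[k]) →
            s'.var 8 = L[(K - 1) / 2])
        ((Safe.ifLt (fun hlt => Safe.ifLt (fun hlt' => Safe.skip ?_) fun hge' => Safe.assign ?_)
          fun hge => Safe.skip ?_).mono_time (by simp [Expr.cost, IExpr.cost]))
        fun s4 hF4 h84 => ?_).mono_time (by norm_num)
      · simp only [Expr.eval, IExpr.eval, Nat.cast_lt, h123] at hlt'
        rw [hv8]
        refine hstep hj1 _ hR8 fun he => ?_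
        have := h1.1 he
        omega
      · simp only [Expr.eval, IExpr.eval, Nat.cast_lt, h123] at hlt hge'
        intro _
        rw [hget s3 ha3 h93, (h1.2 (by omega) : L[(K - 1) / 2] = y)]
        simp [Store.setVar_var]
      · simp only [Expr.eval, IExpr.eval, Nat.cast_lt, h123] at hge
        rw [hv8]
        refine hstep hj1 _ hR8 fun he => ?_
        have := h1.1 he
        omega
      have h104 : s4.idx 10 = s3.idx 10 := hF4.idx rfl
      have h114 : s4.idx 11 = s3.idx 11 := hF4.idx rfl
      have h124 : s4.idx 12 = K := (hF4.idx rfl).trans h123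
      have h94 : s4.idx 9 = i := (hF4.idx rfl).trans h93
      have ha4 : s4.arr 2 = s.arr 2 := (hF4.arr rfl).trans ha3
      have hv94 : s4.var 9 = s0.var 9 := (hF4.var rfl).trans hv9
      refine (Safe.ifLt (fun hlt => Safe.skip ?_) fun hge => Safe.ifLt
        (fun hlt' => Safe.assign ?_) fun hge' => Safe.skip ?_).mono_time
        (by simp [Expr.cost, IExpr.cost])
      · simp only [Expr.eval, IExpr.eval, Nat.cast_lt, h124, h104] at hlt
        refine ⟨h84, ?_⟩
        rw [Store.setIdx_var, hv94]
        refine hstep hj2 _ hR9 fun he => ?_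
        have := h2.1 he
        omega
      · simp only [Expr.eval, IExpr.eval, Nat.cast_lt, h124, h104, h114] at hge hlt'
        refine ⟨h84, fun _ => ?_⟩
        rw [hget s4 ha4 h94, (h2.2 (by omega) : L[K / 2] = y)]
        simp [Store.setIdx_var, Store.setVar_var]
      · simp only [Expr.eval, IExpr.eval, Nat.cast_lt, h124, h114] at hge'
        refine ⟨h84, ?_⟩
        rw [Store.setIdx_var, hv94]
        refine hstep hj2 _ hR9 fun he => ?_
        have := h2.1 he
        omega
    · rintro j s3 hj h3 hF3 ⟨h10, h11⟩
      rw [h122] at hj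
      have h93 : s3.idx 9 = i := (hF3.idx rfl).trans h92
      have ha3 : s3.arr 2 = s.arr 2 := (hF3.arr rfl).trans ha2
      rw [countP_take_succ hj, countP_take_succ hj]
      refine (Safe.seq (T := 11) (T' := 11) (Q := fun s' =>
          s'.idx 10 = (l.take j).countP (· < y) + (if decide (l[j] < y) then 1 else 0) ∧
            s'.idx 11 = (l.take j).countP (· ≤ y))
        ((Safe.ifLt (fun hlt => Safe.assignIdx ?_) fun hge => Safe.skip ?_).mono_time
          (by simp [Expr.cost, IExpr.cost])) fun s4 hF4 h4 => ?_).mono_time (by norm_num)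
      · simp only [Expr.eval, IExpr.eval, ha3, h3, h93, hl j hj, hl i hi, ← hy] at hlt
        simp [Store.setIdx_idx, IExpr.eval, h10, h11, hlt]
      · simp only [Expr.eval, IExpr.eval, ha3, h3, h93, hl j hj, hl i hi, ← hy] at hge
        simp [h10, h11, hge]
      · obtain ⟨h104, h114⟩ := h4
        have h94 : s4.idx 9 = i := (hF4.idx rfl).trans h93
        have h34 : s4.idx 3 = j := (hF4.idx rfl).trans h3
        have ha4 : s4.arr 2 = s.arr 2 := (hF4.arr rfl).trans ha3
        refine (Safe.ifLt (fun hlt => Safe.skip ?_) fun hge => Safe.assignIdx ?_).mono_time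
          (by simp [Expr.cost, IExpr.cost])
        · simp only [Expr.eval, IExpr.eval, ha4, h34, h94, hl j hj, hl i hi, ← hy] at hlt
          simp [Store.setIdx_idx, h104, h114, hlt]
        · simp only [Expr.eval, IExpr.eval, ha4, h34, h94, hl j hj, hl i hi, ← hy, not_lt] at hge
          simp [Store.setIdx_idx, IExpr.eval, h104, h114, hge]
  refine key.mono (by rw [h12, show 45 + K * 27 + 5 = 50 + K * 27 by omega]) ?_
  have hex : ∀ {j : ℕ} (hj : j < L.length), ∃ k, ∃ hk : k < l.length,
      k < s.idx 12 ∧ L[j] = l[k] := by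
    intro j hj
    have hm : L[j] ∈ l := (List.mem_insertionSort _).1 (List.getElem_mem hj)
    obtain ⟨k, hk, he⟩ := List.getElem_of_mem hm
    exact ⟨k, hk, by omega, he.symm⟩
  rintro s' - ⟨h8, h9⟩
  exact ⟨h8 (hex hj1), h9 (hex hj2)⟩

/-! ### The parameters of the estimator -/

/-- The hyperbolic tangent of the real variable `0`. -/
def tanhExpr : Expr :=
  .div (.sub (.exp (.var 0)) (.exp (.sub (.int (.lit 0)) (.var 0))))
    (.add (.exp (.var 0)) (.exp (.sub (.int (.lit 0)) (.var 0))))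

theorem eval_tanhExpr (s : Store) : tanhExpr.eval s = Real.tanh (s.var 0) := by
  simp only [tanhExpr, Expr.eval, IExpr.eval, Nat.cast_zero, zero_sub]
  rw [Real.tanh_eq_sinh_div_cosh, Real.sinh_eq, Real.cosh_eq,
    div_div_div_cancel_right₀ two_ne_zero]

/-- Compute the maximum degree and the sum of the degrees in the integer variables `10` and `11`. -/
def degreesProg : Program :=
  forEach 9 0 (.seq (degProg 9 4) (.seq (.assignIdx 11 (.add (.idx 11) (.idx 4)))
    (.ifLt (.int (.idx 10)) (.int (.idx 4)) (.assignIdx 10 (.idx 4)) .skip)))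

/-- The bound for the mixing time, computed from the integer variables `0`, `10`, `11` and the real
variables `1` and `3`. -/
def mixExpr : Expr :=
  let x : Expr := .var 3
  let n : Expr := .int (.idx 0)
  let m : Expr := .div (.int (.idx 11)) (.int (.lit 2))
  let sz : Expr := .add (.mul (.int (.lit 2)) n) (.int (.lit 1))
  let δ : Expr := .div (.var 1) (.mul (.int (.lit 16)) sz)
  let n₃ : Expr := .mul (.mul n n) n
  .mul (.mul (.mul (.mul (.mul (.div (.int (.lit 1)) (.mul (.int (.lit 2)) x))
    (.sub (.log (.div (.int (.lit 8)) x)) (.div (.log δ) m)))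
    (.add (.int (.lit 3)) (.div (.int (.lit 1)) (.mul m x)))) (.int (.idx 10)))
    (.mul n₃ n₃)) (.mul m m)

/-- Compute the parameters of the estimator. -/
def setupProg : Program :=
  .seq (.assign 7 (.var 0)) (.seq (.assign 3 tanhExpr) (.seq degreesProg (.seq (.assign 4 mixExpr)
    (.seq
      (.loop (.add (.div (.add (.mul (.int (.lit 2)) (.int (.idx 0))) (.int (.lit 1)))
        (.mul (.var 1) (.var 1))) (.int (.lit 1))) (.assignIdx 13 (.add (.idx 13) (.lit 20))))
      (.seq (.loop (.log (.div (.int (.lit 1)) (.var 2))) (.assignIdx 12 (.add (.idx 12) (.lit 7))))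
        (.assignIdx 12 (.add (.idx 12) (.lit 1))))))))

section Main

variable {n : ℕ} {G : SimpleGraph (Fin n)} [DecidableRel G.Adj]

theorem sum_count_adjArr :
    ∑ k ∈ Finset.range n, Nat.count (fun w => 0 < adjArr G k w) n = 2 * G.edgeFinset.card := by
  rw [Finset.sum_range, ← G.sum_degrees_eq_twice_card_edges]
  exact Finset.sum_congr rfl fun u _ => count_adjArr u

theorem sup_count_adjArr :
    ((Finset.range n).sup fun k => Nat.count (fun w => 0 < adjArr G k w) n) = G.maxDegree := by
  refine le_antisymm (Finset.sup_le fun k hk => ?_) (G.maxDegree_le_of_forall_degree_le _ fun u => ?_)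
  · exact (count_adjArr ⟨k, Finset.mem_range.1 hk⟩).trans_le (G.degree_le_maxDegree _)
  · rw [← count_adjArr u]
    exact Finset.le_sup (f := fun k => Nat.count (fun w => 0 < adjArr G k w) n)
      (Finset.mem_range.2 u.2)

theorem safe_degreesProg {s : Store} (h0 : s.idx 0 = n) (ha : s.arr 0 = adjArr G)
    (h10 : s.idx 10 = 0) (h11 : s.idx 11 = 0) :
    Safe degreesProg s (fun s' => s'.idx 10 = G.maxDegree ∧ s'.idx 11 = 2 * G.edgeFinset.card)
      (5 + n * (23 + n * 15)) := by
  rw [← sup_count_adjArr, ← sum_count_adjArr]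
  have key := Safe.forEach (w := 9) (b := 0) (s := s) (T := 18 + n * 15)
    (c := .seq (degProg 9 4) (.seq (.assignIdx 11 (.add (.idx 11) (.idx 4)))
      (.ifLt (.int (.idx 10)) (.int (.idx 4)) (.assignIdx 10 (.idx 4)) .skip)))
    (R := fun i s' =>
      s'.idx 10 = ((Finset.range i).sup fun k => Nat.count (fun w => 0 < adjArr G k w) n) ∧
      s'.idx 11 = ∑ k ∈ Finset.range i, Nat.count (fun w => 0 < adjArr G k w) n)
    (by norm_num) rfl (by simp [Store.setIdx_idx, h10, h11]) ?_
  · rw [h0] at key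
    exact key.mono_time (by rw [show 18 + n * 15 + 5 = 23 + n * 15 by omega])
  rintro i s1 hi h9 hF1 ⟨hR10, hR11⟩
  have h01 : s1.idx 0 = n := (hF1.idx rfl).trans h0
  have ha1 : s1.arr 0 = adjArr G := (hF1.arr rfl).trans ha
  have hdeg := safe_degProg (v := 9) (o := 4) (by norm_num) (by norm_num) (by norm_num)
    (by norm_num) s1
  rw [h01, ha1, h9] at hdeg
  rw [Finset.range_add_one, Finset.sup_insert, Finset.sum_insert (by simp), ← hR10, ← hR11]
  set d := Nat.count (fun w => 0 < adjArr G i w) n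
  refine (Safe.seq hdeg (T' := 11) fun s2 hF2 h42 => ?_).mono_time (by omega)
  have h102 : s2.idx 10 = s1.idx 10 := hF2.idx rfl
  have h112 : s2.idx 11 = s1.idx 11 := hF2.idx rfl
  refine (Safe.seq (Safe.assignIdx (Q := fun s' => s' = s2.setIdx 11 (s2.idx 11 + s2.idx 4)) rfl)
    (T' := 7) ?_).mono_time (by simp [IExpr.cost])
  rintro s3 - rfl
  refine (Safe.ifLt (fun hlt => Safe.assignIdx ?_) fun hge => Safe.skip ?_).mono_time
    (by simp [Expr.cost, IExpr.cost])
  · simp only [Expr.eval, IExpr.eval, Store.setIdx_idx, Nat.cast_lt] at hlt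
    simp only [IExpr.eval, Store.setIdx_idx]
    norm_num at hlt ⊢
    omega
  · simp only [Expr.eval, IExpr.eval, Store.setIdx_idx, Nat.cast_lt] at hge
    simp only [Store.setIdx_idx]
    norm_num at hge ⊢
    omega

theorem eval_mixExpr {s : Store} (h0 : s.idx 0 = n) (h10 : s.idx 10 = G.maxDegree)
    (h11 : s.idx 11 = 2 * G.edgeFinset.card) :
    mixExpr.eval s = mixBound G (s.var 3) (s.var 1 / (16 * (2 * n + 1))) := by
  simp only [mixExpr, Expr.eval, IExpr.eval, h0, h10, h11, mixBound, Fintype.card_fin]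
  push_cast
  rw [mul_div_cancel_left₀ _ (two_ne_zero' ℝ)]
  ring

/-- The number of runs that are averaged. -/
def numRuns (n : ℕ) (ε : ℝ) : ℕ := 20 * ⌈(2 * n + 1) * (ε ^ 2)⁻¹ + 1⌉₊

/-- The number of means of which the median is taken. -/
def numMeans (η : ℝ) : ℕ := 7 * ⌈Real.log η⁻¹⌉₊ + 1

theorem safe_setupProg (β ε η : ℝ) :
    Safe setupProg (input G β ε η)
      (fun s => Env G (Real.tanh β) s ∧
        s.var 4 = mixBound G (Real.tanh β) (ε / (16 * (2 * n + 1))) ∧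
        s.idx 13 = numRuns n ε ∧ s.idx 12 = numMeans η ∧ s.idx 15 = 0 ∧ s.var 7 = β)
      (200 + n * (23 + n * 15) + numRuns n ε + numMeans η) := by
  set s0 := input G β ε η
  set k₁ := ⌈(2 * n + 1) * (ε ^ 2)⁻¹ + 1⌉₊ with hk₁
  set k₂ := ⌈Real.log η⁻¹⌉₊ with hk₂
  have hN : numRuns n ε = 20 * k₁ := rfl
  have hK : numMeans η = 7 * k₂ + 1 := rfl
  refine (Safe.seq (Safe.assign (Q := fun s' => s' = s0.setVar 7 β) rfl)
    (T' := 197 + n * (23 + n * 15) + k₁ * 5 + k₂ * 5) fun s1 hF1 h1 => ?_).mono_time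
    (by simp only [Expr.cost]; omega)
  refine (Safe.seq (Safe.assign (Q := fun s' => s'.var 3 = Real.tanh β) ?_)
    (T' := 179 + n * (23 + n * 15) + k₁ * 5 + k₂ * 5) fun s2 hF2 h2 => ?_).mono_time
    (by simp only [Expr.cost, IExpr.cost, tanhExpr]; omega)
  · simp only [eval_tanhExpr, Store.setVar_var, if_true]
    rw [hF1.var rfl]
    rfl
  have hi2 : ∀ i, s2.idx i = s0.idx i := fun i => (hF2.idx rfl).trans (hF1.idx rfl)
  have ha2 : s2.arr 0 = adjArr G :=
    ((hF2.arr rfl).trans (hF1.arr rfl)).trans (input_arr_zero G β ε η)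
  have h72 : s2.var 7 = β := by
    rw [hF2.var rfl, h1]
    rfl
  refine (Safe.seq (safe_degreesProg (G := G) (hi2 0) ha2 (hi2 10) (hi2 11))
    (T' := 170 + k₁ * 5 + k₂ * 5) fun s3 hF3 h3 => ?_).mono_time (by omega)
  have h03 : s3.idx 0 = n := (hF3.idx rfl).trans (hi2 0)
  have hv3 : s3.var 3 = Real.tanh β := (hF3.var rfl).trans h2
  have h13 : s3.var 1 = ε := (hF3.var rfl).trans ((hF2.var rfl).trans (hF1.var rfl))
  refine (Safe.seq (Safe.assign
    (Q := fun s' => s'.var 4 = mixBound G (Real.tanh β) (ε / (16 * (2 * n + 1)))) ?_)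
    (T' := 40 + k₁ * 5 + k₂ * 5) fun s4 hF4 h4 => ?_).mono_time
    (by simp only [Expr.cost, IExpr.cost, mixExpr]; omega)
  · rw [eval_mixExpr h03 h3.1 h3.2, hv3, h13]
    simp [Store.setVar_var]
  have hE4 : Env G (Real.tanh β) s4 :=
    ⟨(hF4.idx rfl).trans h03, (hF4.arr rfl).trans ((hF3.arr rfl).trans ha2), (hF4.var rfl).trans hv3⟩
  have h14 : s4.var 1 = ε := (hF4.var rfl).trans h13
  have h24 : s4.var 2 = η := by rw [hF4.var rfl, hF3.var rfl, hF2.var rfl, hF1.var rfl]; rfl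
  -- Reals cannot be rounded, but a loop with a real bound runs ⌈bound⌉ times; counting its
  -- iterations in steps of 20 produces the number of runs. The number of means arises in the same
  -- way, in steps of 7.
  refine (Safe.seq (Safe.loop (k := k₁) (T := 4) (R := fun i s' => s'.idx 13 = 20 * i) ?_ ?_ ?_)
    (T' := 20 + k₂ * 5) fun s5 hF5 h5 => ?_).mono_time
    (by simp only [Expr.cost, IExpr.cost]; omega)
  · simp only [Expr.eval, IExpr.eval, hE4.idx0, h14, hk₁]
    push_cast
    rw [div_eq_mul_inv, sq]
  · rw [hF4.idx rfl, hF3.idx rfl, hi2]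
    rfl
  · intro i s' _ _ hR
    refine (Safe.assignIdx ?_).mono_time (by simp [IExpr.cost])
    simp only [IExpr.eval, Store.setIdx_idx, hR, if_true]
    omega
  refine (Safe.seq (Safe.loop (k := k₂) (T := 4) (R := fun i s' => s'.idx 12 = 7 * i) ?_ ?_ ?_)
    (T' := 5) fun s6 hF6 h6 => ?_).mono_time
    (by simp only [Expr.cost, IExpr.cost]; omega)
  · simp only [Expr.eval, IExpr.eval, hF5.var (x := 2) rfl, h24, hk₂]
    rw [Nat.cast_one, one_div]
  · rw [hF5.idx rfl, hF4.idx rfl, hF3.idx rfl, hi2]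
    rfl
  · intro i s' _ _ hR
    refine (Safe.assignIdx ?_).mono_time (by simp [IExpr.cost])
    simp only [IExpr.eval, Store.setIdx_idx, hR, if_true]
    omega
  refine (Safe.assignIdx (Q := fun s' => s' = s6.setIdx 12 (7 * k₂ + 1))
    (by simp only [IExpr.eval, h6])).mono (by simp [IExpr.cost]) fun s7 hF7 h7 => ?_
  refine ⟨((hE4.of_frame hF5).of_frame hF6).of_frame hF7, ?_, ?_, ?_, ?_, ?_⟩
  · rw [hF7.var rfl, hF6.var rfl, hF5.var rfl, h4]
  · rw [hF7.idx rfl, hF6.idx rfl, h5]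
    rfl
  · rw [h7]
    rfl
  · rw [hF7.idx rfl, hF6.idx rfl, hF5.idx rfl, hF4.idx rfl, hF3.idx rfl, hi2]
    rfl
  · rw [hF7.var rfl, hF6.var rfl, hF5.var rfl, hF4.var rfl, hF3.var rfl, h72]

/-! ### The whole program and the law of its output -/

/-- The program of the median-of-means estimator, which is left in the real variable `0`. The input
`β` is kept in the real variable `7`. -/
def mainProg : Program :=
  .seq setupProg (.seq (.loop (.int (.idx 12)) meanProg)
    (.seq medianProg (.assign 0 (.div (.add (.var 8) (.var 9)) (.int (.lit 2))))))

/-- A bound for the time of `mainProg`, in terms of the numbers of vertices, steps of the chain,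
runs and means. -/
def mainTime (n k N K : ℕ) : ℕ :=
  300 + n * (23 + n * 15) + N + K + K * (meanTime n k N + 1) + K * (50 + K * 27)

theorem impl_mainProg {β ε η : ℝ} (h : Admissible G β ε η) :
    Impl (mainProg.run (input G β ε η))
      (iid ((iid (oneSample G (Real.tanh β) (oddClass G 0) (2 * n + 1) ε ∅) (numRuns n ε)).map mean)
        (numMeans η))
      (fun l s => s.var 0 = median l ∧ s.var 7 = β)
      (mainTime n ⌈mixBound G (Real.tanh β) (ε / (16 * (2 * n + 1)))⌉₊ (numRuns n ε)
        (numMeans η)) := by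
  have hn : 0 < n := by
    have := h.two_le_card
    rw [Fintype.card_fin] at this
    omega
  have hnb : ∀ u, (G.neighborFinset u).Nonempty := fun u => by
    rw [← Finset.card_pos, G.card_neighborFinset_eq_degree]
    exact degree_pos_of_connected h.two_le_card h.connected u
  have hpos : 0 < numMeans η := Nat.succ_pos _
  generalize hN : numRuns n ε = N
  generalize hK : numMeans η = K at hpos ⊢
  generalize hk : ⌈mixBound G (Real.tanh β) (ε / (16 * (2 * n + 1)))⌉₊ = k
  refine (Impl.safe_seq (safe_setupProg β ε η)
    (T' := 20 + K * (meanTime n k N + 1) + K * (50 + K * 27)) ?_).mono_time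
    (by rw [hN, hK, mainTime]; omega)
  rintro s1 - ⟨hE, h4, h13, h12, h15, h7⟩
  have hloop := impl_loop_meanProg hn hnb hE h4 h13 h12 h15
  rw [hN, hK, hk] at hloop
  -- The support gives the length of the list of means, which the computation of the median needs.
  have hseq := hloop.support.seq
    (d := .seq medianProg (.assign 0 (.div (.add (.var 8) (.var 9)) (.int (.lit 2)))))
    (ν := PMF.pure) (R' := fun l s => s.var 0 = median l ∧ s.var 7 = β)
    (T' := 12 + K * (50 + K * 27)) fun l s2 hF2 hl => ?_
  · rw [PMF.bind_pure] at hseq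
    exact hseq.mono_time (by omega)
  obtain ⟨hls, hl⟩ := hl
  have hlen := length_of_mem_support_iid hls
  have hmed := safe_medianProg (s := s2) (l := l) (by rw [hF2.idx rfl, h12, hlen, hK])
    (by rw [hlen]; exact hpos) hl
  rw [hlen] at hmed
  refine Impl.of_safe ((Safe.seq hmed (T' := 7) fun s3 hF3 h3 =>
    (Safe.assign ?_).mono_time (by simp [Expr.cost, IExpr.cost])).mono_time (by omega))
  refine ⟨?_, ?_⟩
  · simp only [Store.setVar_var, Expr.eval, IExpr.eval, h3.1, h3.2, median, hlen, if_true]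
    norm_num
  · simp only [Store.setVar_var]
    rw [if_neg (by norm_num), hF3.var rfl, hF2.var rfl, h7]

theorem output_mainProg {β ε η : ℝ} (h : Admissible G β ε η) :
    mainProg.output (input G β ε η) = evenEstimator G β ε η ∅ := by
  rw [(impl_mainProg h).output_eq (f := median) fun l s hl => hl.1, evenEstimator, estimator,
    Fintype.card_fin]
  rfl

end Main

/-! ### The running time -/

/-- The dominant term is means × runs × steps × time per step, of order B · B² · B¹⁴ · B = B¹⁸, with
coefficient 15 · 100 · 113 · 186 ≈ 3.2 · 10⁷ once lower powers are included in the time per step. -/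
theorem mainTime_le {n k N K : ℕ} {B : ℝ} (hB : 1 ≤ B) (hn : n ≤ B) (hk : k ≤ 113 * B ^ 14)
    (hN : N ≤ 100 * B ^ 2) (hK : K ≤ 15 * B) :
    (mainTime n k N K : ℝ) ≤ 40000000 * B ^ 18 := by
  have hB0 : 0 ≤ B := by linarith
  have hp : ∀ i ≤ 18, B ^ i ≤ B ^ 18 := fun i hi => pow_le_pow_right₀ hB hi
  calc (mainTime n k N K : ℝ)
      = 300 + n * (23 + n * 15) + N + K + K * (17 + N * (26 + n * (10 + n * 10) +
          k * (134 + n * 52) + 1) + 1) + K * (50 + K * 27) := by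
        simp only [mainTime, meanTime, sampleTime]
        push_cast
        ring
    _ ≤ 300 + B * (23 + B * 15) + 100 * B ^ 2 + 15 * B + 15 * B * (17 + 100 * B ^ 2 *
          (26 + B * (10 + B * 10) + 113 * B ^ 14 * (134 + B * 52) + 1) + 1) +
          15 * B * (50 + 15 * B * 27) := by gcongr
    _ ≤ 40000000 * B ^ 18 := by
        have h0 := hp 0 (by norm_num)
        have h1 := hp 1 (by norm_num)
        have h2 := hp 2 (by norm_num)
        have h3 := hp 3 (by norm_num)
        have h4 := hp 4 (by norm_num)
        have h5 := hp 5 (by norm_num)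
        have h17 := hp 17 (by norm_num)
        rw [pow_zero] at h0
        rw [pow_one] at h1
        ring_nf
        linarith

section Time

variable {n : ℕ} {G : SimpleGraph (Fin n)} [DecidableRel G.Adj]

/-- The factors are bounded one by one, using log y ≤ y, Δ ≤ n and m ≤ n²: the bracket is at most 8B
+ 48B, where 48B comes from 1/δ = 16(2n+1)/ε, and the product is (B/2)(56B)(4B) · B · B⁶ · B⁴. -/
theorem mixBound_le {x ε B : ℝ} (hV : 2 ≤ n) (hG : G.Connected) (hx : 0 < x) (hx1 : x < 1)
    (hε : 0 < ε) (hε1 : ε < 1) (hB : 1 ≤ B) (hn : n ≤ B) (hxB : x⁻¹ ≤ B) (hεB : n * ε⁻¹ ≤ B) :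
    mixBound G x (ε / (16 * (2 * n + 1))) ≤ 112 * B ^ 14 := by
  have hn1 : (1 : ℝ) ≤ n := by exact_mod_cast (by omega : 1 ≤ n)
  have hm1 : (1 : ℝ) ≤ G.edgeFinset.card := by
    exact_mod_cast card_edgeFinset_pos (by rwa [Fintype.card_fin]) hG
  have hm2 : (G.edgeFinset.card : ℝ) ≤ n ^ 2 := by
    have h1 := G.card_edgeFinset_le_card_choose_two
    rw [Fintype.card_fin] at h1
    exact_mod_cast h1.trans (Nat.choose_le_pow n 2)
  have hΔ : (G.maxDegree : ℝ) ≤ n := by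
    have : G.maxDegree ≤ n := G.maxDegree_le_of_forall_degree_le _ fun u => by
      have := G.degree_lt_card_verts u
      rw [Fintype.card_fin] at this
      exact this.le
    exact_mod_cast this
  have hx1' : 1 ≤ x⁻¹ := (one_le_inv₀ hx).2 hx1.le
  set δ := ε / (16 * (2 * n + 1)) with hδ
  have hδ0 : 0 < δ := by positivity
  have hδ1 : δ ≤ 1 := by
    rw [hδ, div_le_one (by positivity)]
    linarith
  have hlogδ : Real.log δ ≤ 0 := Real.log_nonpos hδ0.le hδ1
  have hlogδ' : -Real.log δ ≤ 48 * B := by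
    rw [← Real.log_inv]
    refine (Real.log_le_self (inv_nonneg.2 hδ0.le)).trans ?_
    rw [hδ, inv_div, div_eq_mul_inv]
    have : 0 < ε⁻¹ := inv_pos.2 hε
    nlinarith
  have hlogx : 0 ≤ Real.log (8 / x) := Real.log_nonneg (by rw [le_div_iff₀ hx]; linarith)
  have hlogx' : Real.log (8 / x) ≤ 8 * B := by
    refine (Real.log_le_self (by positivity)).trans ?_
    rw [div_eq_mul_inv]
    linarith
  have hq0 : Real.log δ / G.edgeFinset.card ≤ 0 := div_nonpos_of_nonpos_of_nonneg hlogδ (by linarith)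
  have hq : Real.log δ ≤ Real.log δ / G.edgeFinset.card := by
    rw [le_div_iff₀ (by linarith)]
    nlinarith
  have hmid0 : 0 ≤ Real.log (8 / x) - Real.log δ / G.edgeFinset.card := by linarith
  have hmid : Real.log (8 / x) - Real.log δ / G.edgeFinset.card ≤ 56 * B := by linarith
  have hfst : 1 / (2 * x) ≤ B / 2 := by
    rw [one_div, mul_inv]
    linarith
  have hthd : 3 + 1 / (G.edgeFinset.card * x) ≤ 4 * B := by
    have : (1 : ℝ) / (G.edgeFinset.card * x) ≤ x⁻¹ := by
      rw [one_div, mul_inv]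
      exact mul_le_of_le_one_left (by linarith) (inv_le_one_of_one_le₀ hm1)
    linarith
  rw [mixBound, Fintype.card_fin]
  calc _ ≤ B / 2 * (56 * B) * (4 * B) * B * B ^ 6 * (B ^ 2) ^ 2 := by
        gcongr
        · exact hΔ.trans hn
        · exact hm2.trans (by gcongr)
    _ = 112 * B ^ 14 := by ring

theorem runsWithin_of_impl {α : Type*} {c : Program} {s : Store} {μ : PMF α}
    {R : α → Store → Prop} {T : ℕ} {t : ℝ} (h : Impl (c.run s) μ R T) (ht : (T : ℝ) ≤ t) :
    c.RunsWithin s t := fun _ hr => (Nat.cast_le.2 (h.time_le hr)).trans ht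

theorem mainTime_le_of_admissible {β ε η : ℝ} (h : Admissible G β ε η) :
    (mainTime n ⌈mixBound G (Real.tanh β) (ε / (16 * (2 * n + 1)))⌉₊ (numRuns n ε)
      (numMeans η) : ℝ) ≤ 40000000 * (n * ε⁻¹ * η⁻¹ * (Real.tanh β)⁻¹) ^ 18 := by
  have hV := h.two_le_card
  rw [Fintype.card_fin] at hV
  have hn1 : (1 : ℝ) ≤ n := by exact_mod_cast (by omega : 1 ≤ n)
  have hx := tanh_pos_of_pos h.beta_pos
  have hx1 := tanh_lt_one' β
  have hε := h.eps_pos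
  have hη := h.eta_pos
  have hε1 : ε < 1 := by linarith [h.eps_lt]
  have hη1 : η < 1 := by linarith [h.eta_lt]
  set x := Real.tanh β
  have ex : 1 ≤ x⁻¹ := (one_le_inv₀ hx).2 hx1.le
  have eε : 1 ≤ ε⁻¹ := (one_le_inv₀ hε).2 hε1.le
  have eη : 1 ≤ η⁻¹ := (one_le_inv₀ hη).2 hη1.le
  -- All four factors are at least 1, so this product dominates each of them and every partial
  -- product.
  set B := n * ε⁻¹ * η⁻¹ * x⁻¹ with hBdef
  have h1 : (n : ℝ) ≤ n * ε⁻¹ := le_mul_of_one_le_right (by linarith) eε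
  have h2 : n * ε⁻¹ ≤ n * ε⁻¹ * η⁻¹ := le_mul_of_one_le_right (by linarith) eη
  have h3 : n * ε⁻¹ * η⁻¹ ≤ B := le_mul_of_one_le_right (by linarith) ex
  have h4 : x⁻¹ ≤ B := le_mul_of_one_le_left (by linarith) (by linarith)
  have h5 : η⁻¹ ≤ B := (le_mul_of_one_le_left (by linarith) (by linarith)).trans h3
  have hB : 1 ≤ B := by linarith
  have hB2 : B ≤ B ^ 2 := by nlinarith
  refine mainTime_le hB (by linarith) ?_ ?_ ?_
  · have := mixBound_le hV h.connected hx hx1 hε hε1 hB (by linarith) h4 (by linarith)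
    have h6 : (⌈112 * B ^ 14⌉₊ : ℝ) < 112 * B ^ 14 + 1 := Nat.ceil_lt_add_one (by positivity)
    have h7 := one_le_pow₀ hB (n := 14)
    exact (Nat.cast_le.2 (Nat.ceil_le_ceil this)).trans (by linarith)
  · have hc : (⌈(2 * n + 1) * (ε ^ 2)⁻¹ + 1⌉₊ : ℝ) < (2 * n + 1) * (ε ^ 2)⁻¹ + 1 + 1 :=
      Nat.ceil_lt_add_one (by positivity)
    have h6 : (2 * n + 1) * (ε ^ 2)⁻¹ ≤ 3 * B ^ 2 := by
      calc (2 * n + 1) * (ε ^ 2)⁻¹ ≤ 3 * (n * n) * (ε ^ 2)⁻¹ := by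
            gcongr
            nlinarith
        _ = 3 * (n * ε⁻¹) ^ 2 := by
            rw [mul_pow, inv_pow]
            ring
        _ ≤ 3 * B ^ 2 := by gcongr; linarith
    rw [numRuns]
    push_cast
    linarith
  · have hl : 0 ≤ Real.log η⁻¹ := Real.log_nonneg eη
    have hc : (⌈Real.log η⁻¹⌉₊ : ℝ) < Real.log η⁻¹ + 1 := Nat.ceil_lt_add_one hl
    have h6 := Real.log_le_self (x := η⁻¹) (by linarith)
    rw [numMeans]
    push_cast
    linarith

end Time

/-! ### The approximation schemes -/

/-- Run `c` if `n ^ 2 * tanh β < ε`, and `d` otherwise. -/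
def ifSmall (c d : Program) : Program :=
  .ifLt (.mul tanhExpr (.mul (.int (.idx 0)) (.int (.idx 0)))) (.var 1) c d

/-- The scheme for the probability of the even subgraphs: if `n ^ 2 * tanh β < ε`, then `1` is
accurate enough. -/
def evenProg : Program := ifSmall (.assign 0 (.int (.lit 1))) mainProg

/-- The scheme for the susceptibility: if `n ^ 2 * tanh β < ε`, then `β` is accurate enough. -/
def susceptibilityProg : Program :=
  ifSmall .skip (.seq (.assign 1 (.div (.var 1) (.int (.lit 2))))
    (.seq mainProg (.assign 0 (.div (.var 7) (.var 0)))))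

theorem output_charge (k : ℕ) (p : PMF (Store × ℕ)) :
    (charge k p).map (fun r => r.1.var 0) = p.map fun r => r.1.var 0 := by
  rw [charge, PMF.map_comp]
  rfl

section Schemes

variable {n : ℕ} {G : SimpleGraph (Fin n)} [DecidableRel G.Adj] {β ε η : ℝ}

theorem run_ifSmall (c d : Program) :
    (ifSmall c d).run (input G β ε η) =
      charge 25 (if Real.tanh β * (n * n) < ε then c.run (input G β ε η)
        else d.run (input G β ε η)) := by
  rw [ifSmall, Program.run]
  simp only [Expr.eval, eval_tanhExpr, IExpr.eval]
  rfl

theorem output_ifSmall (c d : Program) :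
    (ifSmall c d).output (input G β ε η) =
      if Real.tanh β * (n * n) < ε then c.output (input G β ε η)
        else d.output (input G β ε η) := by
  rw [Program.output, run_ifSmall, output_charge]
  split_ifs <;> rfl

theorem runsWithin_ifSmall {c d : Program} {t : ℝ}
    (hc : Real.tanh β * (n * n) < ε → c.RunsWithin (input G β ε η) t)
    (hd : ¬Real.tanh β * (n * n) < ε → d.RunsWithin (input G β ε η) t) :
    (ifSmall c d).RunsWithin (input G β ε η) (25 + t) := by
  intro r hr
  rw [run_ifSmall] at hr
  obtain ⟨k, hk, hrk⟩ := mem_support_charge hr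
  rw [hrk]
  push_cast
  split_ifs at hk with h
  · linarith [hc h _ hk]
  · linarith [hd h _ hk]

theorem empty_mem_psSpace : ∅ ∈ psSpace G :=
  mem_psSpace.2 ⟨Finset.empty_subset _, Or.inl (by rw [oddSet_empty, Finset.card_empty])⟩

/-- Halving the real variable 1 turns the memory into exactly the input with accuracy ε/2, so the
analysis of `mainProg` applies unchanged. The final division uses the saved copy of β. -/
theorem impl_susceptibility_branch (h : Admissible G β ε η) :
    Impl ((Program.seq (.assign 1 (.div (.var 1) (.int (.lit 2))))
      (.seq mainProg (.assign 0 (.div (.var 7) (.var 0))))).run (input G β ε η))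
      (evenEstimator G β (ε / 2) η ∅) (fun y s => s.var 0 = β / y)
      (9 + mainTime n ⌈mixBound G (Real.tanh β) (ε / 2 / (16 * (2 * n + 1)))⌉₊ (numRuns n (ε / 2))
        (numMeans η)) := by
  refine (Impl.safe_seq (Safe.assign (Q := fun s => s = input G β (ε / 2) η) ?_)
    (T' := mainTime n ⌈mixBound G (Real.tanh β) (ε / 2 / (16 * (2 * n + 1)))⌉₊
      (numRuns n (ε / 2)) (numMeans η) + 4) ?_).mono_time
    (by simp only [Expr.cost, IExpr.cost]; omega)
  · simp only [Expr.eval, IExpr.eval, Store.setVar, input, Store.mk.injEq, true_and, and_true]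
    funext y
    by_cases hy : y = 1 <;> simp [hy]
  · rintro s - rfl
    have := (impl_mainProg h.half).seq (d := .assign 0 (.div (.var 7) (.var 0))) (T' := 4)
      (ν := fun l => PMF.pure (median l)) (R' := fun y s => s.var 0 = β / y) fun l s _ hl =>
        Impl.of_safe (Safe.assign (by
          simp [Store.setVar_var, Expr.eval, hl.1, hl.2]))
    convert this using 1
    rw [evenEstimator, estimator, Fintype.card_fin]
    rfl

/-- From 1 ≤ (1 + n²x) π(C₀), with n²x < ε. The two lower bounds serve the constant answer 1 for
π(C₀) and the constant answer β for χ. -/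
theorem evenProb_accurate_of_small (h : Admissible G β ε η) (hx : Real.tanh β * (n * n) < ε) :
    1 ≤ (1 + ε) * evenProb G β ∧ 1 - ε ≤ evenProb G β ∧ evenProb G β ≤ 1 := by
  have hV : 0 < Fintype.card (Fin n) := by linarith [h.two_le_card]
  have hp := evenProb_pos (G := G) hV h.beta_pos
  have h1 := one_le_mul_evenProb (G := G) hV h.beta_pos
  rw [Fintype.card_fin] at h1
  have h2 : 1 ≤ (1 + ε) * evenProb G β := by nlinarith
  refine ⟨h2, ?_, evenProb_le_one hV h.beta_pos⟩
  nlinarith [evenProb_le_one (G := G) hV h.beta_pos, h.eps_pos]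

theorem le_toOuterMeasure_pure {y η : ℝ} (hη : 0 < η) {S : Set ℝ} (hy : y ∈ S) :
    ENNReal.ofReal (1 - η) ≤ (PMF.pure y).toOuterMeasure S := by
  rw [PMF.toOuterMeasure_pure_apply, if_pos hy]
  exact ENNReal.ofReal_le_one.2 (by linarith)

/-- The polynomial that bounds the running time of the schemes. -/
def timePoly : MvPolynomial (Fin 3) ℝ :=
  25 + (9 + 40000000 * (2 * (MvPolynomial.X 0 * MvPolynomial.X 1 * MvPolynomial.X 2) ^ 3) ^ 18)

theorem eval_timePoly (a b c : ℝ) :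
    MvPolynomial.eval ![a, b, c] timePoly =
      25 + (9 + 40000000 * (2 * (a * b * c) ^ 3) ^ 18) := by
  simp [timePoly]

/-- When the shortcut is not taken, 1/x ≤ n²/ε, which is at most the square of n/(εη). This removes
the temperature from the running time. -/
theorem parameters_le (h : Admissible G β ε η) (hx : ¬Real.tanh β * (n * n) < ε) :
    n * ε⁻¹ * η⁻¹ * (Real.tanh β)⁻¹ ≤ (n * ε⁻¹ * η⁻¹) ^ 3 := by
  have hx0 := tanh_pos_of_pos h.beta_pos
  have hε := h.eps_pos
  have hη := h.eta_pos
  have eε : 1 ≤ ε⁻¹ := (one_le_inv₀ hε).2 (by linarith [h.eps_lt])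
  have eη : 1 ≤ η⁻¹ := (one_le_inv₀ hη).2 (by linarith [h.eta_lt])
  have hx' : (Real.tanh β)⁻¹ ≤ n * n * ε⁻¹ := by
    rw [inv_le_iff_one_le_mul₀ hx0, mul_right_comm, ← div_eq_mul_inv, one_le_div hε]
    linarith
  have h1 : n * n * ε⁻¹ ≤ (n * ε⁻¹ * η⁻¹) ^ 2 := by
    calc n * n * ε⁻¹ = n * n * ε⁻¹ * 1 * 1 := by ring
      _ ≤ n * n * ε⁻¹ * ε⁻¹ * η⁻¹ ^ 2 := by
          gcongr
          exact one_le_pow₀ eη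
      _ = (n * ε⁻¹ * η⁻¹) ^ 2 := by ring
  calc n * ε⁻¹ * η⁻¹ * (Real.tanh β)⁻¹ ≤ n * ε⁻¹ * η⁻¹ * (n * ε⁻¹ * η⁻¹) ^ 2 := by
        gcongr
        exact hx'.trans h1
    _ = (n * ε⁻¹ * η⁻¹) ^ 3 := by ring

theorem isFPRAS_evenProg : IsFPRAS evenProg fun G _ β => evenProb G β := by
  refine ⟨timePoly, fun n G _ β ε η h => ⟨?_, ?_⟩⟩
  · rw [eval_timePoly]
    have := h.eps_pos
    have := h.eta_pos
    have hpow : 0 ≤ (2 * (n * ε⁻¹ * η⁻¹) ^ 3) ^ 18 := by positivity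
    refine runsWithin_ifSmall (fun _ => ?_) fun hx => ?_
    · refine runsWithin_of_impl (Impl.of_safe (R := fun _ _ => True) (a := ())
        (Safe.assign trivial)) ?_
      simp only [Expr.cost, IExpr.cost]
      norm_num
      linarith
    · refine runsWithin_of_impl (impl_mainProg h) ((mainTime_le_of_admissible h).trans ?_)
      have hx0 := tanh_pos_of_pos h.beta_pos
      have hle : (n * ε⁻¹ * η⁻¹ * (Real.tanh β)⁻¹) ^ 18 ≤ (2 * (n * ε⁻¹ * η⁻¹) ^ 3) ^ 18 := by
        refine pow_le_pow_left₀ (by positivity) ((parameters_le h hx).trans ?_) _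
        have : 0 ≤ (n * ε⁻¹ * η⁻¹) ^ 3 := by positivity
        linarith
      linarith
  · rw [evenProg, output_ifSmall]
    split_ifs with hx
    · rw [Program.output, Program.run, PMF.pure_map]
      refine le_toOuterMeasure_pure h.eta_pos ?_
      obtain ⟨h1, -, h3⟩ := evenProb_accurate_of_small h hx
      simp only [Store.setVar_var, Expr.eval, IExpr.eval, if_true, Nat.cast_one]
      refine ⟨?_, h1⟩
      nlinarith [h.eps_pos, h.eps_lt,
        evenProb_pos (G := G) (by linarith [h.two_le_card]) h.beta_pos]
    · rw [output_mainProg h]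
      exact evenEstimator_accurate h empty_mem_psSpace

theorem isFPRAS_susceptibilityProg :
    IsFPRAS susceptibilityProg fun G _ β => susceptibility G β := by
  refine ⟨timePoly, fun n G _ β ε η h => ⟨?_, ?_⟩⟩
  · rw [eval_timePoly]
    have := h.eps_pos
    have := h.eta_pos
    have hpow : 0 ≤ (2 * (n * ε⁻¹ * η⁻¹) ^ 3) ^ 18 := by positivity
    refine runsWithin_ifSmall (fun _ => ?_) fun hx => ?_
    · refine runsWithin_of_impl (Impl.of_safe (R := fun _ _ => True) (a := ())
        (Safe.skip trivial)) ?_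
      norm_num
      linarith
    · refine runsWithin_of_impl (impl_susceptibility_branch h) ?_
      have h1 := mainTime_le_of_admissible h.half
      have hx0 := tanh_pos_of_pos h.beta_pos
      have hle : (n * (ε / 2)⁻¹ * η⁻¹ * (Real.tanh β)⁻¹) ^ 18 ≤
          (2 * (n * ε⁻¹ * η⁻¹) ^ 3) ^ 18 := by
        refine pow_le_pow_left₀ (by positivity) ?_ _
        have h2 := parameters_le h hx
        -- The inverse of ε/2 is 2/ε; this is the source of the factor 2 in `timePoly`.
        rw [inv_div, div_eq_mul_inv]
        linarith
      push_cast
      linarith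
  · rw [susceptibilityProg, output_ifSmall]
    split_ifs with hx
    · rw [Program.output, Program.run, PMF.pure_map]
      refine le_toOuterMeasure_pure h.eta_pos ?_
      obtain ⟨h1, h2, h3⟩ := evenProb_accurate_of_small h hx
      have hp := evenProb_pos (G := G) (by linarith [h.two_le_card]) h.beta_pos
      have hβ := h.beta_pos
      have hε := h.eps_pos
      change (1 - ε) * susceptibility G β ≤ β ∧ β ≤ (1 + ε) * susceptibility G β
      rw [susceptibility_eq hβ, ← mul_div_assoc, ← mul_div_assoc, div_le_iff₀ hp, le_div_iff₀ hp]
      constructor <;> nlinarith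
    · rw [(impl_susceptibility_branch h).output_eq (f := fun y => β / y) fun y s hs => hs,
        PMF.toOuterMeasure_map_apply]
      exact evenEstimator_accurate_susceptibility h empty_mem_psSpace

end Schemes

end

end Worm

theorem mainTheorem2 :
    -- `π(C₀) ≥ 1 / (2 n + 1)` and `χ = β / π(C₀)`
    (∀ (V : Type*) [Fintype V] [DecidableEq V] (G : SimpleGraph V) [DecidableRel G.Adj] (β : ℝ),
      2 ≤ Fintype.card V → G.Connected → 0 < β →
        1 / (2 * (Fintype.card V : ℝ) + 1) ≤ evenProb G β ∧
        susceptibility G β = β / evenProb G β) ∧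
    -- accuracy of the median-of-means estimator, from every initial state of the chain
    (∀ (V : Type*) [Fintype V] [DecidableEq V] (G : SimpleGraph V) [DecidableRel G.Adj]
      (β ε η : ℝ), Admissible G β ε η → ∀ A₀ ∈ psSpace G,
        ENNReal.ofReal (1 - η) ≤ (evenEstimator G β ε η A₀).toOuterMeasure
          {y | (1 - ε) * evenProb G β ≤ y ∧ y ≤ (1 + ε) * evenProb G β} ∧
        ENNReal.ofReal (1 - η) ≤ (evenEstimator G β (ε / 2) η A₀).toOuterMeasure
          {y | (1 - ε) * susceptibility G β ≤ β / y ∧ β / y ≤ (1 + ε) * susceptibility G β}) ∧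
    -- the estimator started at the empty set is carried out by one program, in time polynomial
    -- in `n`, `ε⁻¹`, `η⁻¹` and `x⁻¹`, where `x = tanh β`
    (∃ (p : Program) (Q : MvPolynomial (Fin 4) ℝ),
      ∀ (n : ℕ) (G : SimpleGraph (Fin n)) [DecidableRel G.Adj] (β ε η : ℝ),
        Admissible G β ε η →
          p.output (input G β ε η) = evenEstimator G β ε η ∅ ∧
          p.RunsWithin (input G β ε η)
            (MvPolynomial.eval ![(n : ℝ), ε⁻¹, η⁻¹, (Real.tanh β)⁻¹] Q)) ∧
    -- there are schemes for `π(C₀)` and for `χ`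
    (∃ p : Program, IsFPRAS p fun G _ β => evenProb G β) ∧
    (∃ p : Program, IsFPRAS p fun G _ β => susceptibility G β) := by
  refine ⟨fun V _ _ G _ β hV hG hβ => ⟨?_, susceptibility_eq hβ⟩,
    fun V _ _ G _ β ε η h A₀ hA =>
      ⟨evenEstimator_accurate h hA, evenEstimator_accurate_susceptibility h hA⟩,
    ⟨mainProg, 40000000 * (MvPolynomial.X 0 * MvPolynomial.X 1 * MvPolynomial.X 2 *
      MvPolynomial.X 3) ^ 18, fun n G _ β ε η h => ⟨output_mainProg h, ?_⟩⟩,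
    ⟨evenProg, isFPRAS_evenProg⟩, ⟨susceptibilityProg, isFPRAS_susceptibilityProg⟩⟩
  · have hn : (0 : ℝ) < Fintype.card V := by exact_mod_cast (by omega : 0 < Fintype.card V)
    refine le_trans ?_ (one_div_card_le_evenProb (by omega) hβ)
    exact one_div_le_one_div_of_le hn (by linarith)
  · refine runsWithin_of_impl (impl_mainProg h) ((mainTime_le_of_admissible h).trans_eq ?_)
    simp
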